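/- Let $F$ be a non-archimedean local field with ring of integers $\mathfrak o$, maximal ideal $\mathfrak p$, uniformizer $\varpi$, and let $\psi$ be an additive character of $F$ with conductor $\mathfrak o$ (i.e. $\psi|_{a\mathfrak o}=1$ iff $a\in\mathfrak o$). Let $G=\mathrm{GL}_{2n}(F)$, $P\subset G$ the upper triangular Borel subgroup with modular character $\delta=(|\cdot|^{2n-1},|\cdot|^{2n-3},\dots,|\cdot|^{-2n+1})$, $K=\mathrm{GL}_{2n}(\mathfrak o)$, and $B\subset K$ the Iwahori subgroup of matrices that are upper triangular modulo $\mathfrak p$. For an unramified character $\chi$ of $P$ let $I(\chi)$ be the space of locally constant $f:G\to\mathbb C$ with $f(pg)=\chi\delta^{1/2}(p)f(g)$ for $p\in P$, on which $G$ acts by right translation $R$, and let $\phi_B\in I(\chi)$ be the function supported on $PB$ with $\phi_B(pb)=\chi\delta^{1/2}(p)$. A Shalika functional on $I(\chi)$ is a linear functional $\Lambda$ with $\Lambda(R_s v)=\psi(\mathrm{tr}\,Y)\Lambda(v)$ for all $v\in I(\chi)$ and all $s=\begin{pmatrix} g&\\&g\end{pmatrix}\begin{pmatrix} 1&Y\\&1\end{pmatrix}$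 with $g\in \mathrm{GL}_n(F)$, $Y\in \mathrm{Mat}_n(F)$. Put $\xi=\begin{pmatrix}0&1\\w_0&0\end{pmatrix}$, where $w_0$ is the $n\times n$ antidiagonal permutation matrix, and $\Lambda_H(v)=\Lambda(R_{\xi^{-1}}v)$; call $\Lambda$ normalized if $\Lambda_H(\phi_B)=1$. Let $D=(\mathbb C^\times)^n$ be the torus whose point $t=(t_1,\dots,t_n)$ corresponds to the unramified character $\chi=(\chi_1,\dots,\chi_n,\chi_n^{-1},\dots,\chi_1^{-1})$ with Satake parameters $\chi_i(\varpi)=t_i$, and let $L$ be the field of rational functions on $D$. Let $X$ be the space of locally constant functions on $K$ that are left invariant under $P\cap K$; restriction to $K$ identifies every $I(\chi)$ with $X$. A rational family $\{\phi_\chi\}$, $\phi_\chi\in I(\chi)$, is an element $\phi\in L\otimes_{\mathbb C}X$; $\phi_\chi$ is its value at $\chi$, defined at the points where $\phi$ is regular. Then for almost all $\chi\in D$ there is a non-zero Shalika functional on $I(\chi)$, and the normalized Shalika functional, with associated $\Lambda_{H,\chi}$, exists and is unique; here "almost all" means: outside the zero set of some polynomial $Q\neq 0$ in $t_1,\dots,t_n$.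 Moreover, for every rational family $\{\phi_\chi\}$ the value $\Lambda_{H,\chi}(\phi_\chi)$ is a rational function of $\chi\in D$: there is $r\in L$ such that at every $\chi$ with $Q(\chi)\ne0$ at which the family is regular, $r$ is regular and $\Lambda_{H,\chi}(\phi_\chi)=r(\chi)$. -/

import Mathlib

open scoped ValuativeRel TensorProduct Matrix

noncomputable section

namespace Shalika

/-! ## The local field -/

section Field

variable (F : Type*) [Field F] [ValuativeRel F] [TopologicalSpace F]
  [IsNonarchimedeanLocalField F]

/-- The order `q` of the residue field. -/
def resCard : ℕ := Nat.card 𝓀[F]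

variable {F}

/-- The normalized additive valuation `F → ℤ` (a uniformizer has order `1`), with junk value
`ord 0 = 0`. -/
def ord (a : F) : ℤ :=
  -WithZero.log (IsNonarchimedeanLocalField.valueGroupWithZeroIsoInt F
    (ValuativeRel.valuation F a))

/-- The normalized absolute value `|a| = q ^ (-ord a)` of a nonzero `a`. -/
def absF (a : F) : ℝ := (resCard F : ℝ) ^ (-ord a)

/-- The conductor of the additive character `ψ` is the ring of integers `𝔬`: the fractional ideal
`a 𝔬` lies in the kernel of `ψ` if and only if `a ∈ 𝔬`. -/
def ConductorIsIntegers (ψ : AddChar F Circle) : Prop :=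
  ∀ a : F, (∀ x ∈ 𝒪[F], ψ (a * x) = 1) ↔ a ∈ 𝒪[F]

lemma ord_mul {a b : F} (ha : a ≠ 0) (hb : b ≠ 0) : ord (a * b) = ord a + ord b := by
  unfold ord
  rw [map_mul, map_mul, WithZero.log_mul]
  · ring
  · simpa using ha
  · simpa using hb

lemma ord_eq_zero {a : F} (h : ValuativeRel.valuation F a = 1) : ord a = 0 := by
  simp [ord, h]

lemma absF_mul {a b : F} (ha : a ≠ 0) (hb : b ≠ 0) : absF (a * b) = absF a * absF b := by
  unfold absF
  have hq : (resCard F : ℝ) ≠ 0 := by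
    have : 0 < Nat.card 𝓀[F] := Nat.card_pos
    exact_mod_cast this.ne'
  rw [ord_mul ha hb, neg_add, zpow_add₀ hq]

lemma absF_nonneg (a : F) : 0 ≤ absF a := by
  unfold absF
  positivity

end Field

/-! ## `GL_{2n}` and its subgroups

Rows and columns are indexed by `Fin n ⊕ Fin n`, in the order given by `pos`. -/

/-- The index set of the `2n` rows and columns. -/
abbrev Idx (n : ℕ) : Type := Fin n ⊕ Fin n

/-- The position `0, …, 2n - 1` of an index: the left summand comes first. -/
def pos {n : ℕ} (i : Idx n) : Fin (n + n) := finSumFinEquiv i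

/-- The group `GL_{2n}(R)`. -/
abbrev G (R : Type*) [CommRing R] (n : ℕ) : Type _ := GL (Idx n) R

/-- The Borel subgroup of upper triangular matrices. -/
def borelSubgroup (R : Type*) [CommRing R] (n : ℕ) : Subgroup (G R n) where
  carrier := {g | g.val.BlockTriangular pos}
  one_mem' := Matrix.blockTriangular_one
  mul_mem' ha hb := Matrix.BlockTriangular.mul ha hb
  inv_mem' {g} hg := by
    change (g⁻¹).val.BlockTriangular pos
    rw [Matrix.coe_units_inv]
    have : Invertible g.val := g.isUnit.invertible
    exact Matrix.blockTriangular_inv_of_blockTriangular hg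

lemma pos_injective {n : ℕ} : Function.Injective (pos (n := n)) := finSumFinEquiv.injective

lemma borel_diag_mul {R : Type*} [CommRing R] {n : ℕ} {p p' : G R n}
    (hp : p ∈ borelSubgroup R n) (hp' : p' ∈ borelSubgroup R n) (i : Idx n) :
    (p * p').val i i = p.val i i * p'.val i i := by
  rw [Units.val_mul, Matrix.mul_apply]
  refine Finset.sum_eq_single i (fun j _ hj => ?_) (by simp)
  rcases lt_or_gt_of_ne (fun h => hj (pos_injective h) : pos j ≠ pos i) with h | h
  · rw [hp h, zero_mul]
  · rw [hp' h, mul_zero]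

lemma borel_diag_mul_inv {R : Type*} [CommRing R] {n : ℕ} {p : G R n}
    (hp : p ∈ borelSubgroup R n) (i : Idx n) : p.val i i * (p⁻¹).val i i = 1 := by
  rw [← borel_diag_mul hp (inv_mem hp), mul_inv_cancel]
  simp

section Groups

variable (F : Type*) [Field F] [ValuativeRel F] [TopologicalSpace F]
  [IsNonarchimedeanLocalField F] (n : ℕ)

/-- The standard maximal compact subgroup `K = GL_{2n}(𝔬)` of `GL_{2n}(F)`. -/
def maxCompact : Subgroup (G F n) :=
  (Matrix.GeneralLinearGroup.map (n := Idx n) (algebraMap 𝒪[F] F)).range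

/-- The standard Iwahori subgroup: matrices of `K` that are upper triangular modulo the maximal
ideal. -/
def iwahori : Subgroup (G F n) :=
  ((borelSubgroup 𝓀[F] n).comap
    (Matrix.GeneralLinearGroup.map (n := Idx n) (IsLocalRing.residue 𝒪[F]))).map
    (Matrix.GeneralLinearGroup.map (n := Idx n) (algebraMap 𝒪[F] F))

variable {F n}

lemma iwahori_le_maxCompact : iwahori F n ≤ maxCompact F n := by
  rintro _ ⟨k, -, rfl⟩
  exact ⟨k, rfl⟩

lemma maxCompact_apply_mem {k : G F n} (hk : k ∈ maxCompact F n) (i j : Idx n) :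
    ValuativeRel.valuation F (k.val i j) ≤ 1 := by
  obtain ⟨k, rfl⟩ := hk
  exact (k.val i j).2

lemma valuation_diag_eq_one {p : G F n} (hp : p ∈ borelSubgroup F n) (hk : p ∈ maxCompact F n)
    (i : Idx n) : ValuativeRel.valuation F (p.val i i) = 1 := by
  have h := congrArg (ValuativeRel.valuation F) (borel_diag_mul_inv hp i)
  rw [map_mul, map_one] at h
  refine le_antisymm (maxCompact_apply_mem hk i i) ?_
  calc (1 : ValuativeRel.ValueGroupWithZero F) = _ := h.symm
    _ ≤ ValuativeRel.valuation F (p.val i i) * 1 := by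
        gcongr
        exact maxCompact_apply_mem (inv_mem hk) i i
    _ = _ := mul_one _

lemma isOpen_iwahori : IsOpen (iwahori F n : Set (G F n)) := by
  refine Subgroup.isOpen_of_mem_nhds (g := 1) _ ?_
  have hopen : IsOpen {x : F | ValuativeRel.valuation F x < 1} := by
    simpa using Valuation.isOpen_ball (R := F) 1
  let U : Set (G F n) := {g | ∀ i j, ValuativeRel.valuation F (g.val i j - (1 : Matrix _ _ F) i j) < 1
    ∧ ValuativeRel.valuation F ((g⁻¹).val i j - (1 : Matrix _ _ F) i j) < 1}
  have hUopen : IsOpen U := by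
    have : U = ⋂ i, ⋂ j, ({g : G F n | ValuativeRel.valuation F
        (g.val i j - (1 : Matrix _ _ F) i j) < 1} ∩
        {g | ValuativeRel.valuation F ((g⁻¹).val i j - (1 : Matrix _ _ F) i j) < 1}) := by
      ext g; simp [U]
    rw [this]
    refine isOpen_iInter_of_finite fun i => isOpen_iInter_of_finite fun j => ?_
    have h1 : Continuous fun g : G F n => g.val i j :=
      (Units.continuous_val).matrix_elem i j
    have h2 : Continuous fun g : G F n => (g⁻¹).val i j :=
      (Units.continuous_val.comp continuous_inv).matrix_elem i j
    exact (hopen.preimage (h1.sub continuous_const)).inter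
      (hopen.preimage (h2.sub continuous_const))
  refine Filter.mem_of_superset (hUopen.mem_nhds (by intro i j; simp)) ?_
  intro g hg
  have key : ∀ (x : F) (i j : Idx n), ValuativeRel.valuation F (x - (1 : Matrix _ _ F) i j) < 1 →
      x ∈ 𝒪[F] := by
    intro x i j hx
    have h1 : (1 : Matrix (Idx n) (Idx n) F) i j ∈ 𝒪[F] := by
      rw [Matrix.one_apply]
      split_ifs
      · exact one_mem _
      · exact zero_mem _
    have := add_mem (show x - (1 : Matrix _ _ F) i j ∈ 𝒪[F] from hx.le) h1
    simpa using this
  let A : Matrix (Idx n) (Idx n) 𝒪[F] := fun i j => ⟨g.val i j, key _ i j (hg i j).1⟩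
  let A' : Matrix (Idx n) (Idx n) 𝒪[F] := fun i j => ⟨(g⁻¹).val i j, key _ i j (hg i j).2⟩
  have hmul : A * A' = 1 := by
    ext i j
    have := congrFun (congrFun g.mul_inv i) j
    rw [Matrix.mul_apply] at this
    rw [Matrix.mul_apply]
    simp only [Matrix.one_apply] at this ⊢
    push_cast
    split_ifs at this ⊢ <;> simpa [A, A'] using this
  have hmul' : A' * A = 1 := by
    exact mul_eq_one_comm.mp hmul
  refine ⟨⟨A, A', hmul, hmul'⟩, ?_, ?_⟩
  · intro i j hij
    have hne : i ≠ j := by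
      rintro rfl
      exact lt_irrefl _ hij
    change IsLocalRing.residue 𝒪[F] (A i j) = 0
    rw [IsLocalRing.residue_eq_zero_iff]
    have := (hg i j).1
    rw [Matrix.one_apply_ne hne, sub_zero] at this
    rw [IsLocalRing.mem_maximalIdeal, mem_nonunits_iff]
    rw [Valuation.Integers.isUnit_iff_valuation_eq_one
      (Valuation.integer.integers (ValuativeRel.valuation F))]
    exact this.ne
  · ext i j
    rfl

end Groups

/-! ## Unramified principal series -/

section PrincipalSeries

variable {F : Type*} [Field F] [ValuativeRel F] [TopologicalSpace F]
  [IsNonarchimedeanLocalField F] {n : ℕ}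

/-- The unramified character `χ(p) = ∏ χ_i(p_{ii})` of the Borel subgroup, where the unramified
character `χ_i` of `Fˣ` is given by its Satake parameter `χ_i(ϖ)`. -/
def unramChar (χ : Idx n → ℂˣ) (p : G F n) : ℂ := ∏ i, (χ i : ℂ) ^ ord (p.val i i)

/-- The modular character `δ = (|·|^{2n-1}, |·|^{2n-3}, …, |·|^{-2n+1})` of the Borel subgroup. -/
def modulus (p : G F n) : ℝ :=
  ∏ i, absF (p.val i i) ^ (2 * (n : ℤ) - 1 - 2 * ((pos i : ℕ) : ℤ))

/-- The character `χ δ^{1/2}` of the Borel subgroup. -/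
def chiDelta (χ : Idx n → ℂˣ) (p : G F n) : ℂ := unramChar χ p * (Real.sqrt (modulus p) : ℂ)

lemma chiDelta_mul (χ : Idx n → ℂˣ) {p p' : G F n} (hp : p ∈ borelSubgroup F n)
    (hp' : p' ∈ borelSubgroup F n) : chiDelta χ (p * p') = chiDelta χ p * chiDelta χ p' := by
  have hne : ∀ {p : G F n}, p ∈ borelSubgroup F n → ∀ i, p.val i i ≠ 0 := fun hp i h => by
    simpa [h] using borel_diag_mul_inv hp i
  have h1 : unramChar χ (p * p') = unramChar χ p * unramChar χ p' := by
    unfold unramChar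
    rw [← Finset.prod_mul_distrib]
    refine Finset.prod_congr rfl fun i _ => ?_
    rw [borel_diag_mul hp hp', ord_mul (hne hp i) (hne hp' i), zpow_add₀ (χ i).ne_zero]
  have h2 : modulus (p * p') = modulus p * modulus p' := by
    unfold modulus
    rw [← Finset.prod_mul_distrib]
    refine Finset.prod_congr rfl fun i _ => ?_
    rw [borel_diag_mul hp hp', absF_mul (hne hp i) (hne hp' i), mul_zpow]
  have h3 : 0 ≤ modulus p := Finset.prod_nonneg fun i _ => zpow_nonneg (absF_nonneg _) _
  unfold chiDelta
  rw [h1, h2, Real.sqrt_mul h3]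
  push_cast
  ring

lemma chiDelta_eq_one (χ : Idx n → ℂˣ) {p : G F n} (hp : p ∈ borelSubgroup F n)
    (hk : p ∈ maxCompact F n) : chiDelta χ p = 1 := by
  simp [chiDelta, unramChar, modulus, absF, ord_eq_zero (valuation_diag_eq_one hp hk _)]

/-- The space of the unramified principal series `I(χ)` (normalized induction): locally constant
functions on `GL_{2n}(F)` with `f (p g) = χ δ^{1/2} (p) f (g)` for `p` in the Borel subgroup. -/
def I (F : Type*) [Field F] [ValuativeRel F] [TopologicalSpace F] [IsNonarchimedeanLocalField F]
    {n : ℕ} (χ : Idx n → ℂˣ) : Submodule ℂ (G F n → ℂ) where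
  carrier := {f | IsLocallyConstant f ∧
    ∀ p ∈ borelSubgroup F n, ∀ g, f (p * g) = chiDelta χ p * f g}
  zero_mem' := ⟨IsLocallyConstant.const 0, by simp⟩
  add_mem' {f f'} hf hf' := ⟨hf.1.add hf'.1, fun p hp g => by
    simp only [Pi.add_apply, hf.2 p hp, hf'.2 p hp]; ring⟩
  smul_mem' c f hf := ⟨hf.1.comp (c • ·), fun p hp g => by
    simp only [Pi.smul_apply, hf.2 p hp, smul_eq_mul]; ring⟩

/-- The action of `GL_{2n}(F)` on `I(χ)` by right translations, `(R_g f)(x) = f (x g)`. -/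
def principalSeries (χ : Idx n → ℂˣ) : Representation ℂ (G F n) (I F χ) where
  toFun g :=
    { toFun := fun f => ⟨fun x => f.1 (x * g),
        f.2.1.comp_continuous (continuous_mul_const g),
        fun p hp x => by
          change f.1 (p * x * g) = chiDelta χ p * f.1 (x * g)
          rw [mul_assoc, f.2.2 p hp]⟩
      map_add' := fun _ _ => rfl
      map_smul' := fun _ _ => rfl }
  map_one' := by ext f x; simp
  map_mul' g h := by ext f x; simp [mul_assoc]

open Classical in
/-- The function `φ_B` attached to the Iwahori subgroup `B`: it is supported on `P B`, and
`φ_B (p b) = χ δ^{1/2} (p)` for `p` in the Borel subgroup `P` and `b ∈ B`. -/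
def phiBFun (χ : Idx n → ℂˣ) (g : G F n) : ℂ :=
  if h : ∃ p ∈ borelSubgroup F n, p⁻¹ * g ∈ iwahori F n then chiDelta χ h.choose else 0

lemma phiBFun_eq (χ : Idx n → ℂˣ) {p g : G F n} (hp : p ∈ borelSubgroup F n)
    (hg : p⁻¹ * g ∈ iwahori F n) : phiBFun χ g = chiDelta χ p := by
  have h : ∃ p ∈ borelSubgroup F n, p⁻¹ * g ∈ iwahori F n := ⟨p, hp, hg⟩
  unfold phiBFun
  rw [dif_pos h]
  obtain ⟨h1, h2⟩ := h.choose_spec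
  have h3 : p⁻¹ * h.choose ∈ iwahori F n := by
    have := mul_mem hg (inv_mem h2)
    simpa [mul_assoc] using this
  have h4 : p⁻¹ * h.choose ∈ borelSubgroup F n := mul_mem (inv_mem hp) h1
  have h5 := chiDelta_mul χ hp h4
  rw [chiDelta_eq_one χ h4 (iwahori_le_maxCompact h3), mul_one, mul_inv_cancel_left] at h5
  exact h5

lemma phiBFun_eq_zero (χ : Idx n → ℂˣ) {g : G F n}
    (h : ¬ ∃ p ∈ borelSubgroup F n, p⁻¹ * g ∈ iwahori F n) : phiBFun χ g = 0 := by
  unfold phiBFun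
  rw [dif_neg h]

/-- The vector `φ_B` of `I(χ)`. -/
def phiB (χ : Idx n → ℂˣ) : I F χ :=
  ⟨phiBFun χ, by
    refine ⟨(IsLocallyConstant.iff_exists_open _).2 fun g => ?_, fun p hp g => ?_⟩
    · refine ⟨(fun x => g⁻¹ * x) ⁻¹' (iwahori F n : Set (G F n)),
        isOpen_iwahori.preimage (continuous_const_mul _), by simp [one_mem], fun x hx => ?_⟩
      have hx : g⁻¹ * x ∈ iwahori F n := hx
      by_cases h : ∃ p ∈ borelSubgroup F n, p⁻¹ * g ∈ iwahori F n
      · obtain ⟨p, hp, hg⟩ := h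
        rw [phiBFun_eq χ hp hg, phiBFun_eq χ hp]
        simpa [mul_assoc] using mul_mem hg hx
      · rw [phiBFun_eq_zero χ h, phiBFun_eq_zero χ]
        rintro ⟨p, hp, hg⟩
        refine h ⟨p, hp, ?_⟩
        simpa [mul_assoc] using mul_mem hg (inv_mem hx)
    · by_cases h : ∃ p ∈ borelSubgroup F n, p⁻¹ * g ∈ iwahori F n
      · obtain ⟨p', hp', hg⟩ := h
        rw [phiBFun_eq χ hp' hg, phiBFun_eq χ (mul_mem hp hp'), chiDelta_mul χ hp hp']
        simpa [mul_assoc] using hg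
      · rw [phiBFun_eq_zero χ h, phiBFun_eq_zero χ, mul_zero]
        rintro ⟨p', hp', hg⟩
        refine h ⟨p⁻¹ * p', mul_mem (inv_mem hp) hp', ?_⟩
        simpa [mul_assoc] using hg⟩

/-- The space `X` of locally constant functions on `K` that are left invariant under `P ∩ K`. -/
def X (F : Type*) [Field F] [ValuativeRel F] [TopologicalSpace F] [IsNonarchimedeanLocalField F]
    (n : ℕ) : Submodule ℂ (maxCompact F n → ℂ) where
  carrier := {f | IsLocallyConstant f ∧
    ∀ p : maxCompact F n, (p : G F n) ∈ borelSubgroup F n → ∀ k, f (p * k) = f k}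
  zero_mem' := ⟨IsLocallyConstant.const 0, by simp⟩
  add_mem' {f f'} hf hf' := ⟨hf.1.add hf'.1, fun p hp g => by
    simp only [Pi.add_apply, hf.2 p hp, hf'.2 p hp]⟩
  smul_mem' c f hf := ⟨hf.1.comp (c • ·), fun p hp g => by
    simp only [Pi.smul_apply, hf.2 p hp]⟩

/-- Restriction of functions from `GL_{2n}(F)` to `K`, which identifies `I(χ)` with `X`. -/
def resK (χ : Idx n → ℂˣ) : I F χ →ₗ[ℂ] X F n where
  toFun f := ⟨fun k => f.1 k, f.2.1.comp_continuous continuous_subtype_val, fun p hp k => by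
    change f.1 (p * k) = f.1 k
    rw [f.2.2 p hp, chiDelta_eq_one χ hp p.2, one_mul]⟩
  map_add' _ _ := rfl
  map_smul' _ _ := rfl

end PrincipalSeries

/-! ## Shalika functionals -/

section Functionals

variable {F : Type*} [Field F] {n : ℕ}

/-- The element `diag(g, g) · (I, X; 0, I)` of the Shalika subgroup `S`. -/
def shalikaElt (g : GL (Fin n) F) (Y : Matrix (Fin n) (Fin n) F) : G F n :=
  (⟨Matrix.fromBlocks g.val 0 0 g.val, Matrix.fromBlocks (g⁻¹).val 0 0 (g⁻¹).val,
      by simp [Matrix.fromBlocks_multiply], by simp [Matrix.fromBlocks_multiply]⟩ : G F n) *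
  (⟨Matrix.fromBlocks 1 Y 0 1, Matrix.fromBlocks 1 (-Y) 0 1,
      by simp [Matrix.fromBlocks_multiply], by simp [Matrix.fromBlocks_multiply]⟩ : G F n)

/-- The `n × n` antidiagonal permutation matrix `w₀`. -/
def w0 (F : Type*) [Field F] (n : ℕ) : Matrix (Fin n) (Fin n) F :=
  Matrix.of fun i j => if j = i.rev then 1 else 0

lemma w0_mul_w0 : w0 F n * w0 F n = 1 := by
  ext i j
  rw [Matrix.mul_apply, Finset.sum_eq_single i.rev]
  · simp [w0, Matrix.one_apply, eq_comm]
  · intro k _ hk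
    simp [w0, hk]
  · simp

/-- The matrix `ξ = (0, I; w₀, 0)`, for which `P ξ S` is the open double coset. -/
def xi (F : Type*) [Field F] (n : ℕ) : G F n :=
  ⟨Matrix.fromBlocks 0 1 (w0 F n) 0, Matrix.fromBlocks 0 (w0 F n) 1 0,
    by simp [Matrix.fromBlocks_multiply, w0_mul_w0],
    by simp [Matrix.fromBlocks_multiply, w0_mul_w0]⟩

variable [ValuativeRel F] [TopologicalSpace F] [IsNonarchimedeanLocalField F]

/-- `Λ` is a Shalika functional on `I(χ)`: `Λ (R_s v) = Ψ(s) Λ(v)` for every `s` in the Shalika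
subgroup, with `Ψ (diag(g, g) · (I, X; 0, I)) = ψ (tr X)`. -/
def IsShalikaFunctional (ψ : AddChar F Circle) {χ : Idx n → ℂˣ} (Λ : I F χ →ₗ[ℂ] ℂ) : Prop :=
  ∀ (g : GL (Fin n) F) (Y : Matrix (Fin n) (Fin n) F) (v : I F χ),
    Λ (principalSeries χ (shalikaElt g Y) v) = (ψ Y.trace : ℂ) * Λ v

/-- The functional `Λ_H` that corresponds to `Λ` for the conjugate `H = ξ S ξ⁻¹` of the Shalika
subgroup: `Λ_H(v) = Λ (R_{ξ⁻¹} v)`. -/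
def toH {χ : Idx n → ℂˣ} (Λ : I F χ →ₗ[ℂ] ℂ) : I F χ →ₗ[ℂ] ℂ :=
  Λ ∘ₗ principalSeries χ (xi F n)⁻¹

/-- `Λ` is a Shalika functional, normalized by `Λ_H(φ_B) = 1`. -/
def IsNormalizedShalikaFunctional (ψ : AddChar F Circle) {χ : Idx n → ℂˣ}
    (Λ : I F χ →ₗ[ℂ] ℂ) : Prop :=
  IsShalikaFunctional ψ Λ ∧ toH Λ (phiB χ) = 1

end Functionals

/-! ## Rational functions on the parameter torus -/

section Rational

/-- The torus `D` of Satake parameters `t_i = χ_i(ϖ)`, `1 ≤ i ≤ n`. -/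
abbrev D (n : ℕ) : Type := Fin n → ℂˣ

/-- The unramified character `(χ_1, …, χ_n, χ_n⁻¹, …, χ_1⁻¹)` attached to a point of `D`. -/
def chiOf {n : ℕ} (t : D n) : Idx n → ℂˣ := Sum.elim t (fun j => (t j.rev)⁻¹)

/-- Polynomial functions on `D`. Regular functions on `D` are the Laurent polynomials, that is,
the quotients of these by monomials, which vanish nowhere on `D`. -/
abbrev Poly (n : ℕ) : Type := MvPolynomial (Fin n) ℂ

/-- The field `L` of rational functions on `D`. -/
abbrev L (n : ℕ) : Type := FractionRing (Poly n)

/-- Evaluation of polynomials at a point of `D`. -/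
def evalAt {n : ℕ} (t : D n) : Poly n →ₐ[ℂ] ℂ := MvPolynomial.aeval fun i => (t i : ℂ)

/-- The rational function `r` is regular at the point `t` of `D`, with value `c`. -/
def HasValueAt {n : ℕ} (r : L n) (t : D n) (c : ℂ) : Prop :=
  ∃ a d : Poly n, evalAt t d ≠ 0 ∧ algebraMap (Poly n) (L n) d * r = algebraMap (Poly n) (L n) a ∧
    evalAt t d * c = evalAt t a

/-- The vector-valued rational function `x ∈ L ⊗ V` is regular at the point `t` of `D`, with
value `v`: there are `d ∈ Poly` and `a ∈ Poly ⊗ V` such that `x = a / d`, `d(t) ≠ 0` and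
`v = a(t) / d(t)`. -/
def HasVectorValueAt {n : ℕ} {V : Type*} [AddCommGroup V] [Module ℂ V] (x : L n ⊗[ℂ] V) (t : D n)
    (v : V) : Prop :=
  ∃ (a : Poly n ⊗[ℂ] V) (d : Poly n), evalAt t d ≠ 0 ∧
    algebraMap (Poly n) (L n) d • x =
      (IsScalarTower.toAlgHom ℂ (Poly n) (L n)).toLinearMap.rTensor V a ∧
    evalAt t d • v = TensorProduct.lid ℂ V ((evalAt t).toLinearMap.rTensor V a)

end Rational

end Shalika

end

/-! Let S be the Shalika subgroup and Ψ its character. S is the centralizer of the square-zero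
matrix N = (0, 1; 0, 0), so gS ↦ gNg⁻¹ (`conjNilp`) turns the double cosets P\G/S into P-orbits of
square-zero matrices. There are finitely many, represented by permutation matrices w
(`exists_borel_mul_perm_mul_shalika`). They are stratified by the ranks of the lower left
submatrices of gNg⁻¹, added up in `rankSum`. Near w this sum cannot drop, and where it keeps its
value one stays in PwS and can move by small elements of P and S (`exists_of_rankSum_eq`).

The argument works with families of vectors over the torus. A family v is determined if Λ(v_t) =
h(t) Λ(R_{ξ⁻¹}φ_B) for all Shalika functionals Λ on I(χ_t), with one function h that is rational
with poles only on Q = 0. Let u be supported on PwU, for a small congruence subgroup U. If h ∈ S and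
whw⁻¹ ∈ P, then, up to positive constants from changes of level, R_h u is χδ^{1/2}(whw⁻¹) u modulo
determined families and families on higher strata, while Λ(R_h u) = Ψ(h) Λ(u). If the two factors
are not identically equal in χ, division by their difference shows that u is determined once the
higher strata are (`isKilled_of_mem_shalika`). Such an h exists unless w ∈ ξS, and in that case u is
compared with a translate of φ_B itself (`isKilled`). Downward induction on the rank sum then shows
that all regular families are determined (`isDetermined_of_isRegFam`). Q is the product of the
coordinates and of the finitely many polynomials met on the way.

This bounds the space of Shalika functionals, but all of them might still vanish. On the part of D
where χ⁻¹δ^{1/2} is unitary, the kernel κ(pξs) = χ⁻¹δ^{1/2}(p) Ψ(s)⁻¹ is bounded, and v ↦ ∫_K vκ is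
a Shalika functional that does not vanish on R_{ξ⁻¹}φ_B (`exists_shalikaFunctional`). Its
equivariance rests on the invariance of ∫_K on functions that transform by δ
(`setIntegral_translate`), which needs δ to be the modular character of P
(`modularCharacter_borel`). These χ form a product of circles, which is Zariski dense, so the
coefficient h of a family is unique (`IsCoef.eq`). Uniqueness makes the coefficients linear and
equivariant, and evaluating them at any point with Q ≠ 0 defines the normalized functional there.
Its values are rational because the coefficients are; no continuation of the integral is needed. -/

noncomputable section

namespace Shalika

open ValuativeRel

set_option linter.unusedSectionVars false

/-! ### Congruence subgroups of K and the topology of G. -/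

section Congruence

variable {F : Type*} [Field F] [ValuativeRel F] {n : ℕ}

/-- All entries of the matrix `A` have valuation at most `γ`. -/
def MatLE (γ : ValueGroupWithZero F) (A : Matrix (Idx n) (Idx n) F) : Prop :=
  ∀ i j, valuation F (A i j) ≤ γ

variable {γ γ' : ValueGroupWithZero F} {A A' : Matrix (Idx n) (Idx n) F}

lemma MatLE.mono (h : MatLE γ A) (hγ : γ ≤ γ') : MatLE γ' A := fun i j => (h i j).trans hγ

lemma MatLE.add (h : MatLE γ A) (h' : MatLE γ A') : MatLE γ (A + A') :=
  fun i j => Valuation.map_add_le _ (h i j) (h' i j)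

lemma MatLE.neg (h : MatLE γ A) : MatLE γ (-A) := fun i j => by
  simpa [Valuation.map_neg] using h i j

lemma MatLE.mul (h : MatLE γ A) (h' : MatLE γ' A') : MatLE (γ * γ') (A * A') := fun i j => by
  rw [Matrix.mul_apply]
  refine Valuation.map_sum_le _ fun k _ => ?_
  rw [map_mul]
  exact mul_le_mul' (h i k) (h' k j)

lemma MatLE.one : MatLE 1 (1 : Matrix (Idx n) (Idx n) F) := fun i j => by
  rw [Matrix.one_apply]
  split_ifs <;> simp

lemma exists_matLE (A : Matrix (Idx n) (Idx n) F) : ∃ γ, γ ≠ 0 ∧ MatLE γ A := by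
  obtain ⟨γ, hγ⟩ := Finite.bddAbove_range fun p : Idx n × Idx n => valuation F (A p.1 p.2)
  refine ⟨max γ 1, (lt_of_lt_of_le zero_lt_one (le_max_right _ _)).ne', fun i j => ?_⟩
  exact le_max_of_le_left (hγ ⟨(i, j), rfl⟩)

lemma mem_maxCompact_iff {g : G F n} :
    g ∈ maxCompact F n ↔ MatLE 1 g.val ∧ MatLE 1 (g⁻¹).val := by
  constructor
  · rintro ⟨k, rfl⟩
    exact ⟨fun i j => (k.val i j).2, fun i j => ((k⁻¹).val i j).2⟩
  · rintro ⟨h, h'⟩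
    let A : Matrix (Idx n) (Idx n) 𝒪[F] := fun i j => ⟨g.val i j, h i j⟩
    let A' : Matrix (Idx n) (Idx n) 𝒪[F] := fun i j => ⟨(g⁻¹).val i j, h' i j⟩
    have hmul : A * A' = 1 := by
      refine Matrix.map_injective (Subtype.val_injective : Function.Injective (algebraMap 𝒪[F] F)) ?_
      refine (Matrix.map_mul (f := algebraMap 𝒪[F] F)).trans ?_
      refine Eq.trans ?_ (Matrix.map_one (algebraMap 𝒪[F] F) (map_zero _) (map_one _)).symm
      exact g.mul_inv
    exact ⟨⟨A, A', hmul, mul_eq_one_comm.mp hmul⟩, by ext i j; rfl⟩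

/-- The matrix is integral and reduces to the identity over the residue field, so its determinant is
a unit of the local ring 𝒪[F]. -/
lemma exists_maxCompact_of_sub_one (hγ : γ < 1) (h : MatLE γ (A - 1)) :
    ∃ g ∈ maxCompact F n, g.val = A := by
  have hA : MatLE 1 A := by simpa using (h.mono hγ.le).add MatLE.one
  let A0 : Matrix (Idx n) (Idx n) 𝒪[F] := fun i j => ⟨A i j, hA i j⟩
  have hres : A0.map (IsLocalRing.residue 𝒪[F]) = 1 := by
    ext i j
    rw [Matrix.map_apply, ← sub_eq_zero]
    have h1 : ((1 : Matrix (Idx n) (Idx n) 𝓀[F]) i j) =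
        IsLocalRing.residue 𝒪[F] ((1 : Matrix (Idx n) (Idx n) 𝒪[F]) i j) := by
      simp [Matrix.one_apply, apply_ite]
    rw [h1, ← map_sub, IsLocalRing.residue_eq_zero_iff, IsLocalRing.mem_maximalIdeal,
      mem_nonunits_iff, Valuation.Integers.isUnit_iff_valuation_eq_one
      (Valuation.integer.integers (ValuativeRel.valuation F))]
    refine (lt_of_le_of_lt ?_ hγ).ne
    have h2 : algebraMap 𝒪[F] F (A0 i j - (1 : Matrix (Idx n) (Idx n) 𝒪[F]) i j) = (A - 1) i j := by
      rw [map_sub, Matrix.sub_apply]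
      congr 1
      simp [Matrix.one_apply, apply_ite]
    rw [h2]
    exact h i j
  have hdet : IsUnit A0.det := by
    rw [← IsLocalRing.residue_ne_zero_iff_isUnit, RingHom.map_det]
    change (A0.map (IsLocalRing.residue 𝒪[F])).det ≠ 0
    rw [hres]
    simp
  obtain ⟨u, hu⟩ := (Matrix.isUnit_iff_isUnit_det _).2 hdet
  refine ⟨_, ⟨u, rfl⟩, ?_⟩
  ext i j
  change algebraMap 𝒪[F] F (u.val i j) = _
  rw [hu]
  rfl

lemma matLE_of_mem {k : G F n} (hk : k ∈ maxCompact F n) : MatLE 1 k.val :=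
  (mem_maxCompact_iff.1 hk).1

/-- The congruence subgroup of matrices of `K` that are congruent to `1` modulo `γ`. -/
def cong (n : ℕ) (γ : ValueGroupWithZero F) : Subgroup (G F n) where
  carrier := {g | g ∈ maxCompact F n ∧ MatLE γ (g.val - 1)}
  one_mem' := ⟨one_mem _, by intro i j; simp⟩
  mul_mem' {a b} ha hb := ⟨mul_mem ha.1 hb.1, by
    have : (a * b).val - 1 = (a.val - 1) * b.val + (b.val - 1) := by
      rw [Units.val_mul]; noncomm_ring
    rw [this]
    exact MatLE.add (by simpa using ha.2.mul (matLE_of_mem hb.1)) hb.2⟩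
  inv_mem' {a} ha := ⟨inv_mem ha.1, by
    have : (a⁻¹).val - 1 = - ((a⁻¹).val * (a.val - 1)) := by
      rw [mul_sub, Units.inv_mul, mul_one]; abel
    rw [this]
    exact MatLE.neg (by simpa using (matLE_of_mem (inv_mem ha.1)).mul ha.2)⟩

lemma cong_le_maxCompact : cong n γ ≤ maxCompact F n := fun _ h => h.1

lemma cong_mono (h : γ ≤ γ') : cong n γ ≤ cong n γ' := fun _ hg => ⟨hg.1, hg.2.mono h⟩

lemma conj_mem_cong {k g : G F n} (hk : k ∈ maxCompact F n) (hg : g ∈ cong n γ) :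
    k * g * k⁻¹ ∈ cong n γ := by
  refine ⟨mul_mem (mul_mem hk hg.1) (inv_mem hk), ?_⟩
  have : (k * g * k⁻¹).val - 1 = k.val * (g.val - 1) * (k⁻¹).val := by
    rw [Units.val_mul, Units.val_mul, mul_sub, sub_mul, mul_one, Units.mul_inv]
  rw [this]
  simpa using ((matLE_of_mem hk).mul hg.2).mul (matLE_of_mem (inv_mem hk))

lemma conj_mem_cong' {k g : G F n} (hk : k ∈ maxCompact F n) (hg : g ∈ cong n γ) :
    k⁻¹ * g * k ∈ cong n γ := by
  simpa using conj_mem_cong (inv_mem hk) hg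

lemma exists_cong_of_sub_one (hγ : γ < 1) (h : MatLE γ (A - 1)) :
    ∃ g ∈ cong n γ, g.val = A := by
  obtain ⟨g, hg, rfl⟩ := exists_maxCompact_of_sub_one hγ h
  exact ⟨g, ⟨hg, h⟩, rfl⟩

variable [TopologicalSpace F] [IsNonarchimedeanLocalField F]

lemma exists_val_ne_zero_lt_one : ∃ γ : ValueGroupWithZero F, γ ≠ 0 ∧ γ < 1 := by
  obtain ⟨x, hx, h⟩ := Valuation.IsNontrivial.exists_lt_one (v := valuation F)
  exact ⟨_, by simpa using hx, h⟩

lemma isOpen_matLE_sub (hγ : γ ≠ 0) (A : Matrix (Idx n) (Idx n) F) :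
    IsOpen {g : G F n | MatLE γ (g.val - A)} := by
  have : {g : G F n | MatLE γ (g.val - A)} =
      ⋂ i, ⋂ j, {g : G F n | valuation F (g.val i j - A i j) ≤ γ} := by
    ext g; simp [MatLE]
  rw [this]
  refine isOpen_iInter_of_finite fun i => isOpen_iInter_of_finite fun j => ?_
  have hopen : IsOpen {x : F | valuation F x ≤ γ} := by
    obtain ⟨c, rfl⟩ := valuation_surjective γ
    have := Valuation.isOpen_closedBall (v := valuation F) (r := (valuation F).restrict c)
      (by simpa using hγ)
    simpa [Valuation.restrict_le_iff] using this
  exact hopen.preimage (((Units.continuous_val).matrix_elem i j).sub continuous_const)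

lemma isOpen_maxCompact : IsOpen (maxCompact F n : Set (G F n)) :=
  Subgroup.isOpen_mono iwahori_le_maxCompact isOpen_iwahori

lemma isOpen_cong (hγ : γ ≠ 0) : IsOpen (cong n γ : Set (G F n)) :=
  isOpen_maxCompact.inter (isOpen_matLE_sub hγ 1)

instance : T2Space F := by
  let := IsTopologicalAddGroup.rightUniformSpace F
  have := isUniformAddGroup_of_addCommGroup (G := F)
  infer_instance

lemma isCompact_maxCompact : IsCompact (maxCompact F n : Set (G F n)) := by
  rw [maxCompact, MonoidHom.coe_range]
  have : CompactSpace (Matrix (Idx n) (Idx n) 𝒪[F]) :=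
    inferInstanceAs (CompactSpace (Idx n → Idx n → 𝒪[F]))
  have : T1Space (Matrix (Idx n) (Idx n) 𝒪[F]) :=
    inferInstanceAs (T1Space (Idx n → Idx n → 𝒪[F]))
  refine isCompact_range ?_
  refine Continuous.units_map _ ?_
  exact Continuous.matrix_map continuous_id continuous_subtype_val

/-- The congruence subgroups of non-zero level are compact, directed downwards and have intersection
1, so one of them fits into a given neighbourhood of 1. -/
lemma exists_cong_subset {U : Set (G F n)} (hU : U ∈ nhds 1) :
    ∃ γ : ValueGroupWithZero F, γ ≠ 0 ∧ γ < 1 ∧ (cong n γ : Set (G F n)) ⊆ U := by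
  obtain ⟨γ₀, h0, h1⟩ := exists_val_ne_zero_lt_one (F := F)
  let ι := {γ : ValueGroupWithZero F // γ ≠ 0 ∧ γ < 1}
  have : Nonempty ι := ⟨⟨γ₀, h0, h1⟩⟩
  have hclosed : ∀ γ : ι, IsClosed (cong n γ.1 : Set (G F n)) := fun γ =>
    Subgroup.isClosed_of_isOpen _ (isOpen_cong γ.2.1)
  have hdir : Directed (· ⊇ ·) fun γ : ι => (cong n γ.1 : Set (G F n)) := by
    intro a b
    refine ⟨⟨min a.1 b.1, ?_, (min_le_left _ _).trans_lt a.2.2⟩, cong_mono (min_le_left _ _),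
      cong_mono (min_le_right _ _)⟩
    rcases min_choice a.1 b.1 with h | h <;> rw [h]
    exacts [a.2.1, b.2.1]
  have hnhds : ∀ x ∈ ⋂ γ : ι, (cong n γ.1 : Set (G F n)), U ∈ nhds x := by
    intro x hx
    have hx1 : x = 1 := by
      ext i j
      by_contra hne
      have hne' : (x.val - 1) i j ≠ 0 := by
        rw [Matrix.sub_apply]; exact sub_ne_zero.2 hne
      have hmem : ∀ γ : ι, valuation F ((x.val - 1) i j) ≤ γ.1 := fun γ =>
        (Set.mem_iInter.1 hx γ).2 i j
      have hv : valuation F ((x.val - 1) i j) ≠ 0 := by simpa using hne'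
      have h2 := hmem ⟨γ₀, h0, h1⟩
      -- A non-zero entry of x - 1 of value v would have to satisfy the congruence of level v γ₀ <
      -- v.
      have hlt : valuation F ((x.val - 1) i j) * γ₀ < valuation F ((x.val - 1) i j) := by
        conv_rhs => rw [← mul_one (valuation F ((x.val - 1) i j))]
        exact mul_lt_mul_of_pos_left h1 (zero_lt_iff.2 hv)
      exact absurd (hmem ⟨_, mul_ne_zero hv h0, hlt.trans (h2.trans_lt h1)⟩) hlt.not_ge
    rw [hx1]; exact hU
  obtain ⟨γ, hγ⟩ := exists_subset_nhds_of_isCompact' hdir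
    (fun γ => isCompact_maxCompact.of_isClosed_subset (hclosed γ) cong_le_maxCompact) hclosed hnhds
  exact ⟨γ.1, γ.2.1, γ.2.2, hγ⟩

lemma relIndex_ne_zero_of_isCompact {H C : Subgroup (G F n)} (hH : IsOpen (H : Set (G F n)))
    (hC : IsCompact (C : Set (G F n))) : H.relIndex C ≠ 0 := by
  have : CompactSpace C := isCompact_iff_compactSpace.1 hC
  have hopen : IsOpen ((H.subgroupOf C : Subgroup C) : Set C) := hH.preimage continuous_subtype_val
  have : Finite (C ⧸ H.subgroupOf C) := Subgroup.quotient_finite_of_isOpen _ hopen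
  exact Subgroup.index_ne_zero_of_finite

lemma exists_conj_cong_le (h : G F n) (hγ : γ ≠ 0) :
    ∃ γ' : ValueGroupWithZero F, γ' ≠ 0 ∧ γ' < 1 ∧ γ' ≤ γ ∧
      ∀ g ∈ cong n γ', h * g * h⁻¹ ∈ cong n γ := by
  have hU : {g : G F n | h * g * h⁻¹ ∈ cong n γ} ∈ nhds (1 : G F n) := by
    refine ((isOpen_cong hγ).preimage (f := fun g : G F n => h * g * h⁻¹)
      (by fun_prop)).mem_nhds ?_
    simp [one_mem]
  obtain ⟨γ', h0, h1, hsub⟩ := exists_cong_subset hU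
  refine ⟨min γ γ', ?_, (min_le_right _ _).trans_lt h1, min_le_left _ _, fun g hg =>
    hsub (cong_mono (min_le_right _ _) hg)⟩
  rcases min_choice γ γ' with h | h <;> rw [h]
  exacts [hγ, h0]

end Congruence

/-! ### The standard flag. -/

section Flags

variable {F : Type*} [Field F] {n : ℕ}

/-- The step `V_m` of the standard flag: vectors supported in positions `< m`. -/
def flag (F : Type*) [Field F] (n m : ℕ) : Submodule F (Idx n → F) where
  carrier := {v | ∀ c : Idx n, m ≤ pos c → v c = 0}
  add_mem' ha hb c hc := by simp [ha c hc, hb c hc]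
  zero_mem' c hc := rfl
  smul_mem' r a ha c hc := by simp [ha c hc]

lemma flag_mono {m m' : ℕ} (h : m ≤ m') : flag F n m ≤ flag F n m' :=
  fun _ hv c hc => hv c (h.trans hc)

lemma mem_flag_top (v : Idx n → F) : v ∈ flag F n (n + n) := fun c hc =>
  absurd (pos c).2 (not_lt.2 hc)

lemma eq_zero_of_mem_flag_zero {v : Idx n → F} (h : v ∈ flag F n 0) : v = 0 := by
  ext c; exact h c (Nat.zero_le _)

lemma mem_flag_of_succ {i : Idx n} {v : Idx n → F} (h : v ∈ flag F n (pos i + 1))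
    (hi : v i = 0) : v ∈ flag F n (pos i) := fun c hc => by
  rcases hc.lt_or_eq with h' | h'
  · exact h c h'
  · rw [← pos_injective (Fin.ext h' : pos i = pos c)]; exact hi

lemma exists_pos_eq {m : ℕ} (h : m < n + n) : ∃ i : Idx n, (pos i : ℕ) = m :=
  ⟨finSumFinEquiv.symm ⟨m, h⟩, by simp [pos]⟩

lemma single_mem_flag {c : Idx n} {m : ℕ} (h : (pos c : ℕ) < m) (a : F) :
    Pi.single c a ∈ flag F n m := fun d hd => by
  rw [Pi.single_apply, if_neg]
  rintro rfl
  omega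

lemma mem_borelSubgroup_iff_col {g : G F n} :
    g ∈ borelSubgroup F n ↔ ∀ j, g.val.col j ∈ flag F n (pos j + 1) :=
  ⟨fun h _ _ hc => h (Fin.lt_def.2 hc), fun h _ j hij => h j _ (Fin.lt_def.1 hij)⟩

lemma det_ne_zero_of_blockTriangular {A : Matrix (Idx n) (Idx n) F} (h : A.BlockTriangular pos)
    (hd : ∀ i, A i i ≠ 0) : A.det ≠ 0 := by
  rw [← Matrix.det_reindex_self finSumFinEquiv A, Matrix.det_of_isUpperTriangular]
  · exact Finset.prod_ne_zero_iff.2 fun i _ => hd _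
  · intro i j hij
    refine h ?_
    simpa [pos] using hij

end Flags

/-! ### The Iwasawa decomposition. -/

section Iwasawa

variable {F : Type*} [Field F] [ValuativeRel F] [TopologicalSpace F]
  [IsNonarchimedeanLocalField F] {n : ℕ}

lemma log_val_le_log_val {a b : F} (ha : a ≠ 0) (hb : b ≠ 0) :
    ord a ≤ ord b ↔ valuation F b ≤ valuation F a := by
  unfold ord
  rw [neg_le_neg_iff, WithZero.log_le_log (by simpa using hb) (by simpa using ha),
    map_le_map_iff]

/-- The orders are integers bounded below, so a least one is attained. Discreteness of the valuation
enters here. -/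
lemma exists_max_valuation {α : Type*} (s : Set α) (hs : s.Nonempty) (f : α → F)
    (hf : ∀ a ∈ s, f a ≠ 0) {C : F} (hC : C ≠ 0)
    (hb : ∀ a ∈ s, valuation F (f a) ≤ valuation F C) :
    ∃ a ∈ s, ∀ b ∈ s, valuation F (f b) ≤ valuation F (f a) := by
  obtain ⟨a₀, h₀⟩ := hs
  obtain ⟨m, ⟨a, ha, rfl⟩, hm⟩ := Int.exists_least_of_bdd (P := fun m => ∃ a ∈ s, ord (f a) = m)
    ⟨ord C, by
      rintro _ ⟨a, ha, rfl⟩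
      exact (log_val_le_log_val hC (hf a ha)).2 (hb a ha)⟩ ⟨_, a₀, h₀, rfl⟩
  exact ⟨a, ha, fun b hb => (log_val_le_log_val (hf a ha) (hf b hb)).1 (hm _ ⟨b, hb, rfl⟩)⟩

/-- The Iwasawa decomposition `G = P K`. -/
theorem exists_iwasawa (g : G F n) :
    ∃ p ∈ borelSubgroup F n, ∃ k ∈ maxCompact F n, g = p * k := by
  -- The lattice generated by the columns of g. A basis of it adapted to the flag gives an upper
  -- triangular matrix, and two bases of one lattice differ by an element of K.
  let lat : Set (Idx n → F) := {v | ∃ z : Idx n → F, (∀ i, valuation F (z i) ≤ 1) ∧ g.val *ᵥ z = v}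
  obtain ⟨C, hC0, hC⟩ : ∃ C : F, C ≠ 0 ∧ MatLE (valuation F C) g.val := by
    obtain ⟨γ, h0, h⟩ := exists_matLE g.val
    obtain ⟨C, rfl⟩ := valuation_surjective γ
    exact ⟨C, by simpa using h0, h⟩
  -- In each flag step, a lattice vector whose last coordinate is as large as possible. Non-zero
  -- coordinates occur because the lattice contains a multiple of every coordinate vector.
  have hmax : ∀ i : Idx n, ∃ f : Idx n → F, f ∈ lat ∧ f ∈ flag F n (pos i + 1) ∧ f i ≠ 0 ∧
      ∀ f' ∈ lat, f' ∈ flag F n (pos i + 1) → f' i ≠ 0 →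
        valuation F (f' i) ≤ valuation F (f i) := by
    intro i
    have hs : {f : Idx n → F | f ∈ lat ∧ f ∈ flag F n (pos i + 1) ∧ f i ≠ 0}.Nonempty := by
      obtain ⟨γ, h0, h⟩ := exists_matLE (g⁻¹).val
      obtain ⟨c, rfl⟩ := valuation_surjective γ
      have hc0 : c ≠ 0 := by simpa using h0
      refine ⟨Pi.single i c⁻¹, ⟨(g⁻¹).val *ᵥ Pi.single i c⁻¹, fun j => ?_, ?_⟩,
        single_mem_flag (by omega) _, by simpa using hc0⟩
      · rw [Matrix.mulVec_single]
        simp only [MulOpposite.op_inv, Pi.smul_apply, Matrix.col_apply]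
        rw [MulOpposite.smul_eq_mul_unop, map_mul]
        simp only [MulOpposite.unop_inv, MulOpposite.unop_op, map_inv₀]
        exact mul_inv_le_one_of_le₀ (h j i) zero_le
      · rw [Matrix.mulVec_mulVec, Units.mul_inv, Matrix.one_mulVec]
    have hb : ∀ f ∈ {f : Idx n → F | f ∈ lat ∧ f ∈ flag F n (pos i + 1) ∧ f i ≠ 0},
        valuation F (f i) ≤ valuation F C := by
      rintro f ⟨⟨z, hz, rfl⟩, -, -⟩
      change valuation F (∑ j, g.val i j * z j) ≤ _
      refine Valuation.map_sum_le _ fun j _ => ?_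
      rw [map_mul]
      simpa using mul_le_mul' (hC i j) (hz j)
    obtain ⟨f, hf, hfmax⟩ := exists_max_valuation _ hs (fun f => f i) (fun f hf => hf.2.2) hC0 hb
    exact ⟨f, hf.1, hf.2.1, hf.2.2, fun f' h1 h2 h3 => hfmax f' ⟨h1, h2, h3⟩⟩
  choose f hlat hflag hne hfmax using hmax
  have hsub : ∀ v ∈ lat, ∀ c : F, valuation F c ≤ 1 → ∀ i, v - c • f i ∈ lat := by
    rintro _ ⟨z, hz, rfl⟩ c hc i
    obtain ⟨z', hz', hf⟩ := hlat i
    refine ⟨z - c • z', fun j => Valuation.map_sub_le _ (hz j) ?_, ?_⟩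
    · simpa using mul_le_mul' hc (hz' j)
    · rw [Matrix.mulVec_sub, Matrix.mulVec_smul, hf]
  let A : Matrix (Idx n) (Idx n) F := Matrix.of fun i j => f j i
  -- Maximality makes the quotient of last coordinates integral, so an integral multiple of f i can
  -- be subtracted to descend in the flag.
  have hspan : ∀ m : ℕ, ∀ v ∈ lat, v ∈ flag F n m →
      ∃ c : Idx n → F, (∀ i, valuation F (c i) ≤ 1) ∧ v = A *ᵥ c := by
    intro m
    induction m with
    | zero =>
      intro v _ hv
      exact ⟨0, by simp, by simp [eq_zero_of_mem_flag_zero hv]⟩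
    | succ m ih =>
      intro v hv hvm
      by_cases hm : m < n + n
      · obtain ⟨i, rfl⟩ := exists_pos_eq hm
        by_cases hi : v i = 0
        · exact ih v hv (mem_flag_of_succ hvm hi)
        · have hc : valuation F (v i / f i i) ≤ 1 := by
            rw [map_div₀]
            exact div_le_one_of_le₀ (hfmax i v hv hvm hi) zero_le
          obtain ⟨c, hc1, hc2⟩ := ih (v - (v i / f i i) • f i) (hsub v hv _ hc i)
            (mem_flag_of_succ (Submodule.sub_mem _ hvm (Submodule.smul_mem _ _ (hflag i)))
              (by simp [hne i]))
          refine ⟨c + Pi.single i (v i / f i i), fun j => ?_, ?_⟩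
          · refine Valuation.map_add_le _ (hc1 j) ?_
            rw [Pi.single_apply]
            split_ifs
            exacts [hc, by simp]
          · rw [Matrix.mulVec_add, ← hc2, Matrix.mulVec_single]
            ext j
            simp [A]
            ring
      · exact ih v hv (flag_mono (not_lt.1 hm) (mem_flag_top v))
  have hcol : ∀ j, ∃ c : Idx n → F, (∀ i, valuation F (c i) ≤ 1) ∧ g.val.col j = A *ᵥ c := fun j =>
    hspan (n + n) _ ⟨Pi.single j 1, fun i => by
      rw [Pi.single_apply]; split_ifs <;> simp, by simp⟩ (mem_flag_top _)
  choose c hc hgc using hcol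
  choose z hz hfz using hlat
  let Cm : Matrix (Idx n) (Idx n) F := Matrix.of fun i j => c j i
  let Z : Matrix (Idx n) (Idx n) F := Matrix.of fun i j => z j i
  have hA : A = g.val * Z := by
    ext i j
    exact (congrFun (hfz j) i).symm
  have hg : g.val = A * Cm := by
    ext i j
    exact congrFun (hgc j) i
  have hZC : Z * Cm = 1 := by
    have h1 : g.val * (Z * Cm) = g.val * 1 := by rw [← mul_assoc, ← hA, ← hg, mul_one]
    simpa using congrArg ((g⁻¹).val * ·) h1
  have hCZ := mul_eq_one_comm.1 hZC
  let k : G F n := ⟨Cm, Z, hCZ, hZC⟩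
  have hk : k ∈ maxCompact F n := mem_maxCompact_iff.2 ⟨fun i j => hc j i, fun i j => hz j i⟩
  refine ⟨g * k⁻¹, ?_, k, hk, by simp⟩
  have hA' : (g * k⁻¹).val = A := by rw [hA]; rfl
  rw [mem_borelSubgroup_iff_col]
  intro j
  rw [hA']
  exact hflag j

end Iwasawa

/-! ### Double cosets P\G/S and square-zero matrices. -/

section Nilpotent

variable {F : Type*} [Field F] {n : ℕ}

/-- The square-zero matrix `(0, 1; 0, 0)`, whose centralizer is the Shalika subgroup. -/
def nilp (F : Type*) [Field F] (n : ℕ) : Matrix (Idx n) (Idx n) F := Matrix.fromBlocks 0 1 0 0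

lemma nilp_mul_nilp : nilp F n * nilp F n = 0 := by
  simp [nilp, Matrix.fromBlocks_multiply]

/-- The Shalika subgroup, the centralizer of `(0, 1; 0, 0)`. -/
def shalika (F : Type*) [Field F] (n : ℕ) : Subgroup (G F n) where
  carrier := {s | s.val * nilp F n = nilp F n * s.val}
  one_mem' := by simp
  mul_mem' {a b} ha hb := by
    change (a * b).val * _ = _ * (a * b).val
    rw [Units.val_mul, mul_assoc, hb, ← mul_assoc, ha, mul_assoc]
  inv_mem' {a} ha := by
    change (a⁻¹).val * _ = _ * (a⁻¹).val
    rw [Units.inv_mul_eq_iff_eq_mul, ← mul_assoc, ha, mul_assoc, Units.mul_inv, mul_one]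

lemma mem_shalika {s : G F n} : s ∈ shalika F n ↔ s.val * nilp F n = nilp F n * s.val := Iff.rfl

/-- The conjugate of the matrix `(0, 1; 0, 0)` by `g`. -/
def conjNilp (g : G F n) : Matrix (Idx n) (Idx n) F := g.val * nilp F n * (g⁻¹).val

lemma conjNilp_mul_self (g : G F n) : conjNilp g * conjNilp g = 0 := by
  have : conjNilp g * conjNilp g = g.val * (nilp F n * ((g⁻¹).val * g.val) * nilp F n) *
      (g⁻¹).val := by simp only [conjNilp, mul_assoc]
  rw [this, Units.inv_mul, mul_one, nilp_mul_nilp]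
  simp

lemma conjNilp_mul (p g : G F n) : conjNilp (p * g) = p.val * conjNilp g * (p⁻¹).val := by
  simp [conjNilp, mul_assoc]

lemma conjNilp_mul_shalika (g : G F n) {s : G F n} (hs : s ∈ shalika F n) :
    conjNilp (g * s) = conjNilp g := by
  rw [conjNilp_mul, conjNilp, conjNilp, mem_shalika.1 hs]
  simp [mul_assoc]

/-- The hypothesis says that g and g' conjugate `nilp` to the same matrix, so that they differ by an
element of its centralizer. -/
lemma inv_mul_mem_shalika {g g' : G F n} (h : g.val * nilp F n = conjNilp g' * g.val) :
    g⁻¹ * g' ∈ shalika F n := by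
  rw [mem_shalika, Units.val_mul, mul_assoc, Units.inv_mul_eq_iff_eq_mul, ← mul_assoc, ← mul_assoc,
    h, mul_assoc (conjNilp g'), Units.mul_inv, mul_one, conjNilp, mul_assoc, Units.inv_mul, mul_one]

/-- The kernel and the image of `nilp` are both spanned by the first n coordinate vectors, and
equality of kernel and image survives conjugation. -/
lemma exists_of_conjNilp_mulVec_eq_zero {g : G F n} {v : Idx n → F}
    (h : conjNilp g *ᵥ v = 0) : ∃ y, conjNilp g *ᵥ y = v := by
  let u := (g⁻¹).val *ᵥ v
  have hu : nilp F n *ᵥ u = 0 := by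
    have := congrArg ((g⁻¹).val *ᵥ ·) h
    simpa [conjNilp, u, Matrix.mulVec_mulVec, ← mul_assoc] using this
  have hu' : ∀ i, u (Sum.inr i) = 0 := by
    intro i
    have := congrFun hu (Sum.inl i)
    simpa [nilp, Matrix.mulVec, dotProduct, Matrix.one_apply] using this
  refine ⟨g.val *ᵥ (Sum.elim 0 (fun i => u (Sum.inl i))), ?_⟩
  have h1 : nilp F n *ᵥ (Sum.elim 0 (fun i => u (Sum.inl i))) = u := by
    ext i
    rcases i with i | i
    · simp [nilp, Matrix.mulVec, dotProduct, Matrix.one_apply]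
    · simp [nilp, Matrix.mulVec, dotProduct, hu']
  have h2 : conjNilp g *ᵥ g.val *ᵥ (Sum.elim 0 (fun i => u (Sum.inl i))) =
      g.val *ᵥ (nilp F n *ᵥ (Sum.elim 0 (fun i => u (Sum.inl i)))) := by
    simp [conjNilp, Matrix.mulVec_mulVec, mul_assoc]
  rw [h2, h1]
  simp [u, Matrix.mulVec_mulVec]

/-- The permutation matrix with columns `e_{w j}`. -/
def permG (F : Type*) [Field F] {n : ℕ} (w : Equiv.Perm (Idx n)) : G F n :=
  ⟨(1 : Matrix _ _ F).submatrix w.symm id, (1 : Matrix _ _ F).submatrix w id, by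
    ext i j
    rw [Matrix.mul_apply, Finset.sum_eq_single (w.symm i)]
    · simp [Matrix.one_apply]
    · intro k _ hk
      simp [Matrix.one_apply, hk.symm]
    · simp, by
    ext i j
    rw [Matrix.mul_apply, Finset.sum_eq_single (w i)]
    · simp [Matrix.one_apply]
    · intro k _ hk
      simp [Matrix.one_apply, hk.symm]
    · simp⟩

lemma permG_apply (w : Equiv.Perm (Idx n)) (i j : Idx n) :
    (permG F w).val i j = if w.symm i = j then 1 else 0 := by
  simp [permG, Matrix.one_apply]

lemma permG_inv_apply (w : Equiv.Perm (Idx n)) (i j : Idx n) :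
    ((permG F w)⁻¹).val i j = if w i = j then 1 else 0 := by
  change (1 : Matrix _ _ F).submatrix w id i j = _
  simp [Matrix.one_apply]

lemma permG_mul_apply (A : Matrix (Idx n) (Idx n) F) (w : Equiv.Perm (Idx n)) (i j : Idx n) :
    ((permG F w).val * A) i j = A (w.symm i) j := by
  rw [Matrix.mul_apply, Finset.sum_eq_single (w.symm i)] <;> simp +contextual [permG_apply, eq_comm]

lemma mul_permG_inv_apply (A : Matrix (Idx n) (Idx n) F) (w : Equiv.Perm (Idx n)) (i j : Idx n) :
    (A * ((permG F w)⁻¹).val) i j = A i (w.symm j) := by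
  rw [Matrix.mul_apply, Finset.sum_eq_single (w.symm j)] <;>
    simp +contextual [permG_inv_apply, Equiv.eq_symm_apply]

lemma conj_permG_apply (A : Matrix (Idx n) (Idx n) F) (w : Equiv.Perm (Idx n)) (i j : Idx n) :
    ((permG F w).val * A * ((permG F w)⁻¹).val) i j = A (w.symm i) (w.symm j) := by
  rw [mul_permG_inv_apply, permG_mul_apply]

lemma nilp_mulVec_single_inl (i : Fin n) (a : F) :
    nilp F n *ᵥ Pi.single (Sum.inl i) a = 0 := by
  ext (j | j) <;> simp [nilp]

lemma nilp_mulVec_single_inr (i : Fin n) (a : F) :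
    nilp F n *ᵥ Pi.single (Sum.inr i) a = Pi.single (Sum.inl i) a := by
  ext (j | j) <;> simp [nilp, Matrix.one_apply, Pi.single_apply]

/-- The matrix with columns `f i` at `inr i` and `x f i` at `inl i` intertwines `(0, 1; 0, 0)` and the
square-zero matrix `x`. -/
lemma mul_nilp_of_columns {x : Matrix (Idx n) (Idx n) F} (hx : x * x = 0) (f : Fin n → Idx n → F) :
    (Matrix.of fun i j => Sum.elim (fun l => x *ᵥ f l) f j i : Matrix (Idx n) (Idx n) F) * nilp F n =
      x * Matrix.of fun i j => Sum.elim (fun l => x *ᵥ f l) f j i := by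
  set Y : Matrix (Idx n) (Idx n) F := Matrix.of fun i j => Sum.elim (fun l => x *ᵥ f l) f j i
  have hc : ∀ j, Y *ᵥ Pi.single j 1 = Sum.elim (fun l => x *ᵥ f l) f j := by
    intro j; ext i; simp [Y]
  refine Matrix.ext_of_mulVec_single fun j => ?_
  rw [← Matrix.mulVec_mulVec, ← Matrix.mulVec_mulVec]
  rcases j with j | j
  · rw [nilp_mulVec_single_inl, hc, Matrix.mulVec_zero, Sum.elim_inl, Matrix.mulVec_mulVec, hx,
      Matrix.zero_mulVec]
  · rw [nilp_mulVec_single_inr, hc, hc, Sum.elim_inl, Sum.elim_inr]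

/-- Every double coset of the Borel subgroup and the Shalika subgroup contains a permutation
matrix. -/
theorem exists_borel_mul_perm_mul_shalika (g : G F n) :
    ∃ p ∈ borelSubgroup F n, ∃ w : Equiv.Perm (Idx n), ∃ s ∈ shalika F n,
      g = p * permG F w * s := by
  classical
  set x := conjNilp g with hx
  have hxx : x * x = 0 := conjNilp_mul_self g
  -- The positions at which a vector of the kernel of x can have its last non-zero entry.
  let kill : Idx n → Prop := fun b => ∃ f ∈ flag F n (pos b + 1), f b = 1 ∧ x *ᵥ f = 0
  -- At the remaining positions b, f is chosen so that x f lies as low in the flag as possible; a is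
  -- the last position of x f.
  have hmin : ∀ b, ¬ kill b → ∃ f ∈ flag F n (pos b + 1), f b = 1 ∧ ∃ a : Idx n,
      x *ᵥ f ∈ flag F n (pos a + 1) ∧ (x *ᵥ f) a ≠ 0 ∧
      ∀ f' ∈ flag F n (pos b + 1), f' b = 1 → x *ᵥ f' ∉ flag F n (pos a) := by
    intro b hb
    let q : ℕ → Prop := fun m => ∃ f ∈ flag F n (pos b + 1), f b = 1 ∧ x *ᵥ f ∈ flag F n m
    have hq : ∃ m, q m := ⟨n + n, Pi.single b 1, single_mem_flag (by omega) _, by simp,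
      mem_flag_top _⟩
    obtain ⟨f, hf, hfb, hxf⟩ := Nat.find_spec hq
    have hm0 : Nat.find hq ≠ 0 := fun h0 => by
      rw [h0] at hxf
      exact hb ⟨f, hf, hfb, eq_zero_of_mem_flag_zero hxf⟩
    have hmle : Nat.find hq ≤ n + n := Nat.find_min' hq ⟨Pi.single b 1,
      single_mem_flag (by omega) _, by simp, mem_flag_top _⟩
    obtain ⟨a, ha⟩ := exists_pos_eq (n := n) (m := Nat.find hq - 1) (by omega)
    have hlt : (pos a : ℕ) < Nat.find hq := by omega
    have ha1 : (pos a : ℕ) + 1 = Nat.find hq := by omega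
    refine ⟨f, hf, hfb, a, ha1 ▸ hxf, fun h0 => ?_, fun f' hf' hfb' h' =>
      Nat.find_min hq hlt ⟨f', hf', hfb', h'⟩⟩
    exact Nat.find_min hq hlt ⟨f, hf, hfb, mem_flag_of_succ (ha1 ▸ hxf) h0⟩
  have hall : ∀ b, ∃ f ∈ flag F n (pos b + 1), f b = 1 ∧ (kill b → x *ᵥ f = 0) ∧ ∃ a : Idx n,
      ¬ kill b → (x *ᵥ f ∈ flag F n (pos a + 1) ∧ (x *ᵥ f) a ≠ 0 ∧
      ∀ f' ∈ flag F n (pos b + 1), f' b = 1 → x *ᵥ f' ∉ flag F n (pos a)) := by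
    intro b
    by_cases hb : kill b
    · obtain ⟨f, hf, hfb, h0⟩ := hb
      exact ⟨f, hf, hfb, fun _ => h0, b, fun h => absurd ⟨f, hf, hfb, h0⟩ h⟩
    · obtain ⟨f, hf, hfb, a, h⟩ := hmin b hb
      exact ⟨f, hf, hfb, fun h => absurd h hb, a, fun _ => h⟩
  choose f hf hfb hfk a ha using hall
  -- If b < b' had the same a, a multiple of f b subtracted from f b' would cancel the last entry of
  -- x f b', against minimality.
  have hinj' : ∀ b b', ¬ kill b → ¬ kill b' → a b = a b' → ¬ (pos b : ℕ) < pos b' := by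
    intro b b' hb hb' hab hlt
    obtain ⟨h1, h2, -⟩ := ha b hb
    obtain ⟨h1', h2', h3'⟩ := ha b' hb'
    rw [hab] at h1 h2
    refine h3' (f b' - ((x *ᵥ f b') (a b') / (x *ᵥ f b) (a b')) • f b) ?_ ?_ ?_
    · exact Submodule.sub_mem _ (hf b') (Submodule.smul_mem _ _ (flag_mono (by omega) (hf b)))
    · rw [Pi.sub_apply, Pi.smul_apply, hf b b' (by omega), hfb]; simp
    · rw [Matrix.mulVec_sub, Matrix.mulVec_smul]
      refine mem_flag_of_succ (Submodule.sub_mem _ h1' (Submodule.smul_mem _ _ h1)) ?_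
      simp [h2]
  have hinj : ∀ b b', ¬ kill b → ¬ kill b' → a b = a b' → b = b' := by
    intro b b' hb hb' hab
    refine pos_injective (Fin.ext (le_antisymm ?_ ?_))
    · exact not_lt.1 (hinj' b' b hb' hb hab.symm)
    · exact not_lt.1 (hinj' b b' hb hb' hab)
  -- Since x² = 0, the vector x f b itself lies in the kernel, with last position a b.
  have hak : ∀ b, ¬ kill b → kill (a b) := by
    intro b hb
    obtain ⟨h1, h2, -⟩ := ha b hb
    refine ⟨((x *ᵥ f b) (a b))⁻¹ • (x *ᵥ f b), Submodule.smul_mem _ _ h1, by simp [h2], ?_⟩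
    rw [Matrix.mulVec_smul, Matrix.mulVec_mulVec, hxx]
    simp
  have hspan : ∀ m : ℕ, ∀ y ∈ flag F n m, ∃ c : Idx n → F, y = ∑ b, c b • f b := by
    intro m
    induction m with
    | zero => exact fun y hy => ⟨0, by simp [eq_zero_of_mem_flag_zero hy]⟩
    | succ m ih =>
      intro y hy
      by_cases hm : m < n + n
      · obtain ⟨i, rfl⟩ := exists_pos_eq hm
        obtain ⟨c, hc⟩ := ih (y - y i • f i) (mem_flag_of_succ
          (Submodule.sub_mem _ hy (Submodule.smul_mem _ _ (hf i))) (by simp [hfb]))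
        refine ⟨c + Pi.single i (y i), ?_⟩
        simp [add_smul, Finset.sum_add_distrib, ← hc, Pi.single_apply, ite_smul]
      · exact ih y (flag_mono (not_lt.1 hm) (mem_flag_top y))
  -- A kernel vector f c is an image x y. Expand y in the vectors f b. The last positions a b are
  -- distinct, so the largest one with a non-zero coefficient must be c.
  have hsurj : ∀ c, kill c → ∃ b, ¬ kill b ∧ a b = c := by
    intro c hc
    obtain ⟨y, hy⟩ := exists_of_conjNilp_mulVec_eq_zero (hfk c hc)
    obtain ⟨d, hd⟩ := hspan _ y (mem_flag_top y)
    let T : Finset (Idx n) := {b | ¬ kill b ∧ d b ≠ 0}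
    have hfc : f c = ∑ b ∈ T, d b • (x *ᵥ f b) := by
      rw [← hy, hd, Matrix.mulVec_sum, ← Finset.sum_subset (Finset.subset_univ T)]
      · exact Finset.sum_congr rfl fun b _ => Matrix.mulVec_smul _ _ _
      · intro b _ hb
        rw [Matrix.mulVec_smul]
        by_cases hk : kill b
        · rw [hfk b hk, smul_zero]
        · have : d b = 0 := by
            by_contra h0
            exact hb (by simp [T, hk, h0])
          rw [this, zero_smul]
    have hT : T.Nonempty := by
      by_contra h
      rw [Finset.not_nonempty_iff_eq_empty] at h
      have := hfb c
      rw [hfc, h] at this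
      simp at this
    obtain ⟨b, hbT, hbmax⟩ := Finset.exists_max_image T (fun b => (pos (a b) : ℕ)) hT
    have hbT' : ¬ kill b ∧ d b ≠ 0 := by simpa [T] using hbT
    have hmem : ∀ b' ∈ T, d b' • (x *ᵥ f b') ∈ flag F n (pos (a b) + 1) := fun b' hb' =>
      Submodule.smul_mem _ _ (flag_mono (Nat.succ_le_succ (hbmax b' hb'))
        (ha b' (by simpa [T] using hb' : ¬ kill b' ∧ _).1).1)
    have hval : f c (a b) ≠ 0 := by
      rw [hfc, Finset.sum_apply, Finset.sum_eq_single_of_mem b hbT]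
      · exact mul_ne_zero hbT'.2 (ha b hbT'.1).2.1
      · intro b' hb' hne
        have hb'' : ¬ kill b' ∧ d b' ≠ 0 := by simpa [T] using hb'
        have hne' : (pos (a b') : ℕ) ≠ pos (a b) := fun h =>
          hne (hinj _ _ hb''.1 hbT'.1 (pos_injective (Fin.ext h)))
        have := hbmax b' hb'
        simp only [Pi.smul_apply, (ha b' hb''.1).1 (a b) (by omega), smul_zero]
    refine ⟨b, hbT'.1, pos_injective (Fin.ext (le_antisymm ?_ ?_))⟩
    · by_contra hlt
      exact hval (hf c _ (by omega))
    · by_contra hlt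
      have h1 : f c ∈ flag F n (pos (a b) + 1) := by
        rw [hfc]; exact Submodule.sum_mem _ hmem
      have := h1 c (by omega)
      rw [hfb c] at this
      exact one_ne_zero this
  let e0 : {b // ¬ kill b} ≃ {b // ¬ ¬ kill b} := Equiv.ofBijective
    (fun b => ⟨a b.1, not_not.2 (hak b.1 b.2)⟩)
    ⟨fun b b' h => Subtype.ext (hinj _ _ b.2 b'.2 (Subtype.ext_iff.1 h)), fun c => by
      obtain ⟨b, hb, hbc⟩ := hsurj c.1 (not_not.1 c.2)
      exact ⟨⟨b, hb⟩, Subtype.ext hbc⟩⟩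
  -- The bijection b ↦ a b matches the positions outside `kill` with those in it, so there are n of
  -- each.
  have hcard : Fintype.card {b // ¬ kill b} = n := by
    have h1 := Fintype.card_subtype_compl (fun b : Idx n => ¬ kill b)
    have h2 := Fintype.card_congr e0
    have h3 := Fintype.card_subtype_le (fun b : Idx n => ¬ kill b)
    simp only [Fintype.card_sum, Fintype.card_fin] at h1 h3
    omega
  let e : Fin n ≃ {b // ¬ kill b} := (Fintype.equivFinOfCardEq hcard).symm
  have hw : Function.Injective (Sum.elim (fun l => a (e l)) (fun l => (e l : Idx n))) := by
    rw [Sum.elim_injective]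
    refine ⟨fun l l' h => e.injective (Subtype.ext (hinj _ _ (e l).2 (e l').2 h)),
      fun l l' h => e.injective (Subtype.ext h), fun l l' h => (e l').2 (h ▸ hak _ (e l).2)⟩
  let w : Equiv.Perm (Idx n) := Equiv.ofBijective _ (Finite.injective_iff_bijective.1 hw)
  -- Y carries `nilp` to x. Its columns have distinct last positions, given by w, so Y w⁻¹ is upper
  -- triangular.
  let Y : Matrix (Idx n) (Idx n) F :=
    Matrix.of fun i j => Sum.elim (fun l => x *ᵥ f (e l)) (fun l => f (e l)) j i
  have hYN : Y * nilp F n = x * Y := mul_nilp_of_columns hxx (fun l => f (e l))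
  let p : Matrix (Idx n) (Idx n) F := Y * ((permG F w)⁻¹).val
  have hpw : ∀ i j, p i (w j) = Y i j := fun i j => by
    simp only [p, mul_permG_inv_apply, Equiv.symm_apply_apply]
  have hYflag : ∀ j, (fun i => Y i j) ∈ flag F n (pos (w j) + 1) ∧ Y (w j) j ≠ 0 := by
    rintro (l | l)
    · exact ⟨(ha _ (e l).2).1, (ha _ (e l).2).2.1⟩
    · refine ⟨hf (e l), ?_⟩
      change f (e l) (e l) ≠ 0
      rw [hfb]
      exact one_ne_zero
  have hptri : p.BlockTriangular pos := by
    intro i j hij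
    obtain ⟨j, rfl⟩ := w.surjective j
    rw [hpw]
    exact (hYflag j).1 i (Fin.lt_def.1 hij)
  have hpdet : p.det ≠ 0 := det_ne_zero_of_blockTriangular hptri fun i => by
    obtain ⟨i, rfl⟩ := w.surjective i
    rw [hpw]
    exact (hYflag i).2
  let pG : G F n := Matrix.GeneralLinearGroup.mkOfDetNeZero p hpdet
  have hpY : (pG * permG F w).val = Y := by
    change Y * ((permG F w)⁻¹).val * (permG F w).val = Y
    rw [mul_assoc, Units.inv_mul, mul_one]
  refine ⟨pG, hptri, w, (pG * permG F w)⁻¹ * g, inv_mul_mem_shalika ?_, by group⟩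
  rw [hpY]
  exact hYN

end Nilpotent

/-! ### The rank invariant of a double coset. -/

section Rank

variable {F : Type*} [Field F] {n : ℕ}

/-- The subspace `x V_j + V_i`. Its dimension is `i` plus the rank of a lower left submatrix
of `x`. -/
def rankSpace (x : Matrix (Idx n) (Idx n) F) (i j : ℕ) : Submodule F (Idx n → F) :=
  (flag F n j).map x.mulVecLin ⊔ flag F n i

/-- The sum of the ranks of the lower left submatrices of the conjugate of `(0, 1; 0, 0)` by `g`, up to a
constant. -/
def rankSum (g : G F n) : ℕ :=
  ∑ q ∈ Finset.range (n + n + 1) ×ˢ Finset.range (n + n + 1),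
    Module.finrank F (rankSpace (conjNilp g) q.1 q.2)

lemma rankSum_mul_shalika (g : G F n) {s : G F n} (hs : s ∈ shalika F n) :
    rankSum (g * s) = rankSum g := by
  unfold rankSum
  rw [conjNilp_mul_shalika g hs]

lemma borel_mulVec_mem_flag {p : G F n} (hp : p ∈ borelSubgroup F n) {m : ℕ} {v : Idx n → F}
    (hv : v ∈ flag F n m) : p.val *ᵥ v ∈ flag F n m := fun c hc => by
  change ∑ d, p.val c d * v d = 0
  refine Finset.sum_eq_zero fun d _ => ?_
  by_cases hd : m ≤ pos d
  · rw [hv d hd, mul_zero]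
  · rw [hp (Fin.lt_def.2 (by omega)), zero_mul]

/-- Upper triangular matrices preserve the flag, so the space for p g is contained in the image
under p of the space for g. The opposite inequality comes from p⁻¹. -/
lemma finrank_rankSpace_borel_mul_le {p : G F n} (hp : p ∈ borelSubgroup F n) (g : G F n)
    (i j : ℕ) : Module.finrank F (rankSpace (conjNilp (p * g)) i j) ≤
      Module.finrank F (rankSpace (conjNilp g) i j) := by
  refine le_trans (Submodule.finrank_mono (t := (rankSpace (conjNilp g) i j).map p.val.mulVecLin)
    ?_) (Submodule.finrank_map_le _ _)
  refine sup_le ?_ ?_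
  · rintro _ ⟨v, hv, rfl⟩
    refine ⟨conjNilp g *ᵥ (p⁻¹).val *ᵥ v, Submodule.mem_sup_left
      ⟨_, borel_mulVec_mem_flag (inv_mem hp) hv, rfl⟩, ?_⟩
    simp [conjNilp_mul, Matrix.mulVec_mulVec, mul_assoc]
  · intro v hv
    refine ⟨(p⁻¹).val *ᵥ v, Submodule.mem_sup_right
      (borel_mulVec_mem_flag (inv_mem hp) hv), ?_⟩
    simp [Matrix.mulVec_mulVec]

lemma rankSum_borel_mul {p : G F n} (hp : p ∈ borelSubgroup F n) (g : G F n) :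
    rankSum (p * g) = rankSum g := by
  refine Finset.sum_congr rfl fun q _ => le_antisymm (finrank_rankSpace_borel_mul_le hp g _ _) ?_
  have := finrank_rankSpace_borel_mul_le (inv_mem hp) (p * g) q.1 q.2
  rwa [inv_mul_cancel_left] at this

/-- The partner of the index `c` in the partial permutation matrix `conjNilp (permG F w)`. -/
def partner (w : Equiv.Perm (Idx n)) (c : Idx n) : Idx n := w (w.symm c).swap

lemma partner_inl (w : Equiv.Perm (Idx n)) (l : Fin n) :
    partner w (w (Sum.inl l)) = w (Sum.inr l) := by simp [partner]

lemma permG_mulVec_single (w : Equiv.Perm (Idx n)) (j : Idx n) :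
    (permG F w).val *ᵥ Pi.single j 1 = Pi.single (w j) 1 := by
  ext i
  rw [Matrix.mulVec_single_one, Matrix.col_apply, permG_apply, Pi.single_apply]
  simp [Equiv.symm_apply_eq]

lemma permG_inv_mulVec_single (w : Equiv.Perm (Idx n)) (j : Idx n) :
    ((permG F w)⁻¹).val *ᵥ Pi.single (w j) 1 = Pi.single j 1 := by
  rw [← permG_mulVec_single, Matrix.mulVec_mulVec, Units.inv_mul, Matrix.one_mulVec]

lemma conjNilp_permG_mulVec_inl (w : Equiv.Perm (Idx n)) (l : Fin n) :
    conjNilp (permG F w) *ᵥ Pi.single (w (Sum.inl l)) 1 = 0 := by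
  rw [conjNilp, ← Matrix.mulVec_mulVec, ← Matrix.mulVec_mulVec, permG_inv_mulVec_single,
    nilp_mulVec_single_inl, Matrix.mulVec_zero]

lemma conjNilp_permG_mulVec_inr (w : Equiv.Perm (Idx n)) (l : Fin n) :
    conjNilp (permG F w) *ᵥ Pi.single (w (Sum.inr l)) 1 = Pi.single (w (Sum.inl l)) 1 := by
  rw [conjNilp, ← Matrix.mulVec_mulVec, ← Matrix.mulVec_mulVec, permG_inv_mulVec_single,
    nilp_mulVec_single_inr, permG_mulVec_single]

/-- The rows that carry a coordinate direction of `x V_j + V_i`, for `x = conjNilp (permG F w)`. -/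
def rankSupport (w : Equiv.Perm (Idx n)) (i j : ℕ) : Finset (Idx n) :=
  {c | (pos c : ℕ) < i ∨ ((w.symm c).isLeft ∧ (pos (partner w c) : ℕ) < j)}

/-- The vector of `x V_j + V_i` in direction `c`. -/
def rankVec (w : Equiv.Perm (Idx n)) (x : Matrix (Idx n) (Idx n) F) (i : ℕ) (c : Idx n) :
    Idx n → F :=
  if (pos c : ℕ) < i then Pi.single c 1 else x *ᵥ Pi.single (partner w c) 1

lemma rankVec_mem (w : Equiv.Perm (Idx n)) (x : Matrix (Idx n) (Idx n) F) {i j : ℕ} {c : Idx n}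
    (hc : c ∈ rankSupport w i j) : rankVec w x i c ∈ rankSpace x i j := by
  rw [rankVec]
  split_ifs with h
  · exact Submodule.mem_sup_right (single_mem_flag h _)
  · have hc' := (Finset.mem_filter.1 hc).2
    exact Submodule.mem_sup_left ⟨_, single_mem_flag (hc'.resolve_left h).2 _, rfl⟩

/-- The matrix x of a permutation sends every coordinate vector to a coordinate vector or to 0, so
the space is spanned by the coordinate vectors counted in `rankSupport`. -/
lemma finrank_rankSpace_permG_le (w : Equiv.Perm (Idx n)) (i j : ℕ) :
    Module.finrank F (rankSpace (conjNilp (permG F w)) i j) ≤ (rankSupport w i j).card := by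
  classical
  let T : Finset (Idx n → F) := (rankSupport w i j).image fun c => Pi.single c 1
  refine (Submodule.finrank_mono (t := Submodule.span F (T : Set (Idx n → F))) ?_).trans
    ((finrank_span_finset_le_card T).trans Finset.card_image_le)
  have hT : ∀ c ∈ rankSupport w i j, (Pi.single c 1 : Idx n → F) ∈
      Submodule.span F (T : Set (Idx n → F)) := fun c hc =>
    Submodule.subset_span (Finset.mem_coe.2 (Finset.mem_image_of_mem _ hc))
  have hexp : ∀ v : Idx n → F, v = ∑ c, v c • (Pi.single c 1 : Idx n → F) := fun v => by
    ext d
    simp [Finset.sum_apply, Pi.single_apply]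
  refine sup_le ?_ ?_
  · rintro _ ⟨v, hv, rfl⟩
    rw [hexp v, map_sum]
    refine Submodule.sum_mem _ fun c _ => ?_
    rw [map_smul]
    by_cases hc : j ≤ pos c
    · rw [hv c hc, zero_smul]; exact Submodule.zero_mem _
    · refine Submodule.smul_mem _ _ ?_
      obtain ⟨d, rfl⟩ := w.surjective c
      rcases d with l | l
      · rw [Matrix.mulVecLin_apply, conjNilp_permG_mulVec_inl]; exact Submodule.zero_mem _
      · rw [Matrix.mulVecLin_apply, conjNilp_permG_mulVec_inr]
        refine hT _ ?_
        simp only [rankSupport, Finset.mem_filter_univ, partner_inl, Equiv.symm_apply_apply,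
          Sum.isLeft_inl, true_and]
        exact Or.inr (not_le.1 hc)
  · intro v hv
    rw [hexp v]
    refine Submodule.sum_mem _ fun c _ => ?_
    by_cases hc : i ≤ pos c
    · rw [hv c hc, zero_smul]; exact Submodule.zero_mem _
    · refine Submodule.smul_mem _ _ (hT c ?_)
      simp only [rankSupport, Finset.mem_filter_univ]
      exact Or.inl (not_le.1 hc)

end Rank

/-! ### Ranks and orbits near a permutation matrix. -/

section Elimination

variable {F : Type*} [Field F] [ValuativeRel F] {n : ℕ} {γ : ValueGroupWithZero F}

lemma permG_mem_maxCompact (w : Equiv.Perm (Idx n)) : permG F w ∈ maxCompact F n := by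
  refine mem_maxCompact_iff.2 ⟨fun i j => ?_, fun i j => ?_⟩
  · rw [permG_apply]; split_ifs <;> simp
  · rw [permG_inv_apply]; split_ifs <;> simp

/-- In the entry at the index c₀ of the largest coefficient, the error terms carry a factor of value
at most γ < 1 and cannot cancel d c₀. So a largest coefficient above ε would show up in that entry.
-/
lemma valuation_coeff_le {T : Finset (Idx n)} {y : Idx n → Idx n → F} {d : Idx n → F}
    (hγ : γ < 1) (hy : ∀ c ∈ T, ∀ i ∈ T, valuation F (y c i - (Pi.single c 1 : Idx n → F) i) ≤ γ)
    {ε : ValueGroupWithZero F}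
    (hd : ∀ i ∈ T, valuation F ((∑ c ∈ T, d c • y c) i) ≤ ε) :
    ∀ c ∈ T, valuation F (d c) ≤ ε := by
  by_contra! hcon
  obtain ⟨c₁, hc₁, hlt₁⟩ := hcon
  obtain ⟨c₀, hc₀, hmax⟩ := Finset.exists_max_image T (fun c => valuation F (d c)) ⟨c₁, hc₁⟩
  have hlt : ε < valuation F (d c₀) := hlt₁.trans_le (hmax c₁ hc₁)
  have hsum : d c₀ = (∑ c ∈ T, d c • y c) c₀ -
      ∑ c ∈ T, d c * (y c c₀ - (Pi.single c 1 : Idx n → F) c₀) := by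
    simp only [Finset.sum_apply, Pi.smul_apply, smul_eq_mul]
    rw [← Finset.sum_sub_distrib, Finset.sum_eq_single_of_mem c₀ hc₀]
    · simp; ring
    · intro b _ hb
      simp [hb.symm]
  have h0 : valuation F (d c₀) ≠ 0 := (zero_le.trans_lt hlt).ne'
  have h1 : valuation F (∑ c ∈ T, d c * (y c c₀ - (Pi.single c 1 : Idx n → F) c₀)) <
      valuation F (d c₀) := by
    refine Valuation.map_sum_lt _ h0 fun c hc => ?_
    rw [map_mul]
    calc _ ≤ valuation F (d c₀) * γ := mul_le_mul' (hmax c hc) (hy c hc c₀ hc₀)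
      _ < valuation F (d c₀) * 1 := mul_lt_mul_of_pos_left hγ (zero_lt_iff.2 h0)
      _ = _ := mul_one _
  have h2 := Valuation.map_sub_lt (valuation F) ((hd c₀ hc₀).trans_lt hlt) h1
  rw [← hsum] at h2
  exact lt_irrefl _ h2

lemma linearIndepOn_of_near {T : Finset (Idx n)} {y : Idx n → Idx n → F}
    (hγ : γ < 1)
    (hy : ∀ c ∈ T, ∀ i ∈ T, valuation F (y c i - (Pi.single c 1 : Idx n → F) i) ≤ γ) :
    LinearIndepOn F y (T : Set (Idx n)) := by
  rw [linearIndepOn_finset_iff]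
  intro d hd c hc
  have := valuation_coeff_le (ε := 0) hγ hy (d := d) (fun i _ => by rw [hd]; simp) c hc
  simpa using this

variable {k : G F n} (hγ : γ < 1) (hk : k ∈ cong n γ) (w : Equiv.Perm (Idx n))

include hk in
lemma matLE_conjNilp_sub : MatLE γ (conjNilp (k * permG F w) - conjNilp (permG F w)) := by
  have hN : MatLE 1 (conjNilp (permG F w)) := by
    intro i j
    rw [conjNilp, conj_permG_apply]
    rcases w.symm i with a | a <;> rcases w.symm j with b | b <;> simp [nilp, Matrix.one_apply]
    split_ifs <;> simp
  have : conjNilp (k * permG F w) - conjNilp (permG F w) =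
      (k.val - 1) * conjNilp (permG F w) * (k⁻¹).val +
        conjNilp (permG F w) * ((k⁻¹).val - 1) := by
    rw [conjNilp_mul]; noncomm_ring
  rw [this]
  refine MatLE.add ?_ ?_
  · simpa using (hk.2.mul hN).mul (matLE_of_mem (inv_mem hk.1))
  · simpa using hN.mul (inv_mem hk).2

lemma rankVec_sub {x : Matrix (Idx n) (Idx n) F} (hx : MatLE γ (x - conjNilp (permG F w)))
    (i j : ℕ) {c : Idx n} (hc : c ∈ rankSupport w i j) (d : Idx n) :
    valuation F (rankVec w x i c d - (Pi.single c 1 : Idx n → F) d) ≤ γ := by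
  rw [rankVec]
  split_ifs with h
  · simp
  · have hc' := (Finset.mem_filter.1 hc).2
    obtain ⟨e, rfl⟩ := w.surjective c
    have h1 := (hc'.resolve_left h).1
    rw [Equiv.symm_apply_apply] at h1
    obtain ⟨l, rfl⟩ := Sum.isLeft_iff.1 h1
    have h2 := hx d (w (Sum.inr l))
    have h3 := congrFun (conjNilp_permG_mulVec_inr (F := F) w l) d
    rw [Matrix.mulVec_single_one, Matrix.col_apply] at h3
    rw [Matrix.sub_apply, h3] at h2
    simpa [partner_inl] using h2

include hγ in
-- Lower semicontinuity of the rank: the spanning vectors at w deform to vectors congruent to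
-- distinct coordinate vectors, and these stay independent.
lemma card_rankSupport_le {x : Matrix (Idx n) (Idx n) F}
    (hx : MatLE γ (x - conjNilp (permG F w))) (i j : ℕ) :
    (rankSupport w i j).card ≤ Module.finrank F (rankSpace x i j) := by
  have hli := linearIndepOn_of_near hγ (T := rankSupport w i j) (y := rankVec w x i)
    fun c hc d _ => rankVec_sub w hx i j hc d
  have h1 := finrank_span_eq_card hli
  simp only [Finset.coe_sort_coe, Fintype.card_coe] at h1
  rw [← h1]
  refine Submodule.finrank_mono (Submodule.span_le.2 ?_)
  rintro _ ⟨c, rfl⟩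
  exact rankVec_mem w x c.2

include hγ in
-- When the rank does not grow, the deformed independent vectors already span the space.
lemma exists_coeff_of_finrank_le {x : Matrix (Idx n) (Idx n) F}
    (hx : MatLE γ (x - conjNilp (permG F w))) {i j : ℕ}
    (hle : Module.finrank F (rankSpace x i j) ≤ (rankSupport w i j).card)
    {z : Idx n → F} (hz : z ∈ rankSpace x i j) :
    ∃ d : Idx n → F, z = ∑ c ∈ rankSupport w i j, d c • rankVec w x i c := by
  have hli := linearIndepOn_of_near hγ (T := rankSupport w i j) (y := rankVec w x i)
    fun c hc d _ => rankVec_sub w hx i j hc d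
  have h1 := finrank_span_eq_card hli
  simp only [Finset.coe_sort_coe, Fintype.card_coe] at h1
  have h2 : Submodule.span F (Set.range fun c : rankSupport w i j => rankVec w x i c) =
      rankSpace x i j := by
    refine Submodule.eq_of_le_of_finrank_le (Submodule.span_le.2 ?_) (hle.trans h1.ge)
    rintro _ ⟨c, rfl⟩
    exact rankVec_mem w x c.2
  rw [← h2, Submodule.mem_span_range_iff_exists_fun] at hz
  obtain ⟨d, rfl⟩ := hz
  classical
  refine ⟨fun c => if h : c ∈ rankSupport w i j then d ⟨c, h⟩ else 0, ?_⟩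
  rw [← Finset.sum_coe_sort (rankSupport w i j)]
  exact Finset.sum_congr rfl fun c _ => by simp

include hγ hk in
lemma rankSum_permG_le : rankSum (permG F w) ≤ rankSum (k * permG F w) :=
  Finset.sum_le_sum fun _ _ => (finrank_rankSpace_permG_le w _ _).trans
    (card_rankSupport_le hγ w (matLE_conjNilp_sub hk w) _ _)

include hγ hk in
/-- Near a permutation matrix, a double coset of the Borel and the Shalika subgroup is given by the
small elements of the two groups. -/
theorem exists_of_rankSum_eq (h : rankSum (k * permG F w) = rankSum (permG F w)) :
    ∃ p ∈ borelSubgroup F n, p ∈ cong n γ ∧ ∃ s ∈ shalika F n, s ∈ cong n γ ∧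
      k * permG F w = p * permG F w * s := by
  classical
  set x := conjNilp (k * permG F w) with hxdef
  have hx := matLE_conjNilp_sub hk w
  rw [← hxdef] at hx
  -- Each rank is at least its value at w, so equality of the sums forces equality of every rank.
  have hle : ∀ i ≤ n + n, ∀ j ≤ n + n,
      Module.finrank F (rankSpace x i j) ≤ (rankSupport w i j).card := by
    intro i hi j hj
    have h1 := (Finset.sum_eq_sum_iff_of_le fun q _ => (finrank_rankSpace_permG_le (F := F) w q.1
      q.2).trans (card_rankSupport_le hγ w hx q.1 q.2)).1 h.symm (i, j) (by
        simp only [Finset.mem_product, Finset.mem_range]; omega)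
    exact h1.ge.trans (finrank_rankSpace_permG_le w i j)
  -- Elimination: e_b, with b = w (inr l), is corrected by small multiples of earlier coordinate
  -- vectors until its image is a small upper triangular correction of e_a, with a = w (inl l).
  have hf : ∀ l : Fin n, ∃ f : Idx n → F, f ∈ flag F n (pos (w (Sum.inr l)) + 1) ∧
      x *ᵥ f ∈ flag F n (pos (w (Sum.inl l)) + 1) ∧
      (∀ i, valuation F (f i - (Pi.single (w (Sum.inr l)) 1 : Idx n → F) i) ≤ γ) ∧
      ∀ i, valuation F ((x *ᵥ f) i - (Pi.single (w (Sum.inl l)) 1 : Idx n → F) i) ≤ γ := by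
    intro l
    set a := w (Sum.inl l) with ha
    set b := w (Sum.inr l) with hb
    set T := rankSupport w (pos a + 1) (pos b + 1) with hT
    -- This vector is small and lies in x V_{b+1} + V_{a+1}, so it has an expansion in the
    -- `rankVec`s with small coefficients.
    have hz : x *ᵥ Pi.single b 1 - Pi.single a 1 ∈ rankSpace x (pos a + 1) (pos b + 1) :=
      Submodule.sub_mem _ (Submodule.mem_sup_left
        ⟨_, single_mem_flag (Nat.lt_succ_self _) _, rfl⟩)
        (Submodule.mem_sup_right (single_mem_flag (Nat.lt_succ_self _) _))
    obtain ⟨d, hd⟩ := exists_coeff_of_finrank_le hγ w hx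
      (hle _ (by have := (pos a).2; omega) _ (by have := (pos b).2; omega)) hz
    have hxb : ∀ i, valuation F ((x *ᵥ Pi.single b 1 - Pi.single a 1 : Idx n → F) i) ≤ γ := by
      intro i
      have h2 := hx i b
      have h3 := congrFun (conjNilp_permG_mulVec_inr (F := F) w l) i
      rw [Matrix.mulVec_single_one, Matrix.col_apply] at h3
      rw [Matrix.sub_apply, h3] at h2
      simpa using h2
    have hdγ : ∀ c ∈ T, valuation F (d c) ≤ γ :=
      valuation_coeff_le hγ (y := rankVec w x (pos a + 1))
        (fun c hc i _ => rankVec_sub w hx _ _ hc i)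
        (fun i _ => by rw [← hd]; exact hxb i)
    -- The terms in T₁ are images of e_{partner c} and are moved to the side of e_b; those in T₀
    -- already lie in V_{a+1}.
    let T₁ : Finset (Idx n) := T.filter fun c => ¬ (pos c : ℕ) < pos a + 1
    let T₀ : Finset (Idx n) := T.filter fun c => (pos c : ℕ) < pos a + 1
    have hT₁ : ∀ c ∈ T₁, (pos (partner w c) : ℕ) < pos b := by
      intro c hc
      obtain ⟨hcT, hca⟩ := Finset.mem_filter.1 hc
      have hcT' := (Finset.mem_filter.1 hcT).2
      obtain ⟨h1, h2⟩ := hcT'.resolve_left hca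
      -- Only c = a has the partner b, and the condition on positions in T₁ excludes a. This keeps
      -- the entry of f at b free of corrections.
      have hne : (pos (partner w c) : ℕ) ≠ pos b := by
        intro heq
        have heq' := pos_injective (Fin.ext heq)
        have : c = a := by
          rw [partner, hb, w.apply_eq_iff_eq] at heq'
          rw [ha, ← w.symm_apply_eq, ← Sum.swap_swap (w.symm c), heq', Sum.swap_inr]
        exact hca (by rw [this]; exact Nat.lt_succ_self _)
      omega
    have hxf : x *ᵥ (Pi.single b 1 - ∑ c ∈ T₁, d c • Pi.single (partner w c) 1) =
        Pi.single a 1 + ∑ c ∈ T₀, d c • Pi.single c 1 := by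
      have h1 : x *ᵥ Pi.single b 1 = Pi.single a 1 + (∑ c ∈ T₀, d c • rankVec w x (pos a + 1) c +
          ∑ c ∈ T₁, d c • rankVec w x (pos a + 1) c) := by
        rw [Finset.sum_filter_add_sum_filter_not, ← hd]; abel
      have h2 : ∑ c ∈ T₀, d c • rankVec w x (pos a + 1) c = ∑ c ∈ T₀, d c • Pi.single c 1 :=
        Finset.sum_congr rfl fun c hc => by rw [rankVec, if_pos (Finset.mem_filter.1 hc).2]
      have h3 : ∑ c ∈ T₁, d c • rankVec w x (pos a + 1) c =
          x *ᵥ ∑ c ∈ T₁, d c • Pi.single (partner w c) 1 := by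
        rw [Matrix.mulVec_sum]
        refine Finset.sum_congr rfl fun c hc => ?_
        rw [rankVec, if_neg (Finset.mem_filter.1 hc).2, Matrix.mulVec_smul]
      rw [Matrix.mulVec_sub, h1, h2, h3]
      abel
    have hsum : ∀ (T' : Finset (Idx n)) (u : Idx n → Idx n), T' ⊆ T → ∀ i,
        valuation F ((∑ c ∈ T', d c • (Pi.single (u c) 1 : Idx n → F)) i) ≤ γ := by
      intro T' u hT' i
      rw [Finset.sum_apply]
      refine Valuation.map_sum_le _ fun c hc => ?_
      rw [Pi.smul_apply, Pi.single_apply, smul_eq_mul, map_mul]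
      have h1 : valuation F (if i = u c then (1 : F) else 0) ≤ 1 := by split_ifs <;> simp
      exact (mul_le_mul' (hdγ c (hT' hc)) h1).trans (mul_one γ).le
    refine ⟨Pi.single b 1 - ∑ c ∈ T₁, d c • Pi.single (partner w c) 1, ?_, ?_, ?_, ?_⟩
    · refine Submodule.sub_mem _ (single_mem_flag (Nat.lt_succ_self _) _)
        (Submodule.sum_mem _ fun c hc => Submodule.smul_mem _ _
          (single_mem_flag ((hT₁ c hc).trans (Nat.lt_succ_self _)) _))
    · rw [hxf]
      exact Submodule.add_mem _ (single_mem_flag (Nat.lt_succ_self _) _)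
        (Submodule.sum_mem _ fun c hc => Submodule.smul_mem _ _
          (single_mem_flag (Finset.mem_filter.1 hc).2 _))
    · intro i
      have := hsum T₁ (partner w) (Finset.filter_subset _ _) i
      rw [Pi.sub_apply, sub_sub_cancel_left, Valuation.map_neg]
      exact this
    · intro i
      have := hsum T₀ id (Finset.filter_subset _ _) i
      rw [hxf, Pi.add_apply, add_sub_cancel_left]
      exact this
  choose f hf1 hf2 hf3 hf4 using hf
  let Y : Matrix (Idx n) (Idx n) F := Matrix.of fun i j => Sum.elim (fun l => x *ᵥ f l) f j i
  have hYN : Y * nilp F n = x * Y := mul_nilp_of_columns (conjNilp_mul_self _) f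
  let p : Matrix (Idx n) (Idx n) F := Y * ((permG F w)⁻¹).val
  have hpw : ∀ i j, p i (w j) = Y i j := fun i j => by
    simp only [p, mul_permG_inv_apply, Equiv.symm_apply_apply]
  have hp1 : MatLE γ (p - 1) := by
    intro i j
    obtain ⟨j, rfl⟩ := w.surjective j
    rw [Matrix.sub_apply, hpw, Matrix.one_apply]
    rcases j with l | l
    · simpa [Y, Pi.single_apply] using hf4 l i
    · simpa [Y, Pi.single_apply] using hf3 l i
  obtain ⟨pG, hpG, hpGp⟩ := exists_cong_of_sub_one hγ hp1
  have hpb : pG ∈ borelSubgroup F n := by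
    intro i j hij
    rw [hpGp]
    obtain ⟨j, rfl⟩ := w.surjective j
    rw [hpw]
    rcases j with l | l
    · exact hf2 l i (Fin.lt_def.1 hij)
    · exact hf1 l i (Fin.lt_def.1 hij)
  have hpY : (pG * permG F w).val = Y := by
    rw [Units.val_mul, hpGp, mul_assoc, Units.inv_mul, mul_one]
  refine ⟨pG, hpb, hpG, (pG * permG F w)⁻¹ * (k * permG F w), inv_mul_mem_shalika ?_, ?_,
    by group⟩
  · rw [hpY]
    exact hYN
  · have := conj_mem_cong' (permG_mem_maxCompact w) (mul_mem (inv_mem hpG) hk)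
    simpa [mul_assoc] using this

end Elimination

/-! ### The character of the Shalika subgroup. -/

section ShalikaCharacter

variable {F : Type*} [Field F] {n : ℕ}

/-- The additive function `tr Y` of the element `diag(g, g) · (1, Y; 0, 1)` of the Shalika subgroup. -/
def shalikaTrace (s : G F n) : F := ((s⁻¹).val.toBlocks₁₁ * s.val.toBlocks₁₂).trace

lemma shalikaElt_val (g : GL (Fin n) F) (Y : Matrix (Fin n) (Fin n) F) :
    (shalikaElt g Y).val = Matrix.fromBlocks g.val (g.val * Y) 0 g.val := by
  simp [shalikaElt, Matrix.fromBlocks_multiply]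

lemma shalikaElt_inv_val (g : GL (Fin n) F) (Y : Matrix (Fin n) (Fin n) F) :
    ((shalikaElt g Y)⁻¹).val = Matrix.fromBlocks (g⁻¹).val (-(Y * (g⁻¹).val)) 0 (g⁻¹).val := by
  rw [shalikaElt, mul_inv_rev, Units.val_mul]
  change Matrix.fromBlocks 1 (-Y) 0 1 * Matrix.fromBlocks (g⁻¹).val 0 0 (g⁻¹).val = _
  simp [Matrix.fromBlocks_multiply]

lemma shalikaElt_mem (g : GL (Fin n) F) (Y : Matrix (Fin n) (Fin n) F) :
    shalikaElt g Y ∈ shalika F n := by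
  rw [mem_shalika, shalikaElt_val, nilp]
  simp [Matrix.fromBlocks_multiply]

lemma shalikaTrace_shalikaElt (g : GL (Fin n) F) (Y : Matrix (Fin n) (Fin n) F) :
    shalikaTrace (shalikaElt g Y) = Y.trace := by
  rw [shalikaTrace, shalikaElt_val, shalikaElt_inv_val, Matrix.toBlocks_fromBlocks₁₁,
    Matrix.toBlocks_fromBlocks₁₂, ← mul_assoc, Units.inv_mul, one_mul]

/-- Commuting with `nilp` forces the lower left block to vanish and the two diagonal blocks to
agree. -/
lemma exists_eq_shalikaElt {s : G F n} (hs : s ∈ shalika F n) :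
    ∃ g Y, s = shalikaElt g Y := by
  have key : ∀ {s : G F n}, s ∈ shalika F n → s.val = Matrix.fromBlocks s.val.toBlocks₁₁
      s.val.toBlocks₁₂ 0 s.val.toBlocks₁₁ := by
    intro s hs
    have h := mem_shalika.1 hs
    rw [← Matrix.fromBlocks_toBlocks s.val, nilp, Matrix.fromBlocks_multiply,
      Matrix.fromBlocks_multiply, Matrix.fromBlocks_inj] at h
    simp only [mul_zero, mul_one, zero_mul, one_mul, zero_add, add_zero] at h
    conv_lhs => rw [← Matrix.fromBlocks_toBlocks s.val, ← h.1, ← h.2.1]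
  have h1 := key hs
  have h2 := key (inv_mem hs)
  have h3 := s.mul_inv
  rw [h1, h2, Matrix.fromBlocks_multiply, ← Matrix.fromBlocks_one, Matrix.fromBlocks_inj] at h3
  have h4 : s.val.toBlocks₁₁ * (s⁻¹).val.toBlocks₁₁ = 1 := by simpa using h3.1
  refine ⟨⟨s.val.toBlocks₁₁, (s⁻¹).val.toBlocks₁₁, h4, mul_eq_one_comm.1 h4⟩,
    (s⁻¹).val.toBlocks₁₁ * s.val.toBlocks₁₂, Units.ext ?_⟩
  rw [shalikaElt_val]
  change s.val = Matrix.fromBlocks s.val.toBlocks₁₁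
    (s.val.toBlocks₁₁ * ((s⁻¹).val.toBlocks₁₁ * s.val.toBlocks₁₂)) 0 s.val.toBlocks₁₁
  rw [← mul_assoc, h4, one_mul]
  exact h1

lemma shalikaTrace_mul {s s' : G F n} (hs : s ∈ shalika F n) (hs' : s' ∈ shalika F n) :
    shalikaTrace (s * s') = shalikaTrace s + shalikaTrace s' := by
  obtain ⟨g, Y, rfl⟩ := exists_eq_shalikaElt hs
  obtain ⟨g', Y', rfl⟩ := exists_eq_shalikaElt hs'
  have : shalikaElt g Y * shalikaElt g' Y' =
      shalikaElt (g * g') ((g'⁻¹).val * Y * g'.val + Y') := by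
    refine Units.ext ?_
    rw [Units.val_mul, shalikaElt_val, shalikaElt_val, shalikaElt_val, Matrix.fromBlocks_multiply]
    congr 1
    · simp
    · have : g'.val * ((g'⁻¹).val * Y * g'.val) = Y * g'.val := by
        rw [← mul_assoc, ← mul_assoc, Units.mul_inv, one_mul]
      rw [Units.val_mul, mul_add, mul_assoc g.val g'.val ((g'⁻¹).val * Y * g'.val), this]
      simp only [mul_assoc]
      abel
    · simp
    · simp
  rw [this, shalikaTrace_shalikaElt, shalikaTrace_shalikaElt, shalikaTrace_shalikaElt,
    Matrix.trace_add, Matrix.trace_mul_cycle, Units.mul_inv, one_mul]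

/-- The character `Ψ` of the Shalika subgroup attached to `ψ`. -/
def shalikaChar (ψ : AddChar F Circle) (s : G F n) : ℂ := ψ (shalikaTrace s)

variable (ψ : AddChar F Circle)

lemma shalikaChar_mul {s s' : G F n} (hs : s ∈ shalika F n) (hs' : s' ∈ shalika F n) :
    shalikaChar ψ (s * s') = shalikaChar ψ s * shalikaChar ψ s' := by
  simp [shalikaChar, shalikaTrace_mul hs hs', AddChar.map_add_eq_mul]

lemma norm_shalikaChar (s : G F n) : ‖shalikaChar ψ s‖ = 1 := Circle.norm_coe _

lemma shalikaChar_ne_zero (s : G F n) : shalikaChar ψ s ≠ 0 := Circle.coe_ne_zero _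

lemma shalikaChar_one : shalikaChar ψ (1 : G F n) = 1 := by
  have := shalikaChar_mul ψ (one_mem (shalika F n)) (one_mem _)
  rw [mul_one] at this
  exact (mul_eq_left₀ (shalikaChar_ne_zero ψ _)).1 this.symm

lemma shalikaChar_inv {s : G F n} (hs : s ∈ shalika F n) :
    shalikaChar ψ s⁻¹ = (shalikaChar ψ s)⁻¹ := by
  refine eq_inv_of_mul_eq_one_left ?_
  rw [← shalikaChar_mul ψ (inv_mem hs) hs, inv_mul_cancel, shalikaChar_one]

variable [ValuativeRel F]

/-- On K the trace is integral, and ψ is trivial on the integers. -/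
lemma shalikaChar_eq_one {ψ : AddChar F Circle} [TopologicalSpace F] [IsNonarchimedeanLocalField F]
    (hψ : ConductorIsIntegers ψ) {s : G F n}
    (hk : s ∈ maxCompact F n) : shalikaChar ψ s = 1 := by
  have h : shalikaTrace s ∈ 𝒪[F] := by
    have h : shalikaTrace s =
      ∑ i, ∑ j, (s⁻¹).val (Sum.inl i) (Sum.inl j) * s.val (Sum.inl j) (Sum.inr i) := rfl
    rw [h]
    refine sum_mem fun i _ => sum_mem fun j _ => ?_
    exact mul_mem (maxCompact_apply_mem (inv_mem hk) (Sum.inl i) (Sum.inl j))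
      (maxCompact_apply_mem hk (Sum.inl j) (Sum.inr i))
  have h1 := (hψ 1).2 (one_mem _) _ h
  rw [one_mul] at h1
  simp [shalikaChar, h1]

variable [TopologicalSpace F] [IsNonarchimedeanLocalField F]

lemma isShalikaFunctional_iff {χ : Idx n → ℂˣ} {Λ : I F χ →ₗ[ℂ] ℂ} :
    IsShalikaFunctional ψ Λ ↔ ∀ s ∈ shalika F n, ∀ v,
      Λ (principalSeries χ s v) = shalikaChar ψ s * Λ v := by
  constructor
  · intro h s hs v
    obtain ⟨g, Y, rfl⟩ := exists_eq_shalikaElt hs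
    rw [h, shalikaChar, shalikaTrace_shalikaElt]
  · intro h g Y v
    rw [h _ (shalikaElt_mem g Y), shalikaChar, shalikaTrace_shalikaElt]

end ShalikaCharacter

/-! ### Rational functions on the torus with prescribed poles. -/

section Regular

variable {n : ℕ} {Q : Poly n} {h h' : D n → ℂ}

/-- The function `h` on the torus is a rational function whose poles lie on `Q = 0`. -/
def IsReg (Q : Poly n) (h : D n → ℂ) : Prop :=
  ∃ (k : ℕ) (N : Poly n), ∀ t, evalAt t Q ≠ 0 → evalAt t Q ^ k * h t = evalAt t N

lemma IsReg.congr (hh : IsReg Q h) (H : ∀ t, evalAt t Q ≠ 0 → h t = h' t) : IsReg Q h' := by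
  obtain ⟨k, N, hN⟩ := hh
  exact ⟨k, N, fun t ht => by rw [← H t ht, hN t ht]⟩

lemma isReg_evalAt (a : Poly n) : IsReg Q fun t => evalAt t a := ⟨0, a, fun t _ => by simp⟩

lemma isReg_const (c : ℂ) : IsReg Q fun _ => c := by
  simpa [evalAt] using isReg_evalAt (Q := Q) (MvPolynomial.C c : Poly n)

lemma IsReg.mul (hh : IsReg Q h) (hh' : IsReg Q h') : IsReg Q fun t => h t * h' t := by
  obtain ⟨k, N, hN⟩ := hh
  obtain ⟨k', N', hN'⟩ := hh'
  refine ⟨k + k', N * N', fun t ht => ?_⟩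
  rw [map_mul, ← hN t ht, ← hN' t ht]
  ring

lemma IsReg.add (hh : IsReg Q h) (hh' : IsReg Q h') : IsReg Q fun t => h t + h' t := by
  obtain ⟨k, N, hN⟩ := hh
  obtain ⟨k', N', hN'⟩ := hh'
  refine ⟨k + k', Q ^ k' * N + Q ^ k * N', fun t ht => ?_⟩
  rw [map_add, map_mul, map_mul, ← hN t ht, ← hN' t ht, map_pow, map_pow]
  ring

lemma IsReg.sub (hh : IsReg Q h) (hh' : IsReg Q h') : IsReg Q fun t => h t - h' t :=
  (hh.add ((isReg_const (-1)).mul hh')).congr fun t _ => by ring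

lemma IsReg.sum {ι : Type*} (s : Finset ι) {h : ι → D n → ℂ} (hh : ∀ i ∈ s, IsReg Q (h i)) :
    IsReg Q fun t => ∑ i ∈ s, h i t := by
  classical
  induction s using Finset.induction_on with
  | empty => simpa using isReg_const (Q := Q) 0
  | insert a s ha ih =>
    refine ((hh a (Finset.mem_insert_self _ _)).add (ih fun i hi =>
      hh i (Finset.mem_insert_of_mem hi))).congr fun t _ => ?_
    rw [Finset.sum_insert ha]

lemma IsReg.prod {ι : Type*} (s : Finset ι) {h : ι → D n → ℂ} (hh : ∀ i ∈ s, IsReg Q (h i)) :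
    IsReg Q fun t => ∏ i ∈ s, h i t := by
  classical
  induction s using Finset.induction_on with
  | empty => simpa using isReg_const (Q := Q) 1
  | insert a s ha ih =>
    refine ((hh a (Finset.mem_insert_self _ _)).mul (ih fun i hi =>
      hh i (Finset.mem_insert_of_mem hi))).congr fun t _ => ?_
    rw [Finset.prod_insert ha]

lemma IsReg.pow (hh : IsReg Q h) (m : ℕ) : IsReg Q fun t => h t ^ m := by
  simpa using IsReg.prod (Finset.range m) (h := fun _ => h) fun _ _ => hh

lemma isReg_inv {q : Poly n} (hq : q ∣ Q) : IsReg Q fun t => (evalAt t q)⁻¹ := by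
  obtain ⟨c, rfl⟩ := hq
  refine ⟨1, c, fun t ht => ?_⟩
  rw [map_mul] at ht ⊢
  field_simp [left_ne_zero_of_mul ht]

lemma isReg_zpow (hQ : ∀ i, MvPolynomial.X i ∣ Q) (i : Fin n) (m : ℤ) :
    IsReg Q fun t => (t i : ℂ) ^ m := by
  obtain ⟨m, rfl | rfl⟩ := m.eq_nat_or_neg
  · refine ((isReg_evalAt (MvPolynomial.X i)).pow m).congr fun t _ => ?_
    simp [evalAt]
  · refine ((isReg_inv (hQ i)).pow m).congr fun t _ => ?_
    simp [evalAt]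

/-- A polynomial that vanishes at all points of a product of infinite sets where `Q ≠ 0` is zero. -/
lemma eq_zero_of_evalAt (hQ : Q ≠ 0) {N : Poly n} (s : Fin n → Set ℂˣ) (hs : ∀ i, (s i).Infinite)
    (hN : ∀ t : D n, (∀ i, t i ∈ s i) → evalAt t Q ≠ 0 → evalAt t N = 0) : N = 0 := by
  have h : N * Q = 0 := by
    refine MvPolynomial.funext_set (fun i => Units.val '' s i)
      (fun i => (hs i).image Units.val_injective.injOn) fun x hx => ?_
    choose t ht htx using fun i => hx i (Set.mem_univ i)
    have hx' : x = fun i => (t i : ℂ) := funext fun i => (htx i).symm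
    have h1 : ∀ p : Poly n, MvPolynomial.eval x p = evalAt t p := fun p => by
      rw [hx', evalAt, MvPolynomial.aeval_eq_eval]
    rw [h1, map_mul, map_zero]
    by_cases hq : evalAt t Q = 0
    · rw [hq, mul_zero]
    · rw [hN t ht hq, zero_mul]
  exact (mul_eq_zero.1 h).resolve_right hQ

lemma IsReg.eq_zero (hQ : Q ≠ 0) (hh : IsReg Q h) (s : Fin n → Set ℂˣ) (hs : ∀ i, (s i).Infinite)
    (h0 : ∀ t : D n, (∀ i, t i ∈ s i) → evalAt t Q ≠ 0 → h t = 0) {t : D n}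
    (ht : evalAt t Q ≠ 0) : h t = 0 := by
  obtain ⟨k, N, hN⟩ := hh
  have hN0 : N = 0 := eq_zero_of_evalAt hQ s hs fun t ht hq => by
    rw [← hN t hq, h0 t ht hq, mul_zero]
  have := hN t ht
  rw [hN0, map_zero] at this
  exact (mul_eq_zero.1 this).resolve_left (pow_ne_zero _ ht)

variable {F : Type*} [Field F] [ValuativeRel F] [TopologicalSpace F] [IsNonarchimedeanLocalField F]

/-- The exponents of the monomial `χ(p)` in the Satake parameters. -/
def charExponent (p : G F n) (i : Fin n) : ℤ :=
  ord (p.val (Sum.inl i) (Sum.inl i)) - ord (p.val (Sum.inr i.rev) (Sum.inr i.rev))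

lemma unramChar_chiOf (t : D n) (p : G F n) :
    unramChar (chiOf t) p = ∏ i, (t i : ℂ) ^ charExponent p i := by
  rw [unramChar, Fintype.prod_sum_type]
  have h1 : ∏ j : Fin n, (chiOf t (Sum.inr j) : ℂ) ^ ord (p.val (Sum.inr j) (Sum.inr j)) =
      ∏ i : Fin n, (t i : ℂ) ^ (-ord (p.val (Sum.inr i.rev) (Sum.inr i.rev))) := by
    rw [← Equiv.prod_comp Fin.revPerm]
    refine Finset.prod_congr rfl fun i _ => ?_
    simp [chiOf]
  rw [h1, ← Finset.prod_mul_distrib]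
  refine Finset.prod_congr rfl fun i _ => ?_
  rw [charExponent, sub_eq_add_neg, zpow_add₀ (t i).ne_zero]
  rfl

lemma isReg_chiDelta (hQ : ∀ i, MvPolynomial.X i ∣ Q) (p : G F n) :
    IsReg Q fun t => chiDelta (chiOf t) p :=
  ((IsReg.prod Finset.univ fun i _ => isReg_zpow hQ i (charExponent p i)).mul
    (isReg_const (Real.sqrt (modulus p) : ℂ))).congr fun t _ => by
      rw [chiDelta, unramChar_chiOf]

/-- With e split into positive and negative parts, the polynomial c equals a t^e - b up to a
monomial, which has no zeros on the torus. As c divides Q, its inverse is regular where Q ≠ 0. -/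
lemma isReg_inv_chiDelta_sub (hQ : ∀ i, MvPolynomial.X i ∣ Q) (e : Fin n → ℤ) (a b : ℂ) {c : Poly n}
    (hc : c = MvPolynomial.C a * ∏ i, MvPolynomial.X i ^ (e i).toNat -
      MvPolynomial.C b * ∏ i, MvPolynomial.X i ^ (-e i).toNat) (hcQ : c ∣ Q) :
    (IsReg Q fun t => (a * ∏ i, (t i : ℂ) ^ e i - b)⁻¹) ∧
      ∀ t, evalAt t Q ≠ 0 → a * ∏ i, (t i : ℂ) ^ e i - b ≠ 0 := by
  have key : ∀ t : D n, evalAt t c = (∏ i, (t i : ℂ) ^ (-e i).toNat) *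
      (a * ∏ i, (t i : ℂ) ^ e i - b) := by
    intro t
    have h1 : ∏ i, (t i : ℂ) ^ (e i).toNat = (∏ i, (t i : ℂ) ^ (-e i).toNat) *
        ∏ i, (t i : ℂ) ^ e i := by
      rw [← Finset.prod_mul_distrib]
      refine Finset.prod_congr rfl fun i _ => ?_
      rw [← zpow_natCast, ← zpow_natCast, ← zpow_add₀ (t i).ne_zero]
      congr 1
      omega
    rw [hc]
    simp only [evalAt, map_sub, map_mul, map_prod, map_pow, MvPolynomial.aeval_X,
      MvPolynomial.aeval_C, Algebra.algebraMap_self, RingHom.id_apply]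
    rw [h1]
    ring
  have hne : ∀ t : D n, ∏ i, (t i : ℂ) ^ (-e i).toNat ≠ 0 := fun t =>
    Finset.prod_ne_zero_iff.2 fun i _ => pow_ne_zero _ (t i).ne_zero
  refine ⟨?_, fun t ht => ?_⟩
  · refine ((IsReg.prod Finset.univ (h := fun i t => (t i : ℂ) ^ (-e i).toNat) fun i _ => ?_).mul
      (isReg_inv hcQ)).congr fun t ht => ?_
    · exact (isReg_zpow hQ i ((-e i).toNat : ℤ)).congr fun t _ => zpow_natCast _ _
    · rw [key, mul_inv, ← mul_assoc, mul_inv_cancel₀ (hne t), one_mul]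
  · obtain ⟨d, rfl⟩ := hcQ
    rw [map_mul, key] at ht
    exact right_ne_zero_of_mul (left_ne_zero_of_mul ht)

/-- With a ≠ 0, the two terms cancel only if both the exponents and the coefficients agree, that is,
if e = 0 and a = b. -/
lemma sub_monomial_ne_zero (e : Fin n → ℤ) {a b : ℂ} (ha : a ≠ 0) (h : e ≠ 0 ∨ a ≠ b) :
    (MvPolynomial.C a * ∏ i, MvPolynomial.X i ^ (e i).toNat -
      MvPolynomial.C b * ∏ i, MvPolynomial.X i ^ (-e i).toNat : Poly n) ≠ 0 := by
  have hmon : ∀ (a : ℂ) (d : Fin n → ℕ), (MvPolynomial.C a * ∏ i, MvPolynomial.X i ^ d i : Poly n) =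
      MvPolynomial.monomial (Finsupp.equivFunOnFinite.symm d) a := by
    intro a d
    rw [MvPolynomial.monomial_eq, Finsupp.prod_fintype _ _ (by simp)]
    rfl
  rw [hmon, hmon, sub_ne_zero]
  intro heq
  rw [MvPolynomial.monomial_eq_monomial_iff] at heq
  rcases heq with ⟨h1, h2⟩ | ⟨h1, -⟩
  · refine h.elim (fun he => he (funext fun i => ?_)) (fun hab => hab h2)
    have := congrFun (Finsupp.equivFunOnFinite.symm.injective h1) i
    simp only [Pi.zero_apply] at this ⊢
    omega
  · exact ha h1

end Regular

/-! ### Vectors of the principal series. -/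

section Vectors

variable {F : Type*} [Field F] [ValuativeRel F] [TopologicalSpace F]
  [IsNonarchimedeanLocalField F] {n : ℕ} {γ γ' : ValueGroupWithZero F}

lemma chiDelta_one (χ : Idx n → ℂˣ) : chiDelta χ (1 : G F n) = 1 :=
  chiDelta_eq_one χ (one_mem _) (one_mem _)

lemma isLocallyConstant_of_cong {α : Type*} {f : G F n → α} (hγ : γ ≠ 0)
    (hf : ∀ g, ∀ c ∈ cong n γ, f (g * c) = f g) : IsLocallyConstant f := by
  refine (IsLocallyConstant.iff_exists_open _).2 fun g => ⟨(fun x => g⁻¹ * x) ⁻¹' (cong n γ : Set _),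
    (isOpen_cong hγ).preimage (continuous_const_mul _), by simp [one_mem], fun x hx => ?_⟩
  rw [← hf g _ hx, mul_inv_cancel_left]

/-- A vector of `I(χ)` from an equivariant function that is invariant under a congruence
subgroup. -/
def mkI {χ : Idx n → ℂˣ} (f : G F n → ℂ) (hγ : γ ≠ 0)
    (hf : ∀ g, ∀ c ∈ cong n γ, f (g * c) = f g)
    (hp : ∀ p ∈ borelSubgroup F n, ∀ g, f (p * g) = chiDelta χ p * f g) : I F χ :=
  ⟨f, isLocallyConstant_of_cong hγ hf, hp⟩

/-- The Borel component of an Iwasawa decomposition. -/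
def borelPart (g : G F n) : G F n := (exists_iwasawa g).choose

lemma borelPart_mem (g : G F n) : borelPart g ∈ borelSubgroup F n := (exists_iwasawa g).choose_spec.1

/-- The component in `K` of an Iwasawa decomposition. -/
def compactPart (g : G F n) : maxCompact F n :=
  ⟨(exists_iwasawa g).choose_spec.2.choose, (exists_iwasawa g).choose_spec.2.choose_spec.1⟩

lemma borelPart_mul_compactPart (g : G F n) : borelPart g * (compactPart g : G F n) = g :=
  (exists_iwasawa g).choose_spec.2.choose_spec.2.symm

/-- Each point of K has a level that works near it. Finitely many cosets cover the compact group K,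
and the smallest of their levels works everywhere. -/
lemma X_exists_cong (x : X F n) : ∃ γ : ValueGroupWithZero F, γ ≠ 0 ∧ γ < 1 ∧
    ∀ k c : maxCompact F n, (c : G F n) ∈ cong n γ → x.1 (k * c) = x.1 k := by
  have hloc : ∀ k : maxCompact F n, ∃ γ : ValueGroupWithZero F, γ ≠ 0 ∧ γ < 1 ∧
      ∀ c : maxCompact F n, (c : G F n) ∈ cong n γ → x.1 (k * c) = x.1 k := by
    intro k
    have hopen : IsOpen {c : maxCompact F n | x.1 (k * c) = x.1 k} :=
      (x.2.1.isOpen_fiber (x.1 k)).preimage (continuous_const_mul k)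
    obtain ⟨U, hU, hUeq⟩ := isOpen_induced_iff.1 hopen
    have h1 : (1 : maxCompact F n) ∈ Subtype.val ⁻¹' U := by rw [hUeq]; simp
    obtain ⟨γ, h0, hlt, hsub⟩ := exists_cong_subset (hU.mem_nhds h1)
    refine ⟨γ, h0, hlt, fun c hc => ?_⟩
    have : c ∈ Subtype.val ⁻¹' U := hsub hc
    rw [hUeq] at this
    exact this
  choose δ h0 h1 hδ using hloc
  have : CompactSpace (maxCompact F n) := isCompact_iff_compactSpace.1 isCompact_maxCompact
  let V : maxCompact F n → Set (maxCompact F n) := fun k =>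
    {k' | ((k⁻¹ * k' : maxCompact F n) : G F n) ∈ cong n (δ k)}
  have hV : ∀ k, IsOpen (V k) := fun k => (isOpen_cong (h0 k)).preimage (by fun_prop)
  obtain ⟨T, hT⟩ := isCompact_univ.elim_finite_subcover V hV fun k _ =>
    Set.mem_iUnion.2 ⟨k, by simp [V, one_mem]⟩
  have hTne : T.Nonempty := by
    obtain ⟨k, hk⟩ := Set.mem_iUnion.1 (hT (Set.mem_univ 1))
    obtain ⟨hk, -⟩ := Set.mem_iUnion.1 hk
    exact ⟨k, hk⟩
  obtain ⟨k₀, hk₀, hmin⟩ := Finset.exists_min_image T δ hTne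
  refine ⟨δ k₀, h0 k₀, h1 k₀, fun k c hc => ?_⟩
  obtain ⟨k', hk'⟩ := Set.mem_iUnion.1 (hT (Set.mem_univ k))
  obtain ⟨hk'T, hk'⟩ := Set.mem_iUnion.1 hk'
  have e1 := hδ k' _ hk'
  have e2 := hδ k' (k'⁻¹ * k * c) (by
    rw [Subgroup.coe_mul]
    exact mul_mem hk' (cong_mono (hmin k' hk'T) hc))
  rw [mul_inv_cancel_left] at e1
  rw [mul_assoc, mul_inv_cancel_left] at e2
  rw [e1, e2]

/-- An Iwasawa decomposition is unique up to P ∩ K, where χδ^{1/2} is trivial and under which x is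
invariant. Hence the extension to G does not depend on the choices. -/
lemma X_apply_eq (χ : Idx n → ℂˣ) (x : X F n) {p p' : G F n} (hp : p ∈ borelSubgroup F n)
    (hp' : p' ∈ borelSubgroup F n) {k k' : maxCompact F n} (h : p * k = p' * k') :
    chiDelta χ p * x.1 k = chiDelta χ p' * x.1 k' := by
  have h1 : p'⁻¹ * p = k' * (k : G F n)⁻¹ := by
    rw [inv_mul_eq_iff_eq_mul, ← mul_assoc, ← h, mul_inv_cancel_right]
  have h2 : p'⁻¹ * p ∈ borelSubgroup F n := mul_mem (inv_mem hp') hp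
  have h3 : p'⁻¹ * p ∈ maxCompact F n := h1 ▸ mul_mem k'.2 (inv_mem k.2)
  have h4 := x.2.2 ⟨_, h3⟩ h2 k
  have h5 : (⟨p'⁻¹ * p, h3⟩ : maxCompact F n) * k = k' := by
    refine Subtype.ext ?_
    change p'⁻¹ * p * (k : G F n) = k'
    rw [h1, inv_mul_cancel_right]
  rw [h5] at h4
  rw [h4, show p = p' * (p'⁻¹ * p) by group, chiDelta_mul χ hp' h2, chiDelta_eq_one χ h2 h3, mul_one]

/-- The extension of a function on `K` to an element of `I(χ)`. -/
def ext (χ : Idx n → ℂˣ) : X F n →ₗ[ℂ] I F χ where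
  toFun x := mkI (fun g => chiDelta χ (borelPart g) * x.1 (compactPart g)) (X_exists_cong x).choose_spec.1
    (fun g c hc => by
      have hcK : c ∈ maxCompact F n := hc.1
      rw [← (X_exists_cong x).choose_spec.2.2 (compactPart g) ⟨c, hcK⟩ hc]
      refine X_apply_eq χ x (borelPart_mem _) (borelPart_mem _) ?_
      rw [borelPart_mul_compactPart, Subgroup.coe_mul, ← mul_assoc, borelPart_mul_compactPart])
    (fun p hp g => by
      rw [← mul_assoc, ← chiDelta_mul χ hp (borelPart_mem g)]
      refine X_apply_eq χ x (borelPart_mem _) (mul_mem hp (borelPart_mem _)) ?_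
      rw [borelPart_mul_compactPart, mul_assoc, borelPart_mul_compactPart])
  map_add' x y := Subtype.ext <| funext fun g => mul_add _ _ _
  map_smul' c x := Subtype.ext <| funext fun g => mul_left_comm _ _ _

lemma ext_apply (χ : Idx n → ℂˣ) (x : X F n) (g : G F n) :
    (ext χ x).1 g = chiDelta χ (borelPart g) * x.1 (compactPart g) := rfl

lemma ext_resK (χ : Idx n → ℂˣ) (v : I F χ) : ext χ (resK χ v) = v := by
  refine Subtype.ext <| funext fun g => ?_
  rw [ext_apply]
  change _ * v.1 (compactPart g) = _
  rw [← v.2.2 _ (borelPart_mem g), borelPart_mul_compactPart]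

lemma resK_ext (χ : Idx n → ℂˣ) (x : X F n) : resK χ (ext χ x) = x := by
  refine Subtype.ext <| funext fun k => ?_
  change (ext χ x).1 k = _
  rw [ext_apply, X_apply_eq χ x (borelPart_mem _) (one_mem _)
    (k' := k) (by rw [borelPart_mul_compactPart, one_mul]), chiDelta_one, one_mul]

lemma ext_injective (χ : Idx n → ℂˣ) : Function.Injective (ext (F := F) χ) := fun x y h => by
  rw [← resK_ext χ x, h, resK_ext]

lemma I_ext {χ : Idx n → ℂˣ} {v v' : I F χ} (h : ∀ k ∈ maxCompact F n, v.1 k = v'.1 k) :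
    v = v' := by
  rw [← ext_resK χ v, ← ext_resK χ v']
  congr 1
  exact Subtype.ext <| funext fun k => h k k.2

open Classical in
/-- The equivariant function supported on `P E` with value `1` on `E`. -/
def indFun (χ : Idx n → ℂˣ) (E : Set (G F n)) (g : G F n) : ℂ :=
  if h : ∃ p ∈ borelSubgroup F n, p⁻¹ * g ∈ E then chiDelta χ h.choose else 0

variable {E : Set (G F n)}

/-- By the hypothesis on E, two admissible choices of p differ by an element of P ∩ K, on which
χδ^{1/2} is 1. -/
lemma indFun_eq (hE : ∀ a ∈ E, ∀ b ∈ E, a * b⁻¹ ∈ maxCompact F n) (χ : Idx n → ℂˣ) {p g : G F n}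
    (hp : p ∈ borelSubgroup F n) (hg : p⁻¹ * g ∈ E) : indFun χ E g = chiDelta χ p := by
  have h : ∃ p ∈ borelSubgroup F n, p⁻¹ * g ∈ E := ⟨p, hp, hg⟩
  unfold indFun
  rw [dif_pos h]
  obtain ⟨h1, h2⟩ := h.choose_spec
  have h3 : p⁻¹ * h.choose ∈ maxCompact F n := by
    have := hE _ hg _ h2
    simpa [mul_assoc] using this
  have h4 : p⁻¹ * h.choose ∈ borelSubgroup F n := mul_mem (inv_mem hp) h1
  have h5 := chiDelta_mul χ hp h4
  rw [chiDelta_eq_one χ h4 h3, mul_one, mul_inv_cancel_left] at h5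
  exact h5

lemma indFun_eq_zero (χ : Idx n → ℂˣ) {g : G F n}
    (h : ¬ ∃ p ∈ borelSubgroup F n, p⁻¹ * g ∈ E) : indFun χ E g = 0 := by
  unfold indFun
  rw [dif_neg h]

/-- The vector of `I(χ)` supported on `P E` with value `1` on `E`. -/
def indVec (χ : Idx n → ℂˣ) (hE : ∀ a ∈ E, ∀ b ∈ E, a * b⁻¹ ∈ maxCompact F n) (hγ : γ ≠ 0)
    (hEγ : ∀ a ∈ E, ∀ c ∈ cong n γ, a * c ∈ E) : I F χ :=
  mkI (indFun χ E) hγ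
    (fun g c hc => by
      by_cases h : ∃ p ∈ borelSubgroup F n, p⁻¹ * g ∈ E
      · obtain ⟨p, hp, hg⟩ := h
        rw [indFun_eq hE χ hp hg, indFun_eq hE χ hp]
        rw [← mul_assoc]; exact hEγ _ hg _ hc
      · rw [indFun_eq_zero χ h, indFun_eq_zero χ]
        rintro ⟨p, hp, hg⟩
        refine h ⟨p, hp, ?_⟩
        simpa [mul_assoc] using hEγ _ hg _ (inv_mem hc))
    (fun p hp g => by
      by_cases h : ∃ p ∈ borelSubgroup F n, p⁻¹ * g ∈ E
      · obtain ⟨p', hp', hg⟩ := h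
        rw [indFun_eq hE χ hp' hg, indFun_eq hE χ (mul_mem hp hp'), chiDelta_mul χ hp hp']
        simpa [mul_assoc] using hg
      · rw [indFun_eq_zero χ h, indFun_eq_zero χ, mul_zero]
        rintro ⟨p', hp', hg⟩
        refine h ⟨p⁻¹ * p', mul_mem (inv_mem hp) hp', ?_⟩
        simpa [mul_assoc] using hg)

lemma mul_inv_mem_of_permG (w : Equiv.Perm (Idx n)) :
    ∀ a ∈ {g : G F n | (permG F w)⁻¹ * g ∈ cong n γ}, ∀ b ∈ {g : G F n | (permG F w)⁻¹ * g ∈ cong n γ},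
      a * b⁻¹ ∈ maxCompact F n := by
  intro a ha b hb
  have h1 : a * b⁻¹ = permG F w * (((permG F w)⁻¹ * a) * ((permG F w)⁻¹ * b)⁻¹) *
    (permG F w)⁻¹ := by group
  rw [h1]
  exact mul_mem (mul_mem (permG_mem_maxCompact w) (mul_mem ha.1 (inv_mem hb.1)))
    (inv_mem (permG_mem_maxCompact w))

/-- The vector of `I(χ)` supported on `P w U` with value `1` on `w U`, for a permutation matrix `w`
and a congruence subgroup `U`. -/
def permVec (χ : Idx n → ℂˣ) (w : Equiv.Perm (Idx n)) (hγ : γ ≠ 0) : I F χ :=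
  indVec χ (mul_inv_mem_of_permG (γ := γ) w) hγ fun a ha c hc => by
    change _ * (a * c) ∈ cong n γ
    rw [← mul_assoc]; exact mul_mem ha hc

lemma permVec_apply (χ : Idx n → ℂˣ) (w : Equiv.Perm (Idx n)) (hγ : γ ≠ 0) {p c : G F n}
    (hp : p ∈ borelSubgroup F n) (hc : c ∈ cong n γ) :
    (permVec χ w hγ).1 (p * permG F w * c) = chiDelta χ p := by
  refine indFun_eq (mul_inv_mem_of_permG w) χ hp ?_
  change (permG F w)⁻¹ * (p⁻¹ * (p * permG F w * c)) ∈ cong n γ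
  rw [mul_assoc p, inv_mul_cancel_left, inv_mul_cancel_left]
  exact hc

lemma exists_of_permVec_ne_zero {χ : Idx n → ℂˣ} {w : Equiv.Perm (Idx n)} {hγ : γ ≠ 0} {g : G F n}
    (h : (permVec χ w hγ).1 g ≠ 0) :
    ∃ p ∈ borelSubgroup F n, ∃ c ∈ cong n γ, g = p * permG F w * c := by
  by_contra hcon
  refine h (indFun_eq_zero χ ?_)
  rintro ⟨p, hp, hg⟩
  exact hcon ⟨p, hp, _, hg, by group⟩

/-- Since w ∈ K normalizes the congruence subgroups, c can be moved to the left of w, and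
`exists_of_rankSum_eq` applies. -/
lemma exists_shalika_of_rankSum_eq (hγ : γ < 1) {w : Equiv.Perm (Idx n)} {p c : G F n}
    (hp : p ∈ borelSubgroup F n) (hc : c ∈ cong n γ)
    (h : rankSum (p * permG F w * c) = rankSum (permG F w)) :
    ∃ p' ∈ borelSubgroup F n, p' ∈ maxCompact F n ∧ ∃ s ∈ shalika F n, s ∈ cong n γ ∧
      p * permG F w * c = p * p' * permG F w * s := by
  have h1 : permG F w * c = (permG F w * c * (permG F w)⁻¹) * permG F w := by group
  rw [mul_assoc, rankSum_borel_mul hp, h1] at h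
  obtain ⟨p', hp', hpγ, s, hs, hsγ, heq⟩ := exists_of_rankSum_eq hγ
    (conj_mem_cong (permG_mem_maxCompact w) hc) w h
  refine ⟨p', hp', hpγ.1, s, hs, hsγ, ?_⟩
  rw [mul_assoc, h1, heq]
  group

lemma rankSum_permG_le_of_mem (hγ : γ < 1) (w : Equiv.Perm (Idx n)) {p c : G F n}
    (hp : p ∈ borelSubgroup F n) (hc : c ∈ cong n γ) :
    rankSum (permG F w) ≤ rankSum (p * permG F w * c) := by
  have h1 : permG F w * c = (permG F w * c * (permG F w)⁻¹) * permG F w := by group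
  rw [mul_assoc, rankSum_borel_mul hp, h1]
  exact rankSum_permG_le hγ (conj_mem_cong (permG_mem_maxCompact w) hc) w

end Vectors

/-! ### Families over the torus and their coefficients. -/

section Families

variable {F : Type*} [Field F] [ValuativeRel F] [TopologicalSpace F]
  [IsNonarchimedeanLocalField F] {n : ℕ} {γ γ' : ValueGroupWithZero F}

/-- Families of vectors of the representations `I(χ)`, for `χ` in the torus `D`. -/
abbrev Fam (F : Type*) [Field F] [ValuativeRel F] [TopologicalSpace F]
    [IsNonarchimedeanLocalField F] (n : ℕ) : Type _ := ∀ t : D n, I F (chiOf t)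

/-- Right translation of a family. -/
def translate (g : G F n) (v : Fam F n) : Fam F n := fun t => principalSeries (chiOf t) g (v t)

/-- Multiplication of a family by a function on the torus. -/
def scale (h : D n → ℂ) (v : Fam F n) : Fam F n := fun t => h t • v t

/-- The vector `R_{ξ⁻¹} φ_B`. -/
def testVec (F : Type*) [Field F] [ValuativeRel F] [TopologicalSpace F]
    [IsNonarchimedeanLocalField F] (n : ℕ) : Fam F n :=
  translate (xi F n)⁻¹ fun t => phiB (chiOf t)

lemma translate_apply (g x : G F n) (v : Fam F n) (t : D n) :
    (translate g v t).1 x = (v t).1 (x * g) := rfl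

lemma translate_mul (g h : G F n) (v : Fam F n) : translate (g * h) v = translate g (translate h v) :=
  funext fun t => by simp [translate]

lemma translate_one (v : Fam F n) : translate 1 v = v := funext fun t => by simp [translate]

variable (ψ : AddChar F Circle) (Q : Poly n)

/-- The values of the Shalika functionals on the family `v` are `h` times their values on
`testVec`. -/
def IsCoef (v : Fam F n) (h : D n → ℂ) : Prop :=
  IsReg Q h ∧ ∀ t, evalAt t Q ≠ 0 → ∀ Λ : I F (chiOf t) →ₗ[ℂ] ℂ,
    IsShalikaFunctional ψ Λ → Λ (v t) = h t * Λ (testVec F n t)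

/-- The values of the Shalika functionals on the family `v` are regular multiples of their values on
`testVec`. -/
def IsDetermined (v : Fam F n) : Prop := ∃ h, IsCoef ψ Q v h

/-- Families of functions with regular values that are invariant under a common congruence
subgroup. -/
structure IsRegFam (v : Fam F n) : Prop where
  exists_cong : ∃ γ : ValueGroupWithZero F, γ ≠ 0 ∧ ∀ t g, ∀ c ∈ cong n γ, (v t).1 (g * c) = (v t).1 g
  isReg : ∀ g, IsReg Q fun t => (v t).1 g

variable {ψ Q} {v v' : Fam F n} {h h' : D n → ℂ}

lemma sub_eq_add_scale (v v' : Fam F n) : v - v' = v + scale (fun _ => -1) v' :=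
  funext fun t => (sub_eq_add_neg _ _).trans (congrArg (v t + ·) (neg_one_smul ℂ (v' t)).symm)

lemma isCoef_testVec : IsCoef ψ Q (testVec F n) fun _ => 1 :=
  ⟨isReg_const 1, fun _ _ _ _ => (one_mul _).symm⟩

lemma IsCoef.add (hv : IsCoef ψ Q v h) (hv' : IsCoef ψ Q v' h') :
    IsCoef ψ Q (v + v') fun t => h t + h' t :=
  ⟨hv.1.add hv'.1, fun t ht Λ hΛ => by
    rw [Pi.add_apply, map_add, hv.2 t ht Λ hΛ, hv'.2 t ht Λ hΛ, add_mul]⟩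

lemma IsCoef.scale {a : D n → ℂ} (ha : IsReg Q a) (hv : IsCoef ψ Q v h) :
    IsCoef ψ Q (scale a v) fun t => a t * h t :=
  ⟨ha.mul hv.1, fun t ht Λ hΛ => by
    rw [Shalika.scale, map_smul, hv.2 t ht Λ hΛ, smul_eq_mul, mul_assoc]⟩

lemma IsCoef.sum {ι : Type*} (s : Finset ι) {v : ι → Fam F n} {h : ι → D n → ℂ}
    (hv : ∀ i ∈ s, IsCoef ψ Q (v i) (h i)) :
    IsCoef ψ Q (∑ i ∈ s, v i) fun t => ∑ i ∈ s, h i t :=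
  ⟨IsReg.sum s fun i hi => (hv i hi).1, fun t ht Λ hΛ => by
    rw [Finset.sum_apply, map_sum, Finset.sum_mul]
    exact Finset.sum_congr rfl fun i hi => (hv i hi).2 t ht Λ hΛ⟩

lemma IsCoef.translate (hv : IsCoef ψ Q v h) {s : G F n} (hs : s ∈ shalika F n) :
    IsCoef ψ Q (translate s v) fun t => shalikaChar ψ s * h t :=
  ⟨(isReg_const _).mul hv.1, fun t ht Λ hΛ => by
    rw [Shalika.translate, (isShalikaFunctional_iff ψ).1 hΛ s hs, hv.2 t ht Λ hΛ, mul_assoc]⟩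

lemma isDetermined_testVec : IsDetermined ψ Q (testVec F n) := ⟨_, isCoef_testVec⟩

lemma IsDetermined.add (hv : IsDetermined ψ Q v) (hv' : IsDetermined ψ Q v') :
    IsDetermined ψ Q (v + v') := ⟨_, hv.choose_spec.add hv'.choose_spec⟩

lemma IsDetermined.scale {a : D n → ℂ} (ha : IsReg Q a) (hv : IsDetermined ψ Q v) :
    IsDetermined ψ Q (scale a v) := ⟨_, hv.choose_spec.scale ha⟩

lemma IsDetermined.sub (hv : IsDetermined ψ Q v) (hv' : IsDetermined ψ Q v') :
    IsDetermined ψ Q (v - v') := by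
  rw [sub_eq_add_scale]
  exact hv.add (hv'.scale (isReg_const (-1)))

lemma IsDetermined.zero : IsDetermined ψ Q (0 : Fam F n) :=
  ⟨fun _ => 0, isReg_const 0, fun t _ Λ _ => by simp⟩

lemma IsDetermined.sum {ι : Type*} (s : Finset ι) {v : ι → Fam F n}
    (hv : ∀ i ∈ s, IsDetermined ψ Q (v i)) : IsDetermined ψ Q (∑ i ∈ s, v i) :=
  Finset.sum_induction _ _ (fun _ _ => IsDetermined.add) IsDetermined.zero hv

lemma IsDetermined.translate (hv : IsDetermined ψ Q v) {s : G F n} (hs : s ∈ shalika F n) :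
    IsDetermined ψ Q (translate s v) := ⟨_, hv.choose_spec.translate hs⟩

/-- Shalika functionals vanish on this family, so the coefficient is 0. The relation holds even if v
itself is not known to be determined. -/
lemma isDetermined_translate_sub (v : Fam F n) {s : G F n} (hs : s ∈ shalika F n) :
    IsDetermined ψ Q (translate s v - scale (fun _ => shalikaChar ψ s) v) := by
  refine ⟨fun _ => 0, isReg_const 0, fun t ht Λ hΛ => ?_⟩
  rw [Pi.sub_apply, map_sub, Shalika.translate, (isShalikaFunctional_iff ψ).1 hΛ s hs,
    Shalika.scale, map_smul]
  simp

lemma IsRegFam.add (hv : IsRegFam Q v) (hv' : IsRegFam Q v') : IsRegFam Q (v + v') := by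
  obtain ⟨⟨γ, h0, h⟩, hr⟩ := hv
  obtain ⟨⟨γ', h0', h'⟩, hr'⟩ := hv'
  refine ⟨⟨min γ γ', ?_, fun t g c hc => ?_⟩, fun g => (hr g).add (hr' g)⟩
  · rcases min_choice γ γ' with h | h <;> rw [h] <;> assumption
  · exact congrArg₂ (· + ·) (h t g c (cong_mono (min_le_left _ _) hc))
      (h' t g c (cong_mono (min_le_right _ _) hc))

lemma IsRegFam.scale {h : D n → ℂ} (hh : IsReg Q h) (hv : IsRegFam Q v) :
    IsRegFam Q (scale h v) := by
  obtain ⟨⟨γ, h0, h1⟩, hr⟩ := hv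
  exact ⟨⟨γ, h0, fun t g c hc => congrArg (h t * ·) (h1 t g c hc)⟩, fun g => hh.mul (hr g)⟩

lemma IsRegFam.sub (hv : IsRegFam Q v) (hv' : IsRegFam Q v') : IsRegFam Q (v - v') := by
  rw [sub_eq_add_scale]
  exact hv.add (hv'.scale (isReg_const (-1)))

lemma IsRegFam.zero : IsRegFam Q (0 : Fam F n) :=
  ⟨⟨1, one_ne_zero, fun _ _ _ _ => rfl⟩, fun _ => isReg_const 0⟩

lemma IsRegFam.sum {ι : Type*} (s : Finset ι) {v : ι → Fam F n}
    (hv : ∀ i ∈ s, IsRegFam Q (v i)) : IsRegFam Q (∑ i ∈ s, v i) :=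
  Finset.sum_induction _ _ (fun _ _ => IsRegFam.add) IsRegFam.zero hv

lemma IsRegFam.translate (hv : IsRegFam Q v) (s : G F n) : IsRegFam Q (translate s v) := by
  obtain ⟨⟨γ, h0, h⟩, hr⟩ := hv
  obtain ⟨γ', h0', -, -, hc⟩ := exists_conj_cong_le s⁻¹ h0
  refine ⟨⟨γ', h0', fun t g c hcm => ?_⟩, fun g => hr (g * s)⟩
  have h1 := h t (g * s) _ (hc c hcm)
  rw [translate_apply, translate_apply, ← h1]
  group

lemma isRegFam_indVec (hQ : ∀ i, MvPolynomial.X i ∣ Q) {E : Set (G F n)}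
    (hE : ∀ a ∈ E, ∀ b ∈ E, a * b⁻¹ ∈ maxCompact F n) (hγ : γ ≠ 0)
    (hEγ : ∀ a ∈ E, ∀ c ∈ cong n γ, a * c ∈ E) :
    IsRegFam Q fun t => indVec (chiOf t) hE hγ hEγ := by
  refine ⟨⟨γ, hγ, fun t g c hc => ?_⟩, fun g => ?_⟩
  · change indFun _ E (g * c) = indFun _ E g
    by_cases h : ∃ p ∈ borelSubgroup F n, p⁻¹ * g ∈ E
    · obtain ⟨p, hp, hg⟩ := h
      rw [indFun_eq hE _ hp hg, indFun_eq hE _ hp]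
      rw [← mul_assoc]; exact hEγ _ hg _ hc
    · rw [indFun_eq_zero _ h, indFun_eq_zero]
      rintro ⟨p, hp, hg⟩
      refine h ⟨p, hp, ?_⟩
      simpa [mul_assoc] using hEγ _ hg _ (inv_mem hc)
  · change IsReg Q fun t => indFun (chiOf t) E g
    by_cases h : ∃ p ∈ borelSubgroup F n, p⁻¹ * g ∈ E
    · obtain ⟨p, hp, hg⟩ := h
      exact (isReg_chiDelta hQ p).congr fun t _ => (indFun_eq hE _ hp hg).symm
    · exact (isReg_const 0).congr fun t _ => (indFun_eq_zero _ h).symm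

/-- The family of vectors supported on `P w U`. -/
def permFam (w : Equiv.Perm (Idx n)) (hγ : γ ≠ 0) : Fam F n := fun t => permVec (chiOf t) w hγ

lemma isRegFam_permFam (hQ : ∀ i, MvPolynomial.X i ∣ Q) (w : Equiv.Perm (Idx n)) (hγ : γ ≠ 0) :
    IsRegFam Q (permFam (F := F) w hγ) := 
  isRegFam_indVec hQ (mul_inv_mem_of_permG w) hγ fun a ha c hc => by
    change _ * (a * c) ∈ cong n γ
    rw [← mul_assoc]
    exact mul_mem ha hc

lemma isRegFam_phiB (hQ : ∀ i, MvPolynomial.X i ∣ Q) :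
    IsRegFam Q fun t => phiB (F := F) (chiOf t) := by
  obtain ⟨γ, h0, -, hsub⟩ := exists_cong_subset (isOpen_iwahori.mem_nhds (one_mem (iwahori F n)))
  exact isRegFam_indVec hQ (E := (iwahori F n : Set (G F n)))
    (fun a ha b hb => iwahori_le_maxCompact (mul_mem ha (inv_mem hb))) h0
    fun a ha c hc => mul_mem ha (hsub hc)

lemma isRegFam_ext (hQ : ∀ i, MvPolynomial.X i ∣ Q) (x : X F n) :
    IsRegFam Q fun t => ext (chiOf t) x := by
  obtain ⟨γ, h0, -, h⟩ := X_exists_cong x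
  refine ⟨⟨γ, h0, fun t g c hc => ?_⟩, fun g =>
    (isReg_chiDelta hQ (borelPart g)).mul (isReg_const (x.1 (compactPart g)))⟩
  have hcK : c ∈ maxCompact F n := hc.1
  rw [ext_apply, ext_apply, ← h (compactPart g) ⟨c, hcK⟩ hc]
  refine X_apply_eq _ x (borelPart_mem _) (borelPart_mem _) ?_
  rw [borelPart_mul_compactPart, Subgroup.coe_mul, ← mul_assoc, borelPart_mul_compactPart]

end Families

/-! ### Reduction to one vector on a double coset. -/

section Average

variable {F : Type*} [Field F] [ValuativeRel F] [TopologicalSpace F]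
  [IsNonarchimedeanLocalField F] {n : ℕ} {γ : ValueGroupWithZero F}

/-- The product of the stabilizer of `P w` in the Shalika subgroup and of its congruence subgroup. -/
def stabMul (w : Equiv.Perm (Idx n)) (γ : ValueGroupWithZero F) : Set (G F n) :=
  {τ | ∃ s' ∈ shalika F n, permG F w * s' * (permG F w)⁻¹ ∈ borelSubgroup F n ∧
    ∃ s ∈ shalika F n ⊓ cong n γ, τ = s' * s}

variable (w : Equiv.Perm (Idx n)) (H : Subgroup (G F n)) (γ)

/-- The cosets of a subgroup `H` of the Shalika subgroup by the congruence subgroup. -/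
abbrev CosetsOf : Type _ := H ⧸ (shalika F n ⊓ cong n γ).subgroupOf H

/-- The number of cosets that meet the stabilizer of `P w`. -/
def stabCount : ℕ := Nat.card {q : CosetsOf γ H // (q.out : G F n) ∈ stabMul w γ}

/-- The number of orbits of the congruence subgroup on `P w H` modulo `P`, up to multiplicity. -/
def orbitRatio : ℝ := Nat.card (CosetsOf γ H) / stabCount γ w H

variable {γ w H}

lemma finite_cosetsOf (hfin : (shalika F n ⊓ cong n γ).relIndex H ≠ 0) :
    Finite (CosetsOf γ H) := by
  have : ((shalika F n ⊓ cong n γ).subgroupOf H).FiniteIndex := ⟨hfin⟩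
  exact Subgroup.finite_quotient_of_finiteIndex

lemma mul_mem_stabMul_iff {τ s : G F n} (hs : s ∈ shalika F n ⊓ cong n γ) :
    τ * s ∈ stabMul w γ ↔ τ ∈ stabMul w γ := by
  constructor
  · rintro ⟨s', h1, h2, s₁, h3, h4⟩
    exact ⟨s', h1, h2, s₁ * s⁻¹, mul_mem h3 (inv_mem hs), by rw [← mul_assoc, ← h4]; group⟩
  · rintro ⟨s', h1, h2, s₁, h3, rfl⟩
    exact ⟨s', h1, h2, s₁ * s, mul_mem h3 hs, by group⟩

lemma out_mem_stabMul_iff (η τ : H) :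
    (η * ((τ : CosetsOf γ H).out : G F n)) ∈ stabMul w γ ↔ (η * τ : G F n) ∈ stabMul w γ := by
  obtain ⟨s, hs⟩ := QuotientGroup.mk_out_eq_mul ((shalika F n ⊓ cong n γ).subgroupOf H) τ
  rw [hs, Subgroup.coe_mul, ← mul_assoc]
  exact mul_mem_stabMul_iff s.2

/-- Left multiplication by η permutes the cosets, so the count does not depend on η. -/
lemma card_mul_out_mem_stabMul (η : H) :
    Nat.card {q : CosetsOf γ H // (η * q.out : G F n) ∈ stabMul w γ} = stabCount γ w H := by
  refine Nat.card_congr (Equiv.subtypeEquiv (MulAction.toPerm η) fun q => ?_)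
  induction q using QuotientGroup.induction_on with
  | _ τ =>
    have h1 := out_mem_stabMul_iff (w := w) (γ := γ) (1 : H) (η * τ)
    rw [out_mem_stabMul_iff, MulAction.toPerm_apply, MulAction.Quotient.smul_coe, smul_eq_mul]
    simpa using h1.symm

lemma stabCount_pos (hfin : (shalika F n ⊓ cong n γ).relIndex H ≠ 0) : 0 < stabCount γ w H := by
  have : Finite (CosetsOf γ H) := finite_cosetsOf hfin
  refine Nat.card_pos_iff.2 ⟨⟨⟨((1 : H) : CosetsOf γ H), ?_⟩⟩, inferInstance⟩
  have h1 := out_mem_stabMul_iff (w := w) (γ := γ) (1 : H) (1 : H)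
  simp only [OneMemClass.coe_one, one_mul] at h1
  exact h1.2 ⟨1, one_mem _, by simp [one_mem], 1, one_mem _, by simp⟩

lemma orbitRatio_pos (hfin : (shalika F n ⊓ cong n γ).relIndex H ≠ 0) : 0 < orbitRatio γ w H := by
  have : Finite (CosetsOf γ H) := finite_cosetsOf hfin
  have h1 : 0 < Nat.card (CosetsOf γ H) := Nat.card_pos
  have h2 := stabCount_pos (w := w) hfin
  exact div_pos (by exact_mod_cast h1) (by exact_mod_cast h2)

variable (hγ : γ ≠ 0) (hγ1 : γ < 1) {ψ : AddChar F Circle} {Q : Poly n} {v : Fam F n}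
  (hH : H ≤ shalika F n) (hle : shalika F n ⊓ cong n γ ≤ H)
  (hfin : (shalika F n ⊓ cong n γ).relIndex H ≠ 0)

include hγ1 hle in
lemma exists_of_permVec_mul_ne_zero {χ : Idx n → ℂˣ} {g τ : G F n} (hH : H ≤ shalika F n)
    (hτ : τ ∈ H) (h : (permVec χ w hγ).1 (g * τ) ≠ 0) :
    rankSum (permG F w) < rankSum g ∨ ∃ p ∈ borelSubgroup F n, ∃ η ∈ H, g = p * permG F w * η := by
  obtain ⟨p, hp, c, hc, heq⟩ := exists_of_permVec_ne_zero h
  have h1 := rankSum_permG_le_of_mem hγ1 w hp hc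
  rw [← heq, rankSum_mul_shalika g (hH hτ)] at h1
  rcases h1.lt_or_eq with h2 | h2
  · exact Or.inl h2
  · rw [← rankSum_mul_shalika g (hH hτ), heq] at h2
    obtain ⟨p', hp', -, s, hs, hsγ, heq'⟩ := exists_shalika_of_rankSum_eq hγ1 hp hc h2.symm
    refine Or.inr ⟨p * p', mul_mem hp hp', s * τ⁻¹, mul_mem (hle ⟨hs, hsγ⟩) (inv_mem hτ), ?_⟩
    rw [← mul_assoc, ← heq', ← heq, mul_inv_cancel_right]

include hγ1 hH hle hfin in
-- On PwH, v is a combination of S-translates of the single vector u supported on PwU. The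
-- translates of u by representatives τ of H modulo S ∩ U, weighted by v(wτ⁻¹), cover every point of
-- PwH exactly `stabCount` times. The difference then lives on higher strata, where `ih` applies.
lemma isDetermined_sub_average (hQ : ∀ i, MvPolynomial.X i ∣ Q)
    (ih : ∀ v : Fam F n, IsRegFam Q v →
      (∀ t g, (v t).1 g ≠ 0 → rankSum (permG F w) < rankSum g) → IsDetermined ψ Q v)
    (hv : IsRegFam Q v)
    (hsupp : ∀ t g, (v t).1 g ≠ 0 → rankSum (permG F w) < rankSum g ∨
      ∃ p ∈ borelSubgroup F n, ∃ η ∈ H, g = p * permG F w * η)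
    (hinv : ∀ t, ∀ s ∈ shalika F n ⊓ cong n γ, ∀ τ ∈ H,
      (v t).1 (permG F w * (s * τ)) = (v t).1 (permG F w * τ)) :
    IsDetermined ψ Q (v - scale (fun _ => (stabCount γ w H : ℂ)⁻¹)
      (∑ᶠ q : CosetsOf γ H, scale (fun t => (v t).1 (permG F w * (q.out : G F n)⁻¹))
        (translate (q.out : G F n) (permFam w hγ)))) := by
  classical
  have hfinite : Finite (CosetsOf γ H) := finite_cosetsOf hfin
  have := Fintype.ofFinite (CosetsOf γ H)
  rw [finsum_eq_sum_of_fintype]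
  refine ih _ (hv.sub (IsRegFam.scale (isReg_const _) (IsRegFam.sum _ fun q _ =>
    IsRegFam.scale (hv.isReg _) ((isRegFam_permFam hQ w hγ).translate _)))) ?_
  intro t g hne
  by_contra hlt
  refine hne ?_
  have hval : ((v - scale (fun _ => (stabCount γ w H : ℂ)⁻¹)
      (∑ q : CosetsOf γ H, scale (fun t => (v t).1 (permG F w * (q.out : G F n)⁻¹))
        (translate (q.out : G F n) (permFam w hγ)))) t).1 g =
      (v t).1 g - (stabCount γ w H : ℂ)⁻¹ * ∑ q : CosetsOf γ H,
        (v t).1 (permG F w * (q.out : G F n)⁻¹) * (permVec (chiOf t) w hγ).1 (g * q.out) := by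
    simp [scale, translate_apply, permFam, Finset.sum_apply]
  rw [hval]
  by_cases hg : ∃ p ∈ borelSubgroup F n, ∃ η ∈ H, g = p * permG F w * η
  · obtain ⟨p, hp, η, hη, rfl⟩ := hg
    -- The translate indexed by q is non-zero at p w η exactly if η q.out fixes Pw up to S ∩ U;
    -- equivariance of v then makes the product of weight and translate equal to v(p w η).
    have hterm : ∀ q : CosetsOf γ H, (v t).1 (permG F w * (q.out : G F n)⁻¹) *
        (permVec (chiOf t) w hγ).1 (p * permG F w * η * q.out) =
        if (η * q.out : G F n) ∈ stabMul w γ then (v t).1 (p * permG F w * η) else 0 := by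
      intro q
      split_ifs with hq
      · obtain ⟨s', hs', hb, s, hs, heq⟩ := hq
        have hη' : p * permG F w * η =
            (p * (permG F w * s' * (permG F w)⁻¹)) * (permG F w * (s * (q.out : G F n)⁻¹)) := by
          rw [show η = s' * s * (q.out : G F n)⁻¹ by rw [← heq]; group]
          group
        have h1 : p * permG F w * η * q.out =
            (p * (permG F w * s' * (permG F w)⁻¹)) * permG F w * s := by
          rw [mul_assoc (p * permG F w), heq]
          group
        rw [h1, permVec_apply _ w hγ (mul_mem hp hb) hs.2, hη', (v t).2.2 _ (mul_mem hp hb),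
          hinv t s hs _ (inv_mem q.out.2), mul_comm]
      -- The rank sum does not change on PwS, so a non-zero value gives p₁ and s in P and S, and
      -- these exhibit η q.out as an element of `stabMul`.
      · by_contra hne'
        have hne2 := right_ne_zero_of_mul hne'
        obtain ⟨p₁, hp₁, c, hc, heq⟩ := exists_of_permVec_ne_zero hne2
        have h2 : rankSum (p₁ * permG F w * c) = rankSum (permG F w) := by
          rw [← heq, mul_assoc (p * permG F w), rankSum_mul_shalika _
            (hH (mul_mem hη q.out.2)), rankSum_borel_mul hp]
        obtain ⟨p', hp', -, s, hs, hsγ, heq'⟩ := exists_shalika_of_rankSum_eq hγ1 hp₁ hc h2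
        refine hq ⟨η * q.out * s⁻¹, mul_mem (hH (mul_mem hη q.out.2)) (inv_mem hs), ?_, s,
          ⟨hs, hsγ⟩, by group⟩
        have h3 : permG F w * (η * (q.out : G F n) * s⁻¹) * (permG F w)⁻¹ = p⁻¹ * (p₁ * p') := by
          have h4 : permG F w * η * q.out = p⁻¹ * (p₁ * p' * permG F w * s) := by
            rw [← heq', ← heq]; group
          calc _ = (permG F w * η * q.out) * s⁻¹ * (permG F w)⁻¹ := by group
            _ = _ := by rw [h4]; group
        rw [h3]
        exact mul_mem (inv_mem hp) (mul_mem hp₁ hp')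
    rw [Finset.sum_congr rfl fun q _ => hterm q, Finset.sum_ite, Finset.sum_const_zero, add_zero,
      Finset.sum_const, nsmul_eq_mul, ← Fintype.card_subtype, ← Nat.card_eq_fintype_card,
      card_mul_out_mem_stabMul ⟨η, hη⟩, ← mul_assoc, inv_mul_cancel₀, one_mul, sub_self]
    exact_mod_cast (stabCount_pos hfin).ne'
  · have h1 : (v t).1 g = 0 := by
      by_contra h
      exact (hsupp t g h).elim hlt hg
    rw [h1, Finset.sum_eq_zero, mul_zero, sub_zero]
    intro q _
    by_contra h
    exact (exists_of_permVec_mul_ne_zero hγ hγ1 hle hH q.out.2 (right_ne_zero_of_mul h)).elim hlt hg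

include hγ1 hH hle hfin in
lemma isDetermined_of_permFam (hQ : ∀ i, MvPolynomial.X i ∣ Q)
    (ih : ∀ v : Fam F n, IsRegFam Q v →
      (∀ t g, (v t).1 g ≠ 0 → rankSum (permG F w) < rankSum g) → IsDetermined ψ Q v)
    (hv : IsRegFam Q v)
    (hsupp : ∀ t g, (v t).1 g ≠ 0 → rankSum (permG F w) < rankSum g ∨
      ∃ p ∈ borelSubgroup F n, ∃ η ∈ H, g = p * permG F w * η)
    (hinv : ∀ t, ∀ s ∈ shalika F n ⊓ cong n γ, ∀ τ ∈ H,
      (v t).1 (permG F w * (s * τ)) = (v t).1 (permG F w * τ))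
    (hu : IsDetermined ψ Q (permFam w hγ)) : IsDetermined ψ Q v := by
  have h1 := isDetermined_sub_average hγ hγ1 hH hle hfin hQ ih hv hsupp hinv
  have hfinite : Finite (CosetsOf γ H) := finite_cosetsOf hfin
  have := Fintype.ofFinite (CosetsOf γ H)
  rw [finsum_eq_sum_of_fintype] at h1
  have h2 := h1.add (IsDetermined.scale (isReg_const ((stabCount γ w H : ℂ)⁻¹))
    (IsDetermined.sum Finset.univ fun (q : CosetsOf γ H) _ => IsDetermined.scale
      (hv.isReg (permG F w * (q.out : G F n)⁻¹)) (hu.translate (hH q.out.2))))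
  rwa [sub_add_cancel] at h2

include hγ1 hH hle hfin in
-- When v is constant on wH and Ψ is trivial on H, every translate of u may be replaced by u itself,
-- and the average collapses to `orbitRatio` times u. Here u need not be determined, which is what
-- makes relations between such vectors possible.
lemma isDetermined_sub_scale_permFam (hQ : ∀ i, MvPolynomial.X i ∣ Q)
    (ih : ∀ v : Fam F n, IsRegFam Q v →
      (∀ t g, (v t).1 g ≠ 0 → rankSum (permG F w) < rankSum g) → IsDetermined ψ Q v)
    (hv : IsRegFam Q v)
    (hsupp : ∀ t g, (v t).1 g ≠ 0 → rankSum (permG F w) < rankSum g ∨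
      ∃ p ∈ borelSubgroup F n, ∃ η ∈ H, g = p * permG F w * η)
    (hψ : ∀ τ ∈ H, shalikaChar ψ τ = 1) {c : D n → ℂ}
    (hc : ∀ t, ∀ τ ∈ H, (v t).1 (permG F w * τ) = c t) :
    IsDetermined ψ Q (v - scale (fun t => c t * (orbitRatio γ w H : ℂ)) (permFam w hγ)) := by
  have h1 := isDetermined_sub_average hγ hγ1 hH hle hfin hQ ih hv hsupp fun t s hs τ hτ => by
    rw [hc t τ hτ, hc t _ (mul_mem (hle hs) hτ)]
  have hfinite : Finite (CosetsOf γ H) := finite_cosetsOf hfin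
  have := Fintype.ofFinite (CosetsOf γ H)
  rw [finsum_eq_sum_of_fintype] at h1
  have hcr : IsReg Q c := (hv.isReg (permG F w * 1)).congr fun t _ => hc t 1 (one_mem _)
  have h2 := h1.add (IsDetermined.scale (isReg_const ((stabCount γ w H : ℂ)⁻¹))
    (IsDetermined.sum Finset.univ fun (q : CosetsOf γ H) _ => IsDetermined.scale hcr
      (isDetermined_translate_sub (ψ := ψ) (permFam w hγ) (hH q.out.2))))
  convert h2 using 1
  funext t
  refine Subtype.ext (funext fun g => ?_)
  have hval : ∀ f : CosetsOf γ H → Fam F n, ((∑ q, f q) t).1 g = ∑ q, (f q t).1 g := fun f => by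
    simp [Finset.sum_apply]
  let f₁ : CosetsOf γ H → Fam F n := fun q =>
    scale (fun t => (v t).1 (permG F w * (q.out : G F n)⁻¹))
      (translate (q.out : G F n) (permFam w hγ))
  let f₂ : CosetsOf γ H → Fam F n := fun q => scale c (translate (q.out : G F n) (permFam w hγ) -
    scale (fun _ => shalikaChar ψ (q.out : G F n)) (permFam w hγ))
  change (v t).1 g - c t * (orbitRatio γ w H : ℂ) * (permFam w hγ t).1 g =
    (v t).1 g - (stabCount γ w H : ℂ)⁻¹ * ((∑ q, f₁ q) t).1 g +
      (stabCount γ w H : ℂ)⁻¹ * ((∑ q, f₂ q) t).1 g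
  rw [hval, hval, sub_add, ← mul_sub, ← Finset.sum_sub_distrib,
    Finset.sum_congr rfl (g := fun _ => c t * (permFam w hγ t).1 g)]
  · rw [Finset.sum_const, Finset.card_univ, nsmul_eq_mul, orbitRatio, Nat.card_eq_fintype_card]
    push_cast
    ring
  · intro q _
    change (v t).1 (permG F w * (q.out : G F n)⁻¹) * (translate (q.out : G F n) (permFam w hγ) t).1 g
      - c t * ((translate (q.out : G F n) (permFam w hγ) t).1 g -
        shalikaChar ψ (q.out : G F n) * (permFam w hγ t).1 g) = _
    rw [hψ _ q.out.2, hc t _ (inv_mem q.out.2)]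
    ring

end Average

/-! ### Diagonal matrices. -/

section Diagonal

variable {F : Type*} [Field F] {n : ℕ}

/-- The diagonal matrices of `GL_{2n}`. -/
def diagG (F : Type*) [Field F] (n : ℕ) : (Idx n → Fˣ) →* G F n :=
  (Units.map (Matrix.diagonalRingHom (Idx n) F : (Idx n → F) →* _)).comp
    MulEquiv.piUnits.symm.toMonoidHom

lemma diagG_val (a : Idx n → Fˣ) : (diagG F n a).val = Matrix.diagonal fun i => (a i : F) := rfl

lemma diagG_apply_self (a : Idx n → Fˣ) (i : Idx n) : (diagG F n a).val i i = a i := by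
  rw [diagG_val, Matrix.diagonal_apply_eq]

lemma diagG_mem_borelSubgroup (a : Idx n → Fˣ) : diagG F n a ∈ borelSubgroup F n :=
  Matrix.blockTriangular_diagonal _

lemma diagG_mem_shalika {a : Idx n → Fˣ} (ha : ∀ j, a (Sum.inl j) = a (Sum.inr j)) :
    diagG F n a ∈ shalika F n := by
  rw [mem_shalika, diagG_val, nilp]
  ext (i | i) (j | j) <;> simp [Matrix.one_apply, ha]
  split_ifs with h
  · rw [h]
  · rfl

lemma conj_permG_diagG (w : Equiv.Perm (Idx n)) (a : Idx n → Fˣ) :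
    permG F w * diagG F n a * (permG F w)⁻¹ = diagG F n (a ∘ w.symm) := by
  refine Units.ext (Matrix.ext fun i j => ?_)
  rw [Units.val_mul, Units.val_mul, conj_permG_apply, diagG_val, diagG_val]
  simp [Matrix.diagonal_apply]

lemma shalikaChar_conj (ψ : AddChar F Circle) {h s : G F n} (hh : h ∈ shalika F n)
    (hs : s ∈ shalika F n) : shalikaChar ψ (h * s * h⁻¹) = shalikaChar ψ s := by
  rw [shalikaChar_mul ψ (mul_mem hh hs) (inv_mem hh), shalikaChar_mul ψ hh hs,
    shalikaChar_inv ψ hh]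
  field_simp [shalikaChar_ne_zero ψ h]

end Diagonal

/-! ### Orders, the modulus and the Iwahori subgroup. -/

section Orders

variable {F : Type*} [Field F] [ValuativeRel F] [TopologicalSpace F]
  [IsNonarchimedeanLocalField F] {n : ℕ}

lemma ord_one : ord (1 : F) = 0 := ord_eq_zero (map_one _)

lemma exists_ord_pos : ∃ a : Fˣ, 0 < ord (a : F) ∧ valuation F (a : F) < 1 := by
  obtain ⟨γ, h0, h1⟩ := exists_val_ne_zero_lt_one (F := F)
  obtain ⟨a, rfl⟩ := valuation_surjective γ
  have ha : a ≠ 0 := by rintro rfl; simp at h0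
  refine ⟨Units.mk0 a ha, ?_, h1⟩
  by_contra h
  rw [not_lt, Units.val_mk0, ← ord_one (F := F), log_val_le_log_val ha one_ne_zero, map_one] at h
  exact absurd h1 h.not_gt

lemma resCard_pos : 0 < (resCard F : ℝ) := by
  have : 0 < Nat.card 𝓀[F] := Nat.card_pos
  exact_mod_cast this

lemma absF_pos (a : F) : 0 < absF a := zpow_pos resCard_pos _

lemma modulus_pos (p : G F n) : 0 < modulus p :=
  Finset.prod_pos fun _ _ => zpow_pos (absF_pos _) _

lemma modulus_eq_one {p : G F n} (hp : ∀ i, p.val i i = 1) : modulus p = 1 := by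
  simp [modulus, hp, absF, ord_one]

/-- If ψ were trivial, the conductor condition would make the inverse of an element of the maximal
ideal integral. -/
lemma exists_addChar_ne_one {ψ : AddChar F Circle} (hψ : ConductorIsIntegers ψ) :
    ∃ y, ψ y ≠ 1 := by
  obtain ⟨a, -, ha⟩ := exists_ord_pos (F := F)
  by_contra! h
  have h1 : (a⁻¹ : F) ∈ 𝒪[F] := (hψ _).1 fun x _ => h _
  have h2 : valuation F (a⁻¹ : F) ≤ 1 := h1
  rw [map_inv₀, inv_le_one₀ (zero_lt_iff.2 ((valuation F).ne_zero_iff.2 a.ne_zero))] at h2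
  exact absurd ha h2.not_gt

lemma iwahori_apply_lt {b : G F n} (hb : b ∈ iwahori F n) {i j : Idx n} (h : pos j < pos i) :
    valuation F (b.val i j) < 1 := by
  obtain ⟨k, hk, rfl⟩ := hb
  have h1 : IsLocalRing.residue 𝒪[F] (k.val i j) = 0 := hk h
  rw [IsLocalRing.residue_eq_zero_iff, IsLocalRing.mem_maximalIdeal, mem_nonunits_iff,
    Valuation.Integers.isUnit_iff_valuation_eq_one
      (Valuation.integer.integers (ValuativeRel.valuation F))] at h1
  exact lt_of_le_of_ne (k.val i j).2 h1

lemma mem_iwahori {b : G F n} (hb : b ∈ maxCompact F n)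
    (h : ∀ i j, pos j < pos i → valuation F (b.val i j) < 1) : b ∈ iwahori F n := by
  obtain ⟨k, rfl⟩ := hb
  refine ⟨k, fun i j hij => ?_, rfl⟩
  change IsLocalRing.residue 𝒪[F] (k.val i j) = 0
  rw [IsLocalRing.residue_eq_zero_iff, IsLocalRing.mem_maximalIdeal, mem_nonunits_iff,
    Valuation.Integers.isUnit_iff_valuation_eq_one
      (Valuation.integer.integers (ValuativeRel.valuation F))]
  exact (h i j hij).ne

lemma borel_inf_maxCompact_le_iwahori {p : G F n} (hp : p ∈ borelSubgroup F n)
    (hk : p ∈ maxCompact F n) : p ∈ iwahori F n :=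
  mem_iwahori hk fun i j hij => by rw [hp hij]; simp

lemma cong_le_iwahori {γ : ValueGroupWithZero F} (hγ : γ < 1) : cong n γ ≤ iwahori F n :=
  fun b hb => mem_iwahori hb.1 fun i j hij => by
    have h := hb.2 i j
    rw [Matrix.sub_apply, Matrix.one_apply_ne (by rintro rfl; exact lt_irrefl _ hij), sub_zero] at h
    exact h.trans_lt hγ

/-- An element of the Iwahori subgroup is the product of an upper triangular integral matrix and of
an element of a proper congruence subgroup. -/
lemma exists_of_mem_iwahori {b : G F n} (hb : b ∈ iwahori F n) :
    ∃ γ : ValueGroupWithZero F, γ < 1 ∧ ∃ p ∈ borelSubgroup F n, p ∈ maxCompact F n ∧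
      ∃ c ∈ cong n γ, b = p * c := by
  classical
  have hK := iwahori_le_maxCompact hb
  -- The largest valuation below the diagonal. Clearing these entries changes b by a factor
  -- congruent to 1 modulo γ.
  obtain ⟨γ, hγ1, hγ⟩ : ∃ γ : ValueGroupWithZero F, γ < 1 ∧
      ∀ i j, pos j < pos i → valuation F (b.val i j) ≤ γ := by
    let s : Finset (Idx n × Idx n) := Finset.univ.filter fun x => pos x.2 < pos x.1
    refine ⟨s.sup fun x => valuation F (b.val x.1 x.2), ?_, fun i j hij =>
      Finset.le_sup (f := fun x : Idx n × Idx n => valuation F (b.val x.1 x.2)) (b := (i, j))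
        (by simpa [s] using hij)⟩
    rw [Finset.sup_lt_iff (by exact zero_lt_one)]
    exact fun x hx => iwahori_apply_lt hb (by simpa [s] using hx)
  let A : Matrix (Idx n) (Idx n) F := Matrix.of fun i j => if pos j < pos i then 0 else b.val i j
  have hA : ∀ i j, valuation F (A i j) ≤ 1 := by
    intro i j
    simp only [A, Matrix.of_apply]
    split_ifs
    · simp
    · exact matLE_of_mem hK i j
  have hsub : MatLE γ (b.val - A) := by
    intro i j
    simp only [A, Matrix.sub_apply, Matrix.of_apply]
    split_ifs with h
    · simpa using hγ i j h
    · simp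
  have h1 : MatLE γ ((b⁻¹).val * A - 1) := by
    have h2 : (b⁻¹).val * A - 1 = -((b⁻¹).val * (b.val - A)) := by
      rw [mul_sub, Units.inv_mul, neg_sub]
    rw [h2]
    simpa using ((matLE_of_mem (inv_mem hK)).mul hsub).neg
  obtain ⟨c, hc, hcA⟩ := exists_cong_of_sub_one hγ1 h1
  refine ⟨γ, hγ1, b * c, ?_, mul_mem hK hc.1, c⁻¹, inv_mem hc, by group⟩
  change (b * c).val.BlockTriangular pos
  rw [Units.val_mul, hcA, ← mul_assoc, Units.mul_inv, one_mul]
  intro i j hij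
  simp [A, hij]

lemma relIndex_shalika_inf_cong_ne_zero {γ : ValueGroupWithZero F} (hγ : γ ≠ 0)
    {H C : Subgroup (G F n)} (hH : H ≤ shalika F n) (hHC : H ≤ C)
    (hC : IsCompact (C : Set (G F n))) : (shalika F n ⊓ cong n γ).relIndex H ≠ 0 := by
  refine Subgroup.relIndex_inf_ne_zero ?_ fun h => ?_
  · rw [Subgroup.relIndex_eq_one.2 hH]; exact one_ne_zero
  · exact relIndex_ne_zero_of_isCompact (isOpen_cong hγ) hC
      (Subgroup.relIndex_eq_zero_of_le_right hHC h)

lemma isCompact_map_conj (h : G F n) :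
    IsCompact ((maxCompact F n).map (MulAut.conj h).toMonoidHom : Set (G F n)) := by
  rw [Subgroup.coe_map]
  refine isCompact_maxCompact.image ?_
  change Continuous fun g => h * g * h⁻¹
  fun_prop

end Orders

/-! ### Elimination of a double coset by a character obstruction. -/

section Kill

variable {F : Type*} [Field F] [ValuativeRel F] [TopologicalSpace F]
  [IsNonarchimedeanLocalField F] {n : ℕ} {γ γ' : ValueGroupWithZero F}
  {ψ : AddChar F Circle} {Q : Poly n} {v v' : Fam F n} {w : Equiv.Perm (Idx n)}

lemma IsDetermined.congr (hv : IsDetermined ψ Q v) (h : ∀ t, evalAt t Q ≠ 0 → v t = v' t) :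
    IsDetermined ψ Q v' := by
  obtain ⟨f, hf, hh⟩ := hv
  exact ⟨f, hf, fun t ht Λ hΛ => by rw [← h t ht, hh t ht Λ hΛ]⟩

lemma IsDetermined.of_scale {f : D n → ℂ} (hv : IsDetermined ψ Q (Shalika.scale f v))
    (hf : IsReg Q fun t => (f t)⁻¹) (h0 : ∀ t, evalAt t Q ≠ 0 → f t ≠ 0) : IsDetermined ψ Q v :=
  (hv.scale hf).congr fun t ht => by
    rw [Shalika.scale, Shalika.scale, smul_smul, inv_mul_cancel₀ (h0 t ht), one_smul]

/-- Families supported where the rank sum is larger than at `w` are determined. -/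
def DeterminedAbove (ψ : AddChar F Circle) (Q : Poly n) (w : Equiv.Perm (Idx n)) : Prop :=
  ∀ v : Fam F n, IsRegFam Q v →
    (∀ t g, (v t).1 g ≠ 0 → rankSum (permG F w) < rankSum g) → IsDetermined ψ Q v

/-- Change of level: the vector of level γ is constant on w(S ∩ U_γ), and Ψ is trivial on this part
of S because it lies in K. Modulo determined families it is thus a positive multiple of the vector
of level γ'. -/
lemma isDetermined_permFam_sub (hψ : ConductorIsIntegers ψ) (hQ : ∀ i, MvPolynomial.X i ∣ Q)
    (ih : DeterminedAbove ψ Q w) (hγ : γ ≠ 0) (hγ1 : γ < 1) (hγ' : γ' ≠ 0) (hle : γ' ≤ γ) :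
    IsDetermined ψ Q (permFam w hγ -
      scale (fun _ => (orbitRatio γ' w (shalika F n ⊓ cong n γ) : ℂ)) (permFam w hγ')) := by
  have h := isDetermined_sub_scale_permFam (w := w) hγ' (hle.trans_lt hγ1)
    (H := shalika F n ⊓ cong n γ) (v := permFam w hγ) inf_le_left
    (inf_le_inf_left _ (cong_mono hle))
    (relIndex_shalika_inf_cong_ne_zero hγ' inf_le_left
      (inf_le_right.trans cong_le_maxCompact) isCompact_maxCompact)
    hQ ih (isRegFam_permFam hQ w hγ)
    (fun t g hne => by
      refine exists_of_permVec_mul_ne_zero (w := w) (τ := 1) hγ hγ1 le_rfl inf_le_left (one_mem _)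
        (χ := chiOf t) ?_
      rwa [mul_one])
    (fun τ hτ => shalikaChar_eq_one hψ hτ.2.1) (c := fun _ => 1)
    (fun t τ hτ => by
      have h1 := permVec_apply (chiOf t) w hγ (one_mem (borelSubgroup F n)) hτ.2
      rw [one_mul, chiDelta_one] at h1
      exact h1)
  simpa only [one_mul] using h

/-- Since whw⁻¹ ∈ P, the translate by h is supported on Pw(hUh⁻¹), and on w(S ∩ hUh⁻¹) it has the
constant value χδ^{1/2}(whw⁻¹). The conjugate group need not lie in K, but Ψ is still trivial on its
intersection with S, by invariance under conjugation. -/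
lemma isDetermined_translate_permFam_sub (hψ : ConductorIsIntegers ψ)
    (hQ : ∀ i, MvPolynomial.X i ∣ Q)
    (ih : DeterminedAbove ψ Q w) (hγ : γ ≠ 0) (hγ1 : γ < 1) (hγ' : γ' ≠ 0) (hγ1' : γ' < 1)
    {h : G F n} (hh : h ∈ shalika F n) (hp : permG F w * h * (permG F w)⁻¹ ∈ borelSubgroup F n)
    (hle : ∀ c ∈ cong n γ', h⁻¹ * c * h⁻¹⁻¹ ∈ cong n γ) :
    IsDetermined ψ Q (translate h (permFam w hγ) -
      scale (fun t => chiDelta (chiOf t) (permG F w * h * (permG F w)⁻¹) *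
        (orbitRatio γ' w (shalika F n ⊓ (cong n γ).map (MulAut.conj h).toMonoidHom) : ℂ))
        (permFam w hγ')) := by
  have hmem : ∀ τ ∈ shalika F n ⊓ (cong n γ).map (MulAut.conj h).toMonoidHom,
      ∃ s ∈ shalika F n ⊓ cong n γ, τ = h * s * h⁻¹ := by
    rintro _ ⟨hs, s, hsγ, rfl⟩
    refine ⟨s, ⟨?_, hsγ⟩, rfl⟩
    have hs' : h * s * h⁻¹ ∈ shalika F n := hs
    have := mul_mem (mul_mem (inv_mem hh) hs') hh
    have h2 : h⁻¹ * (h * s * h⁻¹) * h = s := by group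
    rwa [h2] at this
  refine isDetermined_sub_scale_permFam (w := w) hγ' hγ1'
    (H := shalika F n ⊓ (cong n γ).map (MulAut.conj h).toMonoidHom) inf_le_left
    (fun s hs => ⟨hs.1, h⁻¹ * s * h⁻¹⁻¹, hle s hs.2, ?_⟩)
    (relIndex_shalika_inf_cong_ne_zero hγ' inf_le_left
      (inf_le_right.trans (Subgroup.map_mono cong_le_maxCompact)) (isCompact_map_conj h))
    hQ ih ((isRegFam_permFam hQ w hγ).translate h) (fun t g hne => ?_) (fun τ hτ => ?_)
    (fun t τ hτ => ?_)
  · change h * (h⁻¹ * s * h⁻¹⁻¹) * h⁻¹ = s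
    group
  · obtain ⟨p, hpb, c, hc, heq⟩ := exists_of_permVec_ne_zero (χ := chiOf t) (w := w) (hγ := hγ) hne
    have h1 := rankSum_permG_le_of_mem hγ1 w hpb hc
    rcases h1.lt_or_eq with h2 | h2
    · rw [← heq, rankSum_mul_shalika g hh] at h2
      exact Or.inl h2
    · obtain ⟨p', hp', -, s, hs, hsγ, heq'⟩ := exists_shalika_of_rankSum_eq hγ1 hpb hc h2.symm
      have hs' : h * s * h⁻¹ ∈ shalika F n := mul_mem (mul_mem hh hs) (inv_mem hh)
      refine Or.inr ⟨p * p' * (permG F w * h * (permG F w)⁻¹)⁻¹,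
        mul_mem (mul_mem hpb hp') (inv_mem hp), h * s * h⁻¹,
        ⟨hs', s, hsγ, rfl⟩, ?_⟩
      have h3 : g = p * p' * permG F w * s * h⁻¹ := by
        rw [← heq', ← heq, mul_inv_cancel_right]
      rw [h3]
      group
  · obtain ⟨s, hs, rfl⟩ := hmem τ hτ
    rw [shalikaChar_conj ψ hh hs.1, shalikaChar_eq_one hψ hs.2.1]
  · obtain ⟨s, hs, rfl⟩ := hmem τ hτ
    rw [← permVec_apply (chiOf t) w hγ hp hs.2]
    change (permVec (chiOf t) w hγ).1 (permG F w * (h * s * h⁻¹) * h) = _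
    group

/-- Both levels are compared with their minimum, and the ratios are positive, hence invertible. -/
lemma isDetermined_permFam_of_exists (hψ : ConductorIsIntegers ψ) (hQ : ∀ i, MvPolynomial.X i ∣ Q)
    (ih : DeterminedAbove ψ Q w) {γ₀ : ValueGroupWithZero F} (h0 : γ₀ ≠ 0) (h1 : γ₀ < 1)
    (hu : IsDetermined ψ Q (permFam w h0)) (hγ : γ ≠ 0) (hγ1 : γ < 1) :
    IsDetermined ψ Q (permFam w hγ) := by
  have hm : min γ γ₀ ≠ 0 := by rcases min_choice γ γ₀ with h | h <;> rw [h] <;> assumption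
  have h2 := isDetermined_permFam_sub hψ hQ ih h0 h1 hm (min_le_right _ _)
  have h3 := isDetermined_permFam_sub hψ hQ ih hγ hγ1 hm (min_le_left _ _)
  have h4 : IsDetermined ψ Q (permFam w hm) := by
    have h5 := hu.sub h2
    rw [sub_sub_cancel] at h5
    refine h5.of_scale (isReg_const _) fun _ _ => ?_
    exact_mod_cast (orbitRatio_pos (relIndex_shalika_inf_cong_ne_zero hm inf_le_left
      (inf_le_right.trans cong_le_maxCompact) isCompact_maxCompact)).ne'
  have h5 := h3.add (h4.scale (isReg_const
    (orbitRatio (min γ γ₀) w (shalika F n ⊓ cong n γ) : ℂ)))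
  rwa [sub_add_cancel] at h5

/-- The permutation `w` is harmless: the families supported on `P w U` are determined if those
supported where the rank sum is larger are. -/
def IsKilled (ψ : AddChar F Circle) (w : Equiv.Perm (Idx n)) : Prop :=
  ∃ q : Poly n, q ≠ 0 ∧ ∀ Q : Poly n, (∀ i, MvPolynomial.X i ∣ Q) → q ∣ Q →
    DeterminedAbove ψ Q w → ∀ (γ : ValueGroupWithZero F) (hγ : γ ≠ 0), γ < 1 →
      IsDetermined ψ Q (permFam w hγ)

/-- Two expressions for the translate by h are compared: it is equivalent to Ψ(h) u by equivariance
of Λ, and to χδ^{1/2}(whw⁻¹) u by the left action of P. The difference of the factors must not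
vanish identically: either the first one varies with χ, or it is a positive constant while Ψ(h) ≠ 1.
-/
lemma isKilled_of_mem_shalika (hψ : ConductorIsIntegers ψ) {h : G F n} (hh : h ∈ shalika F n)
    (hp : permG F w * h * (permG F w)⁻¹ ∈ borelSubgroup F n)
    (hne : charExponent (permG F w * h * (permG F w)⁻¹) ≠ 0 ∨
      (modulus (permG F w * h * (permG F w)⁻¹) = 1 ∧ shalikaChar ψ h ≠ 1)) :
    IsKilled ψ w := by
  obtain ⟨γ, h0, h1⟩ := exists_val_ne_zero_lt_one (F := F)
  obtain ⟨γ', h0', h1', hle, hconj⟩ := exists_conj_cong_le (n := n) h⁻¹ h0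
  set ph := permG F w * h * (permG F w)⁻¹ with hph
  set α := orbitRatio γ' w (shalika F n ⊓ cong n γ) with hα
  set α' := orbitRatio γ' w (shalika F n ⊓ (cong n γ).map (MulAut.conj h).toMonoidHom) with hα'
  have hαpos : 0 < α := orbitRatio_pos (relIndex_shalika_inf_cong_ne_zero h0' inf_le_left
      (inf_le_right.trans cong_le_maxCompact) isCompact_maxCompact)
  have hαpos' : 0 < α' := orbitRatio_pos (relIndex_shalika_inf_cong_ne_zero h0' inf_le_left
      (inf_le_right.trans (Subgroup.map_mono cong_le_maxCompact)) (isCompact_map_conj h))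
  have ha : ((Real.sqrt (modulus ph) * α' : ℝ) : ℂ) ≠ 0 := by
    exact_mod_cast (mul_pos (Real.sqrt_pos.2 (modulus_pos ph)) hαpos').ne'
  -- In the second case both orbit ratios are positive and |Ψ(h)| = 1. Equality would force the
  -- ratios to agree and then Ψ(h) = 1, so neither ratio has to be computed.
  have hab : charExponent ph ≠ 0 ∨
      ((Real.sqrt (modulus ph) * α' : ℝ) : ℂ) ≠ shalikaChar ψ h * α := by
    refine hne.imp_right fun ⟨hm, hc⟩ heq => hc ?_
    rw [hm, Real.sqrt_one, one_mul] at heq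
    have h2 := congrArg norm heq
    rw [norm_mul, norm_shalikaChar, one_mul, Complex.norm_real, Complex.norm_real,
      Real.norm_of_nonneg hαpos.le, Real.norm_of_nonneg hαpos'.le] at h2
    rw [h2] at heq
    exact (mul_eq_right₀ (by exact_mod_cast hαpos.ne')).1 heq.symm
  refine ⟨_, sub_monomial_ne_zero (charExponent ph) ha hab, fun Q hQ hqQ ih γ₁ hγ₁ hγ₁1 => ?_⟩
  refine isDetermined_permFam_of_exists hψ hQ ih h0' h1' ?_ hγ₁ hγ₁1
  have e1 := isDetermined_permFam_sub hψ hQ ih h0 h1 h0' hle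
  have e2 := isDetermined_translate_permFam_sub hψ hQ ih h0 h1 h0' h1' hh hp hconj
  have e3 := isDetermined_translate_sub (ψ := ψ) (Q := Q) (permFam w h0) hh
  obtain ⟨hr, hr0⟩ := isReg_inv_chiDelta_sub hQ (charExponent ph) _ _ rfl hqQ
  refine IsDetermined.of_scale ?_ hr hr0
  -- In this combination the vector of level γ and its translate cancel, and only a multiple of the
  -- vector of level γ' remains.
  refine (((e1.scale (isReg_const (shalikaChar ψ h))).sub e2).add e3).congr fun t _ => ?_
  refine Subtype.ext (funext fun g => ?_)
  change shalikaChar ψ h * ((permFam w h0 t).1 g - (α : ℂ) * (permFam w h0' t).1 g) -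
    ((translate h (permFam w h0) t).1 g - chiDelta (chiOf t) ph * (α' : ℂ) *
      (permFam w h0' t).1 g) + ((translate h (permFam w h0) t).1 g -
      shalikaChar ψ h * (permFam w h0 t).1 g) = (((Real.sqrt (modulus ph) * α' : ℝ) : ℂ) *
        ∏ i, (t i : ℂ) ^ charExponent ph i - shalikaChar ψ h * α) * (permFam w h0' t).1 g
  rw [chiDelta, unramChar_chiOf]
  push_cast
  ring

end Kill

/-! ### Every permutation is either obstructed or represents the open double coset. -/

section Cases

variable {F : Type*} [Field F] [ValuativeRel F] [TopologicalSpace F]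
  [IsNonarchimedeanLocalField F] {n : ℕ} {ψ : AddChar F Circle} {w : Equiv.Perm (Idx n)}

/-- The index in the opposite position. -/
def opp (i : Idx n) : Idx n := Sum.elim (fun a => Sum.inr a.rev) (fun a => Sum.inl a.rev) i

/-- Take h diagonal, with an element of positive order at inl j and inr j. Opposite places carry
inverse characters χ_i and χ_i⁻¹, so χ(whw⁻¹) is constant in χ only if w sends the two indices to
opposite places. -/
lemma isKilled_of_not_opp (hψ : ConductorIsIntegers ψ) {j : Fin n}
    (hj : w (Sum.inr j) ≠ opp (w (Sum.inl j))) : IsKilled ψ w := by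
  classical
  obtain ⟨b, hb, -⟩ := exists_ord_pos (F := F)
  let a : Idx n → Fˣ := fun i => if i = Sum.inl j ∨ i = Sum.inr j then b else 1
  have hconj := conj_permG_diagG w a
  have ha : ∀ i, ord ((a (w.symm i) : Fˣ) : F) = if i = w (Sum.inl j) ∨ i = w (Sum.inr j) then
      ord (b : F) else 0 := by
    intro i
    simp only [a, Equiv.symm_apply_eq]
    split_ifs <;> simp [ord_one]
  refine isKilled_of_mem_shalika hψ (h := diagG F n a) (diagG_mem_shalika fun l => ?_)
    (by rw [hconj]; exact diagG_mem_borelSubgroup _) (Or.inl fun h0 => hj ?_)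
  · simp [a]
  · rw [hconj] at h0
    have hne : w (Sum.inl j) ≠ w (Sum.inr j) := fun h => by simpa using w.injective h
    have key : ∀ i, (Sum.inl i = w (Sum.inl j) ∨ Sum.inl i = w (Sum.inr j)) ↔
        (Sum.inr i.rev = w (Sum.inl j) ∨ Sum.inr i.rev = w (Sum.inr j)) := by
      intro i
      have h1 := congrFun h0 i
      simp only [charExponent, diagG_apply_self, Function.comp_apply, ha, Pi.zero_apply] at h1
      split_ifs at h1 with h2 h3 h3
      · exact ⟨fun _ => h3, fun _ => h2⟩
      · omega
      · omega
      · exact ⟨fun h => (h2 h).elim, fun h => (h3 h).elim⟩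
    rcases hA : w (Sum.inl j) with i | i
    · rcases (key i).1 (Or.inl hA.symm) with h | h
      · rw [hA] at h; simp at h
      · exact h.symm
    · have h1 := (key i.rev).2 (Or.inl (by rw [Fin.rev_rev, hA]))
      rcases h1 with h | h
      · rw [hA] at h; simp at h
      · exact h.symm

/-- Take h = 1 + y E with E the matrix unit at (inl j, inr j). The assumption on positions makes
whw⁻¹ upper unipotent, while Ψ(h) = ψ(y), which is not 1 for suitable y. -/
lemma isKilled_of_pos_lt (hψ : ConductorIsIntegers ψ) {j : Fin n}
    (hj : pos (w (Sum.inl j)) < pos (w (Sum.inr j))) : IsKilled ψ w := by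
  classical
  obtain ⟨y, hy⟩ := exists_addChar_ne_one hψ
  have hval : (shalikaElt 1 (Matrix.single j j y) : G F n).val =
      1 + Matrix.single (Sum.inl j) (Sum.inr j) y := by
    rw [shalikaElt_val]
    ext (i | i) (k | k) <;> simp [Matrix.one_apply, Matrix.single_apply]
  have hconj : ∀ i k, (permG F w * shalikaElt 1 (Matrix.single j j y) * (permG F w)⁻¹).val i k =
      (1 : Matrix (Idx n) (Idx n) F) i k +
        if w (Sum.inl j) = i ∧ w (Sum.inr j) = k then y else 0 := by
    intro i k
    rw [Units.val_mul, Units.val_mul, conj_permG_apply, hval]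
    simp [Matrix.one_apply, Matrix.single_apply, Equiv.eq_symm_apply]
  have hdiag : ∀ i, (permG F w * shalikaElt 1 (Matrix.single j j y) * (permG F w)⁻¹).val i i = 1 := by
    intro i
    rw [hconj, if_neg, add_zero, Matrix.one_apply_eq]
    rintro ⟨h1, h2⟩
    exact absurd (w.injective (h1.trans h2.symm)) (by simp)
  refine isKilled_of_mem_shalika hψ (h := shalikaElt 1 (Matrix.single j j y)) (shalikaElt_mem _ _)
    (fun i k hik => ?_) (Or.inr ⟨modulus_eq_one hdiag, ?_⟩)
  · rw [hconj, Matrix.one_apply_ne (by rintro rfl; exact lt_irrefl _ hik), zero_add, if_neg]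
    rintro ⟨rfl, rfl⟩
    exact absurd hik hj.not_gt
  · rw [shalikaChar, shalikaTrace_shalikaElt, Matrix.trace_single_eq_same]
    exact fun h => hy (Circle.ext (by rw [h, Circle.coe_one]))

lemma conjNilp_xi : conjNilp (xi F n) = Matrix.fromBlocks 0 0 (w0 F n) 0 := by
  change Matrix.fromBlocks 0 1 (w0 F n) 0 * nilp F n * Matrix.fromBlocks 0 (w0 F n) 1 0 = _
  simp [nilp, Matrix.fromBlocks_multiply]

lemma pos_opp (i : Idx n) : (pos (opp i) : ℕ) = n + n - 1 - (pos i : ℕ) := by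
  rcases i with i | i <;> simp [opp, pos, Fin.val_rev] <;> omega

/-- If neither obstruction applies, w conjugates `nilp` to the same matrix (0, 0; w₀, 0) as ξ. -/
lemma exists_of_forall_opp (hopp : ∀ j, w (Sum.inr j) = opp (w (Sum.inl j)))
    (hpos : ∀ j, pos (w (Sum.inr j)) ≤ pos (w (Sum.inl j))) :
    (xi F n)⁻¹ * permG F w ∈ shalika F n := by
  have hinl : ∀ j, ∃ a : Fin n, w (Sum.inl j) = Sum.inr a.rev ∧ w (Sum.inr j) = Sum.inl a := by
    intro j
    have h1 := hopp j
    have h2 := hpos j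
    rw [h1, Fin.le_def, pos_opp] at h2
    rcases hA : w (Sum.inl j) with a | a
    · rw [hA] at h2
      simp only [pos, finSumFinEquiv_apply_left, Fin.val_castAdd] at h2
      omega
    · exact ⟨a.rev, by rw [Fin.rev_rev], by rw [h1, hA]; rfl⟩
  refine inv_mul_mem_shalika ?_
  have hx : conjNilp (permG F w) = conjNilp (xi F n) := by
    rw [conjNilp_xi]
    ext i k
    rw [conjNilp, conj_permG_apply]
    obtain ⟨i, rfl⟩ := w.surjective i
    obtain ⟨k, rfl⟩ := w.surjective k
    rw [Equiv.symm_apply_apply, Equiv.symm_apply_apply]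
    rcases i with i | i <;> rcases k with k | k <;> obtain ⟨a, ha, ha'⟩ := hinl i <;>
      obtain ⟨b, hb, hb'⟩ := hinl k <;> simp only [ha, ha', hb, hb', nilp] <;>
      simp [w0, Matrix.one_apply]
    have : i = k ↔ b = a := by
      constructor
      · rintro rfl
        rw [hb'] at ha'
        simpa using ha'
      · rintro rfl
        have := w.injective (ha'.trans hb'.symm)
        simpa using this
    simp [this]
  rw [hx, conjNilp, mul_assoc, mul_assoc, Units.inv_mul, mul_one]

/-- As w ∈ ξS, the translate of φ_B by w⁻¹ is an S-translate of the test vector, hence determined.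
It is 1 on w(S ∩ w⁻¹Bw), so it differs from a positive multiple of u by a determined family, and u
is determined without any division by a polynomial. -/
lemma isKilled_of_inv_mul_mem (hψ : ConductorIsIntegers ψ)
    (hw : (xi F n)⁻¹ * permG F w ∈ shalika F n) : IsKilled ψ w := by
  refine ⟨1, one_ne_zero, fun Q hQ _ ih γ hγ hγ1 => ?_⟩
  have hv : IsDetermined ψ Q (translate (permG F w)⁻¹ fun t => phiB (F := F) (chiOf t)) := by
    have h1 := (isDetermined_testVec (ψ := ψ) (Q := Q)).translate (inv_mem hw)
    rw [testVec, ← translate_mul] at h1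
    convert h1 using 2
    group
  let H : Subgroup (G F n) :=
    shalika F n ⊓ (iwahori F n).comap (MulAut.conj (permG F w)).toMonoidHom
  have hmemH : ∀ {s : G F n}, s ∈ H ↔ s ∈ shalika F n ∧
      permG F w * s * (permG F w)⁻¹ ∈ iwahori F n := Iff.rfl
  have hHK : H ≤ maxCompact F n := fun s hs => by
    have h1 := mul_mem (mul_mem (inv_mem (permG_mem_maxCompact w))
      (iwahori_le_maxCompact (hmemH.1 hs).2)) (permG_mem_maxCompact w)
    have h2 : (permG F w)⁻¹ * (permG F w * s * (permG F w)⁻¹) * permG F w = s := by group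
    rwa [h2] at h1
  have hfin := relIndex_shalika_inf_cong_ne_zero hγ (H := H) inf_le_left hHK isCompact_maxCompact
  have h1 := isDetermined_sub_scale_permFam (w := w) (c := fun _ => 1) hγ hγ1 (H := H) inf_le_left
    (fun s hs => ⟨hs.1, cong_le_iwahori hγ1 (conj_mem_cong (permG_mem_maxCompact w) hs.2)⟩)
    hfin hQ ih ((isRegFam_phiB hQ).translate (permG F w)⁻¹)
    (fun t g hne => ?_) (fun τ hτ => shalikaChar_eq_one hψ (hHK hτ)) (fun t τ hτ => ?_)
  · have h2 := hv.sub h1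
    rw [sub_sub_cancel] at h2
    refine h2.of_scale (isReg_const _) fun _ _ => ?_
    rw [one_mul]
    exact_mod_cast (orbitRatio_pos hfin).ne'
  · have h2 : ∃ p ∈ borelSubgroup F n, p⁻¹ * (g * (permG F w)⁻¹) ∈ iwahori F n := by
      by_contra hcon
      exact hne (phiBFun_eq_zero _ hcon)
    obtain ⟨p, hp, hb⟩ := h2
    obtain ⟨γ', hγ', p', hp', hpk', c, hc, heq⟩ := exists_of_mem_iwahori hb
    have hg : g = (p * p') * permG F w * ((permG F w)⁻¹ * c * permG F w) := by
      have : g = p * (p⁻¹ * (g * (permG F w)⁻¹)) * permG F w := by group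
      rw [this, heq]
      group
    have hcw : (permG F w)⁻¹ * c * permG F w ∈ cong n γ' :=
      conj_mem_cong' (permG_mem_maxCompact w) hc
    have h3 := rankSum_permG_le_of_mem hγ' w (mul_mem hp hp') hcw
    rw [← hg] at h3
    rcases h3.lt_or_eq with h4 | h4
    · exact Or.inl h4
    · rw [hg] at h4
      obtain ⟨p₁, hp₁, hpk₁, s, hs, -, heq'⟩ :=
        exists_shalika_of_rankSum_eq hγ' (mul_mem hp hp') hcw h4.symm
      rw [← hg] at heq'
      refine Or.inr ⟨p * p' * p₁, mul_mem (mul_mem hp hp') hp₁, s, ⟨hs, ?_⟩, heq'⟩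
      have h5 : permG F w * s * (permG F w)⁻¹ = (p' * p₁)⁻¹ * (p⁻¹ * (g * (permG F w)⁻¹)) := by
        rw [heq']; group
      change permG F w * s * (permG F w)⁻¹ ∈ iwahori F n
      rw [h5]
      exact mul_mem (inv_mem (borel_inf_maxCompact_le_iwahori (mul_mem hp' hp₁)
        (mul_mem hpk' hpk₁))) hb
  · have h2 : phiBFun (chiOf t) (permG F w * τ * (permG F w)⁻¹) = chiDelta (chiOf t) 1 :=
      phiBFun_eq _ (one_mem _) (by rw [inv_one, one_mul]; exact (hmemH.1 hτ).2)
    rw [chiDelta_one] at h2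
    exact h2

theorem isKilled (hψ : ConductorIsIntegers ψ) (w : Equiv.Perm (Idx n)) : IsKilled ψ w := by
  by_cases h1 : ∃ j, w (Sum.inr j) ≠ opp (w (Sum.inl j))
  · exact isKilled_of_not_opp hψ h1.choose_spec
  by_cases h2 : ∃ j, pos (w (Sum.inl j)) < pos (w (Sum.inr j))
  · exact isKilled_of_pos_lt hψ h2.choose_spec
  push Not at h1 h2
  exact isKilled_of_inv_mul_mem hψ (exists_of_forall_opp h1 h2)

end Cases

/-! ### Downward induction over the strata. -/

section Induction

variable {F : Type*} [Field F] [ValuativeRel F] [TopologicalSpace F]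
  [IsNonarchimedeanLocalField F] {n : ℕ} {γ γ' : ValueGroupWithZero F}
  {ψ : AddChar F Circle} {Q : Poly n} {v v' : Fam F n}

lemma exists_rankSum_le : ∃ B, ∀ g : G F n, rankSum g ≤ B :=
  ⟨_, fun _ => Finset.sum_le_sum fun _ _ => (Submodule.finrank_le _)⟩

open Classical in
/-- The restriction of a vector to a subset of `G` that is a union of double cosets of the Borel
subgroup and a congruence subgroup. -/
def restrictI {χ : Idx n → ℂˣ} {A : Set (G F n)} (hγ : γ ≠ 0)
    (hA : ∀ g, ∀ c ∈ cong n γ, (g * c ∈ A ↔ g ∈ A))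
    (hP : ∀ p ∈ borelSubgroup F n, ∀ g, (p * g ∈ A ↔ g ∈ A)) (v : I F χ) : I F χ :=
  ⟨fun g => (if g ∈ A then 1 else 0) * v.1 g,
    (isLocallyConstant_of_cong hγ fun g c hc => by simp only [hA g c hc]).mul v.2.1,
    fun p hp g => by simp only [hP p hp, v.2.2 p hp]; ring⟩

lemma isRegFam_restrictI {A : Set (G F n)} (hγ : γ ≠ 0)
    (hA : ∀ g, ∀ c ∈ cong n γ, (g * c ∈ A ↔ g ∈ A))
    (hP : ∀ p ∈ borelSubgroup F n, ∀ g, (p * g ∈ A ↔ g ∈ A)) (hv : IsRegFam Q v) :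
    IsRegFam Q fun t => restrictI hγ hA hP (v t) := by
  obtain ⟨⟨γ', h0', h'⟩, hr⟩ := hv
  refine ⟨⟨min γ γ', ?_, fun t g c hc => ?_⟩, fun g => (isReg_const _).mul (hr g)⟩
  · rcases min_choice γ γ' with h | h <;> rw [h] <;> assumption
  · classical
    change (if g * c ∈ A then 1 else 0) * (v t).1 (g * c) = (if g ∈ A then 1 else 0) * (v t).1 g
    rw [h' t g c (cong_mono (min_le_right _ _) hc)]
    simp only [hA g c (cong_mono (min_le_left _ _) hc)]

/-- The set `P w U σ`. -/
def cell (w : Equiv.Perm (Idx n)) (γ : ValueGroupWithZero F) (σ : G F n) : Set (G F n) :=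
  {g | ∃ p ∈ borelSubgroup F n, ∃ c ∈ cong n γ, g = p * permG F w * c * σ}

lemma cell_borel_mul {w : Equiv.Perm (Idx n)} {σ p : G F n} (hp : p ∈ borelSubgroup F n) (g : G F n) :
    p * g ∈ cell w γ σ ↔ g ∈ cell w γ σ := by
  constructor
  · rintro ⟨p', hp', c, hc, h⟩
    exact ⟨p⁻¹ * p', mul_mem (inv_mem hp) hp', c, hc, by
      rw [mul_assoc, mul_assoc, mul_assoc, eq_inv_mul_iff_mul_eq, h]; group⟩
  · rintro ⟨p', hp', c, hc, rfl⟩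
    exact ⟨p * p', mul_mem hp hp', c, hc, by group⟩

lemma cell_mul {w : Equiv.Perm (Idx n)} {σ c : G F n} (hc : σ * c * σ⁻¹ ∈ cong n γ) (g : G F n) :
    g * c ∈ cell w γ σ ↔ g ∈ cell w γ σ := by
  constructor
  · rintro ⟨p', hp', c', hc', h⟩
    refine ⟨p', hp', c' * (σ * c * σ⁻¹)⁻¹, mul_mem hc' (inv_mem hc), ?_⟩
    rw [eq_mul_inv_of_mul_eq h]
    group
  · rintro ⟨p', hp', c', hc', rfl⟩
    exact ⟨p', hp', c' * (σ * c * σ⁻¹), mul_mem hc' hc, by group⟩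

/-- Translation by σ ∈ S moves the support into PwU. There v is a combination of S-translates of u
modulo higher strata. -/
lemma isDetermined_of_cell (hQ : ∀ i, MvPolynomial.X i ∣ Q)
    {w : Equiv.Perm (Idx n)} (ih : DeterminedAbove ψ Q w)
    (hu : ∀ (γ : ValueGroupWithZero F) (hγ : γ ≠ 0), γ < 1 → IsDetermined ψ Q (permFam w hγ))
    {σ : G F n} (hσ : σ ∈ shalika F n) (hγ : γ ≠ 0) (hγ1 : γ < 1) (hv : IsRegFam Q v)
    (hsupp : ∀ t g, (v t).1 g ≠ 0 → g ∈ cell w γ σ) : IsDetermined ψ Q v := by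
  suffices h : IsDetermined ψ Q (translate σ v) by
    have h1 := h.translate (inv_mem hσ)
    rwa [← translate_mul, inv_mul_cancel, translate_one] at h1
  have hv' := hv.translate σ
  obtain ⟨γ₁, h0, h1⟩ := hv'.exists_cong
  have hm : min γ γ₁ ≠ 0 := by rcases min_choice γ γ₁ with h | h <;> rw [h] <;> assumption
  refine isDetermined_of_permFam (w := w) hm ((min_le_left _ _).trans_lt hγ1)
    (H := shalika F n ⊓ cong n γ) inf_le_left (inf_le_inf_left _ (cong_mono (min_le_left _ _)))
    (relIndex_shalika_inf_cong_ne_zero hm inf_le_left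
      (inf_le_right.trans cong_le_maxCompact) isCompact_maxCompact) hQ ih hv' (fun t g hne => ?_)
    (fun t s hs τ hτ => ?_) (hu _ hm ((min_le_left _ _).trans_lt hγ1))
  · obtain ⟨p, hp, c, hc, heq⟩ := hsupp t (g * σ) hne
    have hg : g = p * permG F w * c := mul_right_cancel heq
    have h2 := rankSum_permG_le_of_mem hγ1 w hp hc
    rcases h2.lt_or_eq with h3 | h3
    · rw [← hg] at h3; exact Or.inl h3
    · obtain ⟨p', hp', -, s, hs, hsγ, heq'⟩ := exists_shalika_of_rankSum_eq hγ1 hp hc h3.symm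
      exact Or.inr ⟨p * p', mul_mem hp hp', s, ⟨hs, hsγ⟩, hg.trans heq'⟩
  · have h2 := conj_mem_cong' hτ.2.1 (cong_mono (min_le_right γ γ₁) hs.2)
    have h3 := h1 t (permG F w * τ) _ h2
    rw [← h3]
    group

/-- The family is cut by the indicator functions of the sets A i, one at a time. The set Z records
that no piece is supported outside the support of the original family. -/
lemma isDetermined_of_finite_cover {Z : Set (G F n)} {ι : Type*} (T : Finset ι)
    (A : ι → Set (G F n))
    (hA : ∀ i ∈ T, ∃ γ : ValueGroupWithZero F, γ ≠ 0 ∧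
      ∀ g, ∀ c ∈ cong n γ, (g * c ∈ A i ↔ g ∈ A i))
    (hP : ∀ i ∈ T, ∀ p ∈ borelSubgroup F n, ∀ g, (p * g ∈ A i ↔ g ∈ A i))
    (hdet : ∀ i ∈ T, ∀ v : Fam F n, IsRegFam Q v → (∀ t g, (v t).1 g ≠ 0 → g ∈ A i ∧ g ∈ Z) →
      IsDetermined ψ Q v) (v : Fam F n) (hv : IsRegFam Q v)
    (hsupp : ∀ t g, (v t).1 g ≠ 0 → (∃ i ∈ T, g ∈ A i) ∧ g ∈ Z) : IsDetermined ψ Q v := by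
  classical
  induction T using Finset.induction_on generalizing v with
  | empty =>
    have : v = 0 := by
      funext t
      refine Subtype.ext (funext fun g => ?_)
      by_contra h
      simpa using (hsupp t g h).1
    rw [this]
    exact IsDetermined.zero
  | insert i T hi ih =>
    obtain ⟨γ, hγ, hAi⟩ := hA i (Finset.mem_insert_self _ _)
    have hPi := hP i (Finset.mem_insert_self _ _)
    let u : Fam F n := fun t => restrictI hγ hAi hPi (v t)
    have hu : IsRegFam Q u := isRegFam_restrictI hγ hAi hPi hv
    have huval : ∀ t g, (u t).1 g = (if g ∈ A i then 1 else 0) * (v t).1 g := fun t g => by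
      simp only [u, restrictI]
    have h1 : IsDetermined ψ Q u := by
      refine hdet i (Finset.mem_insert_self _ _) u hu fun t g hne => ?_
      rw [huval] at hne
      refine ⟨?_, (hsupp t g (right_ne_zero_of_mul hne)).2⟩
      by_contra h
      simp [h] at hne
    have h2 : IsDetermined ψ Q (v - u) := by
      refine ih (fun j hj => hA j (Finset.mem_insert_of_mem hj))
        (fun j hj => hP j (Finset.mem_insert_of_mem hj))
        (fun j hj => hdet j (Finset.mem_insert_of_mem hj)) _ (hv.sub hu) fun t g hne => ?_
      have hval : ((v - u) t).1 g = (v t).1 g - (if g ∈ A i then 1 else 0) * (v t).1 g := by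
        rw [← huval]; rfl
      rw [hval] at hne
      by_cases hg : g ∈ A i
      · simp [hg] at hne
      · simp only [hg, if_false, zero_mul, sub_zero] at hne
        obtain ⟨⟨j, hj, hgj⟩, hZ⟩ := hsupp t g hne
        rcases Finset.mem_insert.1 hj with rfl | hj
        · exact absurd hgj hg
        · exact ⟨⟨j, hj, hgj⟩, hZ⟩
    have h3 := h1.add h2
    rwa [add_sub_cancel] at h3

/-- All regular families are determined. -/
theorem isDetermined_of_isRegFam (hQ : ∀ i, MvPolynomial.X i ∣ Q)
    (hkill : ∀ w : Equiv.Perm (Idx n), DeterminedAbove ψ Q w →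
      ∀ (γ : ValueGroupWithZero F) (hγ : γ ≠ 0), γ < 1 → IsDetermined ψ Q (permFam w hγ))
    (hv : IsRegFam Q v) : IsDetermined ψ Q v := by
  classical
  obtain ⟨B, hB⟩ := exists_rankSum_le (F := F) (n := n)
  -- The rank sums are bounded by B, so the lower bound c on the support can be raised finitely
  -- often; d counts the remaining steps.
  suffices h : ∀ d c, B < c + d → ∀ v : Fam F n, IsRegFam Q v →
      (∀ t g, (v t).1 g ≠ 0 → c ≤ rankSum g) → IsDetermined ψ Q v from
    h (B + 1) 0 (by omega) v hv fun _ _ _ => zero_le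
  intro d
  induction d with
  | zero =>
    intro c hc v _ hsupp
    have : v = 0 := by
      funext t
      refine Subtype.ext (funext fun g => ?_)
      by_contra h
      have := hsupp t g h
      have := hB g
      omega
    rw [this]
    exact IsDetermined.zero
  | succ d ih =>
    intro c hc v hv hsupp
    obtain ⟨γ₀, h0, hinv⟩ := hv.exists_cong
    -- The cell around k is taken so small that, if the whole family vanishes at k, it vanishes on
    -- the cell. Hence only cells with representative w of rank sum at least c matter.
    have hloc : ∀ k : G F n, ∃ (w : Equiv.Perm (Idx n)) (γ : ValueGroupWithZero F) (σ : G F n),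
        γ ≠ 0 ∧ γ < 1 ∧ σ ∈ shalika F n ∧ k ∈ cell w γ σ ∧
        ((∃ t, (v t).1 k ≠ 0) → c ≤ rankSum (permG F w)) ∧
        ((∀ t, (v t).1 k = 0) → ∀ t, ∀ g ∈ cell w γ σ, (v t).1 g = 0) := by
      intro k
      obtain ⟨p, hp, w, σ, hσ, rfl⟩ := exists_borel_mul_perm_mul_shalika k
      obtain ⟨γ, hγ, hγ1, -, hc⟩ := exists_conj_cong_le σ⁻¹ h0
      refine ⟨w, γ, σ, hγ, hγ1, hσ, ⟨p, hp, 1, one_mem _, by group⟩, ?_, ?_⟩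
      · rintro ⟨t, ht⟩
        have := hsupp t _ ht
        rwa [rankSum_mul_shalika _ hσ, rankSum_borel_mul hp] at this
      · rintro h t _ ⟨p', hp', c', hc', rfl⟩
        have h1 := hinv t (p * permG F w * σ) _ (hc c' hc')
        have h2 : p' * permG F w * c' * σ =
            (p' * p⁻¹) * (p * permG F w * σ * (σ⁻¹ * c' * σ⁻¹⁻¹)) := by group
        rw [h2, (v t).2.2 _ (mul_mem hp' (inv_mem hp)), h1, h t, mul_zero]
    choose w γ σ hγ hγ1 hσ hmem hrank hzero using hloc
    have hright : ∀ k, ∃ γ' : ValueGroupWithZero F, γ' ≠ 0 ∧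
        ∀ g, ∀ c ∈ cong n γ', (g * c ∈ cell (w k) (γ k) (σ k) ↔ g ∈ cell (w k) (γ k) (σ k)) := by
      intro k
      obtain ⟨γ', h0', -, -, h'⟩ := exists_conj_cong_le (σ k) (hγ k)
      exact ⟨γ', h0', fun g c hc => cell_mul (h' c hc) g⟩
    have hopen : ∀ k, IsOpen (cell (w k) (γ k) (σ k)) := by
      intro k
      obtain ⟨γ', h0', h'⟩ := hright k
      have h1 := (isLocallyConstant_of_cong (α := Prop) (f := (· ∈ cell (w k) (γ k) (σ k))) h0'
        fun g c hc => propext (h' g c hc)).isOpen_fiber True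
      convert h1 using 1
      ext g
      simp
    obtain ⟨T, -, hT⟩ := isCompact_maxCompact (F := F) (n := n).elim_nhds_subcover
      (fun k => cell (w k) (γ k) (σ k)) fun k _ => (hopen k).mem_nhds (hmem k)
    refine isDetermined_of_finite_cover (Z := {g | ∃ t, (v t).1 g ≠ 0}) T
      (fun k => cell (w k) (γ k) (σ k)) (fun k _ => hright k)
      (fun k _ p hp g => cell_borel_mul hp g) (fun k _ u hu hsu => ?_) v hv fun t g hne => ?_
    · by_cases hk : ∃ t, (v t).1 k ≠ 0
      -- A rank sum above that of w k is at least c + 1, which is the induction hypothesis.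
      · have ihk : DeterminedAbove ψ Q (w k) := fun u' hu' hsu' =>
          ih (c + 1) (by omega) u' hu' fun t g hne => by
            have := hsu' t g hne
            have := hrank k hk
            omega
        exact isDetermined_of_cell hQ ihk (hkill _ ihk) (hσ k) (hγ k) (hγ1 k) hu
          fun t g hne => (hsu t g hne).1
      · push Not at hk
        have : u = 0 := by
          funext t
          refine Subtype.ext (funext fun g => ?_)
          by_contra h
          obtain ⟨h1, t', h2⟩ := hsu t g h
          exact h2 (hzero k hk t' g h1)
        rw [this]
        exact IsDetermined.zero
    · refine ⟨?_, t, hne⟩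
      obtain ⟨p, hp, k, hk, rfl⟩ := exists_iwasawa g
      obtain ⟨i, hi, hki⟩ := Set.mem_iUnion₂.1 (hT hk)
      exact ⟨i, hi, (cell_borel_mul hp k).2 hki⟩

/-- There is a polynomial outside the zero set of which all regular families are determined. -/
theorem exists_isDetermined (hψ : ConductorIsIntegers ψ) : ∃ Q : Poly n, Q ≠ 0 ∧
    (∀ i, MvPolynomial.X i ∣ Q) ∧ ∀ v : Fam F n, IsRegFam Q v → IsDetermined ψ Q v := by
  choose q hq0 hq using fun w : Equiv.Perm (Idx n) => isKilled hψ w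
  have hX : ∀ i, (MvPolynomial.X i : Poly n) ∣ (∏ i, MvPolynomial.X i) * ∏ w, q w := fun i =>
    (Finset.dvd_prod_of_mem _ (Finset.mem_univ i)).mul_right _
  refine ⟨(∏ i, MvPolynomial.X i) * ∏ w, q w, mul_ne_zero
    (Finset.prod_ne_zero_iff.2 fun i _ => MvPolynomial.X_ne_zero i)
    (Finset.prod_ne_zero_iff.2 fun w _ => hq0 w), hX, fun v hv =>
    isDetermined_of_isRegFam hX (fun w ih => hq w _ hX
      ((Finset.dvd_prod_of_mem _ (Finset.mem_univ w)).mul_left _) ih) hv⟩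

end Induction

/-! ### Countability, closedness of the Borel subgroup, and contraction to the diagonal. -/

section Topology

variable {F : Type*} [Field F] [ValuativeRel F] [TopologicalSpace F]
  [IsNonarchimedeanLocalField F] {n : ℕ}

lemma ord_pow {a : F} (ha : a ≠ 0) (m : ℕ) : ord (a ^ m) = m * ord a := by
  induction m with
  | zero => simp [ord_one]
  | succ m ih => rw [pow_succ, ord_mul (pow_ne_zero _ ha) ha, ih]; push_cast; ring

lemma ord_inv {a : F} (ha : a ≠ 0) : ord a⁻¹ = -ord a := by
  have h := ord_mul ha (inv_ne_zero ha)
  rw [mul_inv_cancel₀ ha, ord_one] at h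
  omega

lemma exists_pow_val_le {a : F} (ha : a ≠ 0) (h : 0 < ord a) {b : F} (hb : b ≠ 0) :
    ∃ m : ℕ, valuation F (a ^ m) ≤ valuation F b := by
  refine ⟨(ord b).toNat, (log_val_le_log_val hb (pow_ne_zero _ ha)).1 ?_⟩
  rw [ord_pow ha]
  have := Int.self_le_toNat (ord b)
  nlinarith

/-- Powers of an element of positive order give a countable basis at 0 and an exhaustion by compact
balls. Second countability is needed for products of Borel measures. -/
instance : SecondCountableTopology F := by
  obtain ⟨a, ha, -⟩ := exists_ord_pos (F := F)
  let := IsTopologicalAddGroup.rightUniformSpace F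
  have := isUniformAddGroup_of_addCommGroup (G := F)
  have hcg : (nhds (0 : F)).IsCountablyGenerated := by
    have hb : (nhds (0 : F)).HasBasis (fun _ : ℕ => True)
        fun m => {x | valuation F x ≤ valuation F ((a : F) ^ m)} := by
      refine ⟨fun U => ⟨fun hU => ?_, fun ⟨m, _, hm⟩ => ?_⟩⟩
      · obtain ⟨γ, hγ⟩ := (IsValuativeTopology.mem_nhds_zero_iff U).1 hU
        obtain ⟨b, hb⟩ := valuation_surjective (γ : ValueGroupWithZero F)
        have hb0 : b ≠ 0 := by
          rintro rfl
          rw [map_zero] at hb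
          exact γ.ne_zero hb.symm
        obtain ⟨m, hm⟩ := exists_pow_val_le a.ne_zero ha (mul_ne_zero hb0 a.ne_zero)
        refine ⟨m, trivial, fun x hx => hγ ?_⟩
        have h1 : valuation F (a : F) < 1 := by
          by_contra h
          rw [not_lt, ← map_one (valuation F), ← log_val_le_log_val a.ne_zero one_ne_zero,
            ord_one] at h
          omega
        have h2 : valuation F x ≤ γ * valuation F (a : F) := by
          rw [← hb, ← map_mul]
          exact le_trans hx hm
        exact h2.trans_lt (mul_lt_of_lt_one_right (zero_lt_iff.2 γ.ne_zero) h1)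
      · refine Filter.mem_of_superset ((IsValuativeTopology.mem_nhds_zero_iff _).2
          ⟨Units.mk0 (valuation F ((a : F) ^ m)) (by simp), subset_rfl⟩) fun x hx => hm ?_
        rw [Set.mem_ofPred_eq] at hx ⊢
        exact hx.le
    exact hb.isCountablyGenerated
  have : (uniformity F).IsCountablyGenerated := by
    rw [uniformity_eq_comap_nhds_zero]
    infer_instance
  have : SigmaCompactSpace F := by
    refine ⟨⟨fun m : ℕ => {x | valuation F x ≤ valuation F (((a : F) ^ m)⁻¹)}, fun m =>
      IsNonarchimedeanLocalField.isCompact_closedBall F _, ?_⟩⟩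
    refine Set.eq_univ_of_forall fun x => Set.mem_iUnion.2 ?_
    by_cases hx : x = 0
    · exact ⟨0, by simp [hx]⟩
    · obtain ⟨m, hm⟩ := exists_pow_val_le a.ne_zero ha (inv_ne_zero hx)
      refine ⟨m, ?_⟩
      rw [← log_val_le_log_val (inv_ne_zero hx) (pow_ne_zero _ a.ne_zero)] at hm
      rw [Set.mem_ofPred_eq, ← log_val_le_log_val (inv_ne_zero (pow_ne_zero _ a.ne_zero)) hx,
        ord_inv (pow_ne_zero _ a.ne_zero)]
      rw [ord_inv hx] at hm
      omega
  let := UniformSpace.pseudoMetricSpace F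
  infer_instance

instance : SecondCountableTopology (G F n) := by
  have : SecondCountableTopology (Matrix (Idx n) (Idx n) F) :=
    inferInstanceAs (SecondCountableTopology (Idx n → Idx n → F))
  have : SecondCountableTopology (Matrix (Idx n) (Idx n) F)ᵐᵒᵖ :=
    MulOpposite.opHomeomorph.symm.isEmbedding.secondCountableTopology
  exact (Units.isEmbedding_embedProduct (M := Matrix (Idx n) (Idx n) F)).secondCountableTopology

instance : LocallyCompactSpace (G F n) :=
  isCompact_maxCompact.locallyCompactSpace_of_mem_nhds_of_group
    (isOpen_maxCompact.mem_nhds (one_mem _))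

lemma isClosed_borelSubgroup : IsClosed (borelSubgroup F n : Set (G F n)) := by
  have : (borelSubgroup F n : Set (G F n)) = ⋂ i, ⋂ j, {g : G F n | pos j < pos i → g.val i j = 0} := by
    ext g
    simp only [Set.mem_iInter, Set.mem_ofPred_eq]
    exact ⟨fun h i j hij => h hij, fun h i j hij => h i j hij⟩
  rw [this]
  refine isClosed_iInter fun i => isClosed_iInter fun j => ?_
  by_cases h : pos j < pos i
  · simp only [h, forall_const]
    exact isClosed_eq (Units.continuous_val.matrix_elem i j) continuous_const
  · simp [h]

instance : LocallyCompactSpace (borelSubgroup F n) :=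
  isClosed_borelSubgroup.isClosedEmbedding_subtypeVal.locallyCompactSpace

/-- The diagonal matrix with the diagonal entries of `p`. -/
def borelDiag {p : G F n} (hp : p ∈ borelSubgroup F n) : Idx n → Fˣ := fun i =>
  ⟨p.val i i, (p⁻¹).val i i, borel_diag_mul_inv hp i, by rw [mul_comm]; exact borel_diag_mul_inv hp i⟩

/-- Every element of the Borel subgroup is conjugate, by a diagonal matrix, to the product of its
diagonal and of an integral matrix. -/
lemma exists_conj_diagG {p : G F n} (hp : p ∈ borelSubgroup F n) :
    ∃ a : Idx n → Fˣ, ∃ k ∈ borelSubgroup F n, k ∈ maxCompact F n ∧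
      diagG F n a * p * (diagG F n a)⁻¹ = diagG F n (borelDiag hp) * k := by
  obtain ⟨b, hb, hb1⟩ := exists_ord_pos (F := F)
  have hne : ∀ i, p.val i i ≠ 0 := fun i => (borelDiag hp i).ne_zero
  have hloc : ∀ i j, ∃ N : ℕ, valuation F ((b : F) ^ N * (p.val i j * (p.val i i)⁻¹)) ≤
      valuation F (b : F) := by
    intro i j
    by_cases h : p.val i j = 0
    · exact ⟨0, by simp [h]⟩
    · obtain ⟨N, hN⟩ := exists_pow_val_le b.ne_zero hb
        (mul_ne_zero b.ne_zero (inv_ne_zero (mul_ne_zero h (inv_ne_zero (hne i)))))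
      refine ⟨N, ?_⟩
      rw [map_mul]
      refine (mul_le_mul_left hN _).trans (le_of_eq ?_)
      rw [← map_mul, mul_assoc, inv_mul_cancel₀ (mul_ne_zero h (inv_ne_zero (hne i))), mul_one]
  choose N hN using hloc
  let M : ℕ := Finset.univ.sup fun x : Idx n × Idx n => N x.1 x.2
  have hM : ∀ i j (e : ℕ), M ≤ e → valuation F ((b : F) ^ e * (p.val i j * (p.val i i)⁻¹)) ≤
      valuation F (b : F) := by
    intro i j e he
    have h1 : N i j ≤ e := (Finset.le_sup (f := fun x : Idx n × Idx n => N x.1 x.2)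
      (Finset.mem_univ (i, j))).trans he
    obtain ⟨d, rfl⟩ := Nat.exists_eq_add_of_le h1
    rw [pow_add, mul_comm ((b : F) ^ N i j), mul_assoc, map_mul]
    refine (mul_le_mul' ?_ (hN i j)).trans_eq (one_mul _)
    rw [map_pow]
    exact pow_le_one' hb1.le d
  -- Conjugation by this diagonal matrix multiplies the entry at (i, j) by b to the power M (pos j -
  -- pos i), which makes everything above the diagonal small.
  let a : Idx n → Fˣ := fun i => (b ^ (M * (pos i : ℕ)))⁻¹
  let g : G F n := (diagG F n (borelDiag hp))⁻¹ * (diagG F n a * p * (diagG F n a)⁻¹)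
  have hg : ∀ i j, g.val i j = (p.val i i)⁻¹ * ((a i : F) * p.val i j * (a j : F)⁻¹) := by
    intro i j
    rw [show g = diagG F n (borelDiag hp)⁻¹ * (diagG F n a * p * diagG F n a⁻¹) by
      rw [map_inv, map_inv]]
    simp only [Units.val_mul, diagG_val, Matrix.diagonal_mul, Matrix.mul_diagonal, Pi.inv_apply,
      Units.val_inv_eq_inv_val]
    rfl
  have hgb : g ∈ borelSubgroup F n := mul_mem (inv_mem (diagG_mem_borelSubgroup _))
    (mul_mem (mul_mem (diagG_mem_borelSubgroup _) hp) (inv_mem (diagG_mem_borelSubgroup _)))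
  have hsub : MatLE (valuation F (b : F)) (g.val - 1) := by
    intro i j
    rw [Matrix.sub_apply]
    rcases lt_trichotomy (pos i) (pos j) with hij | hij | hij
    · rw [Matrix.one_apply_ne (by rintro rfl; exact lt_irrefl _ hij), sub_zero, hg]
      have h1 : (a i : F) * p.val i j * (a j : F)⁻¹ =
          (b : F) ^ (M * ((pos j : ℕ) - (pos i : ℕ))) * p.val i j := by
        have h2 : (b : F) ^ (M * (pos j : ℕ)) =
            (b : F) ^ (M * ((pos j : ℕ) - (pos i : ℕ))) * (b : F) ^ (M * (pos i : ℕ)) := by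
          rw [← pow_add, ← mul_add, Nat.sub_add_cancel (le_of_lt hij)]
        simp only [a, Units.val_inv_eq_inv_val, Units.val_pow_eq_pow_val, inv_inv, h2]
        field_simp
      have h3 := hM i j (M * ((pos j : ℕ) - (pos i : ℕ)))
        (Nat.le_mul_of_pos_right _ (Nat.sub_pos_of_lt hij))
      rw [h1]
      convert h3 using 2
      ring
    · obtain rfl := pos_injective hij
      rw [Matrix.one_apply_eq, hg, mul_comm ((a i : F) * p.val i i), ← mul_assoc (a i : F)⁻¹,
        inv_mul_cancel₀ (a i).ne_zero, one_mul, inv_mul_cancel₀ (hne i), sub_self, map_zero]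
      exact zero_le
    · rw [hgb hij, Matrix.one_apply_ne (by rintro rfl; exact lt_irrefl _ hij), sub_zero, map_zero]
      exact zero_le
  obtain ⟨k, hk, hkg⟩ := exists_cong_of_sub_one hb1 hsub
  obtain rfl : k = g := Units.ext hkg
  exact ⟨a, g, hgb, hk.1, by simp only [g, mul_inv_cancel_left]⟩

end Topology

open MeasureTheory

/-! ### Haar measure, indices and the modular character. -/

section Modular

open Measure

variable {H : Type*} [Group H] [TopologicalSpace H] [IsTopologicalGroup H] [LocallyCompactSpace H]
  [SecondCountableTopology H] [MeasurableSpace H] [BorelSpace H] (μ : Measure H) [μ.IsHaarMeasure]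

lemma measure_preimage_mul_right (g : H) {A : Set H} (hA : MeasurableSet A) :
    μ ((· * g) ⁻¹' A) = modularCharacter g * μ A := by
  have h := congrArg (fun ν : Measure H => ν A) (map_right_mul_eq_modularCharacterFun_smul μ g)
  rw [map_apply (measurable_mul_const g) hA] at h
  exact h

lemma modularCharacter_eq_one_of_forall {g : H} {A : Set H} (hA : IsOpen A) (hne : A.Nonempty)
    (hc : IsCompact A) (h : haar ((· * g) ⁻¹' A) = (haar : Measure H) A) :
    modularCharacter g = 1 := by
  have h1 := measure_preimage_mul_right (haar : Measure H) g hA.measurableSet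
  rw [h] at h1
  have h2 : (haar : Measure H) A ≠ 0 := (hA.measure_pos _ hne).ne'
  have h4 : (modularCharacter g : ENNReal) = 1 := by
    have := ENNReal.mul_left_inj h2 hc.measure_lt_top.ne (a := (modularCharacter g : ENNReal)) (b := 1)
    exact this.1 (by rw [one_mul, ← h1])
  exact_mod_cast h4

lemma relIndex_mul_measure {C C' : Subgroup H} (hle : C' ≤ C) (hC : MeasurableSet (C : Set H))
    (hC' : MeasurableSet (C' : Set H)) (hfin : C'.relIndex C ≠ 0) :
    C'.relIndex C * μ C' = μ C := by
  have : (C'.subgroupOf C).FiniteIndex := ⟨hfin⟩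
  have hemb : MeasurableEmbedding (C.subtype : C → H) := MeasurableEmbedding.subtype_coe hC
  have : (μ.comap C.subtype).IsMulLeftInvariant := IsMulLeftInvariant.comap μ hemb
  have h := Subgroup.index_mul_measure (C'.subgroupOf C) (hC'.preimage measurable_subtype_coe)
    (μ.comap C.subtype)
  rw [hemb.comap_apply, hemb.comap_apply] at h
  have h1 : C.subtype '' (C'.subgroupOf C : Set C) = C' := by
    ext x
    constructor
    · rintro ⟨y, hy, rfl⟩; exact hy
    · intro hx; exact ⟨⟨x, hle hx⟩, hx, rfl⟩
  rw [h1] at h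
  have h2 : C.subtype '' Set.univ = C := by simp
  rw [h2] at h
  exact h

end Modular

/-! ### Values of the modular character from compact open subgroups. -/

section Modular

open Measure

variable {H : Type*} [Group H] [TopologicalSpace H] [IsTopologicalGroup H] [LocallyCompactSpace H]
  [SecondCountableTopology H]

lemma modularCharacter_eq_one_of_mem {C : Subgroup H} (hC : IsOpen (C : Set H))
    (hc : IsCompact (C : Set H)) {g : H} (hg : g ∈ C) : modularCharacter g = 1 := by
  borelize H
  refine modularCharacter_eq_one_of_forall hC ⟨1, one_mem _⟩ hc ?_
  congr 1
  ext x
  exact C.mul_mem_cancel_right hg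

lemma modularCharacter_eq_one_of_center {C : Subgroup H} (hC : IsOpen (C : Set H))
    (hc : IsCompact (C : Set H)) {g : H} (hg : ∀ x, x * g = g * x) : modularCharacter g = 1 := by
  borelize H
  refine modularCharacter_eq_one_of_forall hC ⟨1, one_mem _⟩ hc ?_
  simp only [hg]
  exact measure_preimage_mul _ _ _

/-- The conjugate hCh⁻¹ has the measure Δ(h) μ(C), and finitely many of its translates, as many as
the index, tile C. -/
lemma modularCharacter_mul_relIndex {C : Subgroup H} (hC : IsOpen (C : Set H))
    (hc : IsCompact (C : Set H)) {h : H} (hle : C.map (MulAut.conj h).toMonoidHom ≤ C)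
    (hfin : (C.map (MulAut.conj h).toMonoidHom).relIndex C ≠ 0) :
    modularCharacter h * ((C.map (MulAut.conj h).toMonoidHom).relIndex C : NNReal) = 1 := by
  borelize H
  let μ : Measure H := haar
  have hset : (C.map (MulAut.conj h).toMonoidHom : Set H) =
      (· * h) ⁻¹' ((h⁻¹ * ·) ⁻¹' (C : Set H)) := by
    ext x
    constructor
    · rintro ⟨c, hc, rfl⟩
      change h⁻¹ * (h * c * h⁻¹ * h) ∈ C
      have : h⁻¹ * (h * c * h⁻¹ * h) = c := by group
      rwa [this]
    · intro hx
      exact ⟨_, hx, by change h * (h⁻¹ * (x * h)) * h⁻¹ = x; group⟩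
  have hop : IsOpen ((h⁻¹ * ·) ⁻¹' (C : Set H)) := hC.preimage (continuous_const_mul _)
  have h1 : μ (C.map (MulAut.conj h).toMonoidHom : Set H) = modularCharacter h * μ C := by
    rw [hset, measure_preimage_mul_right μ h hop.measurableSet, measure_preimage_mul]
  have h2 := relIndex_mul_measure μ hle hC.measurableSet
    (by rw [hset]; exact (hop.preimage (continuous_mul_const _)).measurableSet) hfin
  rw [h1, ← mul_assoc] at h2
  have h3 := ENNReal.mul_left_inj (hC.measure_pos μ ⟨1, one_mem _⟩).ne' hc.measure_lt_top.ne
    (a := ((C.map (MulAut.conj h).toMonoidHom).relIndex C : ENNReal) * modularCharacter h) (b := 1)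
  have h4 := h3.1 (by rw [one_mul, h2])
  rw [mul_comm]
  exact_mod_cast h4

end Modular

/-! ### Homomorphisms from the diagonal torus. -/

section Torus

variable {F : Type*} [Field F] [ValuativeRel F] [TopologicalSpace F]
  [IsNonarchimedeanLocalField F] {n : ℕ}

variable (F) in
lemma exists_uniformizer : ∃ b : Fˣ, ord (b : F) = 1 := by
  obtain ⟨γ, hγ⟩ := (IsNonarchimedeanLocalField.valueGroupWithZeroIsoInt F).surjective
    (WithZero.exp (-1 : ℤ))
  obtain ⟨a, rfl⟩ := valuation_surjective γ
  have ha : a ≠ 0 := by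
    rintro rfl
    rw [map_zero, map_zero] at hγ
    exact WithZero.exp_ne_zero hγ.symm
  exact ⟨Units.mk0 a ha, by rw [Units.val_mk0, ord, show IsNonarchimedeanLocalField.valueGroupWithZeroIsoInt F (valuation F a) = _
    from hγ, WithZero.log_exp, neg_neg]⟩

lemma valuation_eq_one_of_ord {a : F} (ha : a ≠ 0) (h : ord a = 0) : valuation F a = 1 := by
  have h1 := log_val_le_log_val ha one_ne_zero
  have h2 := log_val_le_log_val one_ne_zero ha
  rw [ord_one, h, map_one] at h1 h2
  exact le_antisymm (h2.1 le_rfl) (h1.1 le_rfl)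

lemma ord_zpow {a : F} (ha : a ≠ 0) (m : ℤ) : ord (a ^ m) = m * ord a := by
  obtain ⟨k, rfl | rfl⟩ := m.eq_nat_or_neg
  · rw [zpow_natCast, ord_pow ha]
  · rw [zpow_neg, zpow_natCast, ord_inv (pow_ne_zero _ ha), ord_pow ha]; ring

lemma diagG_mem_maxCompact {a : Idx n → Fˣ} (ha : ∀ i, ord (a i : F) = 0) :
    diagG F n a ∈ maxCompact F n := by
  refine mem_maxCompact_iff.2 ⟨fun i j => ?_, fun i j => ?_⟩
  · rw [diagG_val, Matrix.diagonal_apply]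
    split_ifs
    · exact (valuation_eq_one_of_ord (a i).ne_zero (ha i)).le
    · simp
  · rw [← map_inv, diagG_val, Matrix.diagonal_apply]
    split_ifs
    · rw [Pi.inv_apply, Units.val_inv_eq_inv_val, map_inv₀,
        valuation_eq_one_of_ord (a i).ne_zero (ha i), inv_one]
    · simp

/-- After division by powers of the uniformizer b, only units are left, and these are killed by T.
-/
lemma torus_hom_apply {A : Type*} [CommGroup A] (T : (Idx n → Fˣ) →* A)
    (hT : ∀ a : Idx n → Fˣ, (∀ i, ord (a i : F) = 0) → T a = 1) {b : Fˣ} (hb : ord (b : F) = 1)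
    (a : Idx n → Fˣ) : T a = ∏ i, T (Pi.mulSingle i b) ^ ord (a i : F) := by
  have h1 : ∏ i, T (Pi.mulSingle i b) ^ ord (a i : F) = T fun i => b ^ ord (a i : F) := by
    rw [← Finset.univ_prod_mulSingle fun i => b ^ ord (a i : F), map_prod]
    refine Finset.prod_congr rfl fun i _ => ?_
    rw [← map_zpow, Pi.mulSingle_zpow]
  rw [h1, ← div_eq_one, ← map_div]
  refine hT _ fun i => ?_
  rw [Pi.div_apply, Units.val_div_eq_div_val, div_eq_mul_inv, Units.val_zpow_eq_zpow_val,
    ord_mul (a i).ne_zero (inv_ne_zero (zpow_ne_zero _ b.ne_zero)),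
    ord_inv (zpow_ne_zero _ b.ne_zero), ord_zpow b.ne_zero, hb]
  ring

end Torus

/-! ### Unimodularity of G. -/

section Unimodular

open Measure

variable {F : Type*} [Field F] [ValuativeRel F] [TopologicalSpace F]
  [IsNonarchimedeanLocalField F] {n : ℕ}

lemma conj_permG_diagG_mulSingle (w : Equiv.Perm (Idx n)) (i : Idx n) (b : Fˣ) :
    permG F w * diagG F n (Pi.mulSingle i b) * (permG F w)⁻¹ =
      diagG F n (Pi.mulSingle (w i) b) := by
  rw [conj_permG_diagG]
  congr 1
  funext j
  simp [Pi.mulSingle_apply, Equiv.symm_apply_eq]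

/-- The group `GL_{2n}(F)` is unimodular. -/
theorem modularCharacter_G (g : G F n) : modularCharacter g = 1 := by
  obtain ⟨b, hb⟩ := exists_uniformizer F
  let Δ : G F n →* NNRealˣ := modularCharacter.toHomUnits
  suffices h : Δ g = 1 from congrArg Units.val h
  have hK : ∀ k ∈ maxCompact F n, Δ k = 1 := fun k hk =>
    Units.ext (modularCharacter_eq_one_of_mem isOpen_maxCompact isCompact_maxCompact hk)
  let T : (Idx n → Fˣ) →* NNRealˣ := Δ.comp (diagG F n)
  have hT : ∀ a : Idx n → Fˣ, (∀ i, ord (a i : F) = 0) → T a = 1 := fun a ha =>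
    hK _ (diagG_mem_maxCompact ha)
  have hconj : ∀ x y : G F n, Δ (x * y * x⁻¹) = Δ y := fun x y => by
    rw [map_mul, map_mul, map_inv, mul_comm (Δ x), mul_inv_cancel_right]
  -- Permutation matrices exchange the diagonal entries, and Δ has values in an abelian group.
  have hsame : ∀ i j, T (Pi.mulSingle i b) = T (Pi.mulSingle j b) := fun i j => by
    have h1 := hconj (permG F (Equiv.swap i j)) (diagG F n (Pi.mulSingle i b))
    rw [conj_permG_diagG_mulSingle, Equiv.swap_apply_left] at h1
    exact h1.symm
  have hcent : T (fun _ => b) = 1 := by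
    refine Units.ext (modularCharacter_eq_one_of_center isOpen_maxCompact isCompact_maxCompact
      fun x => Units.ext ?_)
    ext i j
    rw [Units.val_mul, Units.val_mul, diagG_val, Matrix.mul_diagonal, Matrix.diagonal_mul, mul_comm]
  -- The scalar matrix is central, so the common value of Δ has 2n-th power 1. Being non-negative
  -- and real, it is 1.
  have hone : ∀ i, T (Pi.mulSingle i b) = 1 := by
    intro i
    rw [torus_hom_apply T hT hb, Finset.prod_congr rfl fun j _ => by rw [hb, zpow_one, hsame j i],
      Finset.prod_const] at hcent
    have h1 := congrArg Units.val hcent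
    rw [Units.val_pow_eq_pow_val, Units.val_one] at h1
    exact Units.ext ((pow_eq_one_iff_of_nonneg zero_le (Finset.card_ne_zero_of_mem (Finset.mem_univ i))).1 h1)
  have hT1 : ∀ a, T a = 1 := fun a => by
    rw [torus_hom_apply T hT hb]
    simp [hone]
  obtain ⟨p, hp, k, hk, rfl⟩ := exists_iwasawa g
  obtain ⟨a, k', -, hk', heq⟩ := exists_conj_diagG hp
  rw [map_mul, hK k hk, mul_one, ← hconj (diagG F n a), heq, map_mul, hK k' hk', mul_one]
  exact hT1 _

end Unimodular

/-! ### The modular character of the Borel subgroup. -/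

section BorelModulus

open Measure

variable {F : Type*} [Field F] [ValuativeRel F] [TopologicalSpace F]
  [IsNonarchimedeanLocalField F] {n : ℕ}

lemma val_le_of_lt_one {b : Fˣ} (hb : ord (b : F) = 1) {x : F} (hx : valuation F x < 1) :
    valuation F x ≤ valuation F (b : F) := by
  by_cases h0 : x = 0
  · simp [h0]
  rw [← log_val_le_log_val b.ne_zero h0, hb]
  by_contra h
  have h1 := (log_val_le_log_val h0 (one_ne_zero (α := F))).1 (by rw [ord_one]; omega)
  rw [map_one] at h1
  exact absurd hx h1.not_gt

lemma val_uniformizer_lt_one {b : Fˣ} (hb : ord (b : F) = 1) : valuation F (b : F) < 1 := by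
  by_contra h
  rw [not_lt, ← map_one (valuation F), ← log_val_le_log_val b.ne_zero one_ne_zero, ord_one, hb] at h
  omega

lemma residue_eq_zero_iff_val {x : 𝒪[F]} :
    IsLocalRing.residue 𝒪[F] x = 0 ↔ valuation F (x : F) < 1 := by
  rw [IsLocalRing.residue_eq_zero_iff, IsLocalRing.mem_maximalIdeal, mem_nonunits_iff,
    Valuation.Integers.isUnit_iff_valuation_eq_one
      (Valuation.integer.integers (ValuativeRel.valuation F))]
  exact ⟨fun h => lt_of_le_of_ne x.2 h, fun h => h.ne⟩

/-- The positions in the upper right block of size `m × (2n - m)`. -/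
abbrev Corner (n m : ℕ) : Type := {i : Idx n // (pos i : ℕ) < m} × {j : Idx n // m ≤ (pos j : ℕ)}

lemma card_corner {m : ℕ} (hm : m ≤ n + n) : Nat.card (Corner n m) = m * (n + n - m) := by
  have h1 : Nat.card {i : Idx n // (pos i : ℕ) < m} = m := by
    rw [Nat.card_congr (Equiv.subtypeEquiv (p := fun i : Idx n => (pos i : ℕ) < m) finSumFinEquiv (q := fun i : Fin (n + n) => (i : ℕ) < m)
      fun _ => Iff.rfl), Nat.card_eq_fintype_card, Fintype.card_subtype,
      Fin.card_filter_val_lt]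
    exact min_eq_right hm
  have h2 : Nat.card {i : Idx n // m ≤ (pos i : ℕ)} = n + n - m := by
    have := Fintype.card_subtype_compl (fun i : Idx n => (pos i : ℕ) < m)
    simp only [not_lt, Fintype.card_sum, Fintype.card_fin] at this
    rw [Nat.card_eq_fintype_card] at h1 ⊢
    rw [this, h1]
  rw [Nat.card_prod, h1, h2]

/-- The congruence subgroup of the Borel subgroup. -/
def borelCong (n : ℕ) (γ : ValueGroupWithZero F) : Subgroup (borelSubgroup F n) :=
  (cong n γ).subgroupOf _

variable {b : Fˣ} (hb : ord (b : F) = 1) (m : ℕ)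

lemma val_corner_le {p : borelSubgroup F n} (hp : p ∈ borelCong n (valuation F (b : F)))
    (x : Corner n m) :
    valuation F (p.1.val x.1 x.2 * (b : F)⁻¹) ≤ 1 := by
  have h := hp.2 x.1 x.2
  rw [Subgroup.subtype_apply, Matrix.sub_apply, Matrix.one_apply_ne (by
    intro h
    have h1 := x.1.2
    have h2 := x.2.2
    rw [h] at h1
    omega), sub_zero] at h
  rw [map_mul, map_inv₀]
  exact mul_inv_le_one_of_le₀ h zero_le

/-- The upper right block of an element of the congruence subgroup, modulo higher powers of the
maximal ideal. -/
def cornerHom (hb : ord (b : F) = 1) : borelCong (F := F) n (valuation F (b : F)) →*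
    Multiplicative (Corner n m → 𝓀[F]) where
  toFun p := Multiplicative.ofAdd fun x =>
    IsLocalRing.residue 𝒪[F] ⟨p.1.1.val x.1 x.2 * (b : F)⁻¹, val_corner_le m p.2 x⟩
  map_one' := by
    refine congrArg Multiplicative.ofAdd (funext fun x => residue_eq_zero_iff_val.2 ?_)
    have : x.1.1 ≠ x.2.1 := by
      intro h
      have h1 := x.1.2
      have h2 := x.2.2
      rw [h] at h1
      omega
    simp [Matrix.one_apply_ne this]
  map_mul' p p' := by
    refine congrArg Multiplicative.ofAdd (funext fun x => ?_)
    have hne : x.1.1 ≠ x.2.1 := by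
      intro h
      have h1 := x.1.2
      have h2 := x.2.2
      rw [h] at h1
      omega
    change _ = IsLocalRing.residue 𝒪[F] _ + IsLocalRing.residue 𝒪[F] _
    rw [← map_add, ← sub_eq_zero, ← map_sub, residue_eq_zero_iff_val]
    -- Multiplication of elements of the congruence subgroup is addition of p - 1 up to a product
    -- divisible by b², which disappears after division by b and reduction.
    have h1 : (p * p').1.1.val - 1 - ((p.1.1.val - 1) + (p'.1.1.val - 1)) =
        (p.1.1.val - 1) * (p'.1.1.val - 1) := by
      change p.1.1.val * p'.1.1.val - 1 - _ = _
      noncomm_ring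
    have h2 : (p * p').1.1.val x.1 x.2 - (p.1.1.val x.1 x.2 + p'.1.1.val x.1 x.2) =
        ((p.1.1.val - 1) * (p'.1.1.val - 1)) x.1 x.2 := by
      rw [← h1]
      simp only [Matrix.sub_apply, Matrix.add_apply, Matrix.one_apply_ne hne]
      ring
    have h3 := p.2.2.mul p'.2.2 x.1 x.2
    have h4 := val_uniformizer_lt_one hb
    change valuation F ((p * p').1.1.val x.1 x.2 * (b : F)⁻¹ - (p.1.1.val x.1 x.2 * (b : F)⁻¹ +
      p'.1.1.val x.1 x.2 * (b : F)⁻¹)) < 1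
    rw [← add_mul, ← sub_mul, h2, map_mul, map_inv₀]
    refine lt_of_le_of_lt (mul_le_mul_left h3 _) ?_
    rwa [mul_assoc, mul_inv_cancel₀ (by simp), mul_one]

lemma cornerHom_surjective : Function.Surjective (cornerHom (n := n) m hb) := by
  classical
  intro y
  choose z hz using fun x => IsLocalRing.residue_surjective (R := 𝒪[F]) (Multiplicative.toAdd y x)
  let A : Matrix (Idx n) (Idx n) F := 1 + Matrix.of fun i j =>
    if h : (pos i : ℕ) < m ∧ m ≤ (pos j : ℕ) then (b : F) * z (⟨i, h.1⟩, ⟨j, h.2⟩) else 0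
  obtain ⟨g, hg, hgA⟩ := exists_cong_of_sub_one (A := A) (val_uniformizer_lt_one hb) (by
    intro i j
    simp only [A, add_sub_cancel_left, Matrix.of_apply]
    split_ifs with h
    · rw [map_mul]
      exact mul_le_of_le_one_right' (z _).2
    · simp)
  have hgb : g ∈ borelSubgroup F n := by
    change g.val.BlockTriangular pos
    rw [hgA]
    refine Matrix.blockTriangular_one.add fun i j hij => ?_
    rw [Matrix.of_apply, dif_neg]
    rintro ⟨h1, h2⟩
    have : (pos j : ℕ) < pos i := hij
    omega
  refine ⟨⟨⟨g, hgb⟩, hg⟩, ?_⟩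
  refine congrArg Multiplicative.ofAdd (funext fun x => ?_)
  refine Eq.trans ?_ (hz x)
  congr 1
  refine Subtype.ext ?_
  change g.val x.1 x.2 * (b : F)⁻¹ = z x
  have hne : x.1.1 ≠ x.2.1 := by
    intro h
    have h1 := x.1.2
    have h2 := x.2.2
    rw [h] at h1
    omega
  rw [hgA]
  simp only [A, Matrix.add_apply, Matrix.one_apply_ne hne, zero_add, Matrix.of_apply]
  rw [dif_pos ⟨x.1.2, x.2.2⟩, mul_comm (b : F), mul_inv_cancel_right₀ b.ne_zero]

/-- The diagonal matrix with `b` in the first `m` places and `1` elsewhere. -/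
def blockDiag (n : ℕ) (b : Fˣ) (m : ℕ) : borelSubgroup F n :=
  ⟨diagG F n fun i => if (pos i : ℕ) < m then b else 1, diagG_mem_borelSubgroup _⟩

lemma mem_map_conj_iff {H : Type*} [Group H] {C : Subgroup H} {h x : H} :
    x ∈ C.map (MulAut.conj h).toMonoidHom ↔ h⁻¹ * x * h ∈ C := by
  constructor
  · rintro ⟨c, hc, rfl⟩
    change h⁻¹ * (h * c * h⁻¹) * h ∈ C
    have : h⁻¹ * (h * c * h⁻¹) * h = c := by group
    rwa [this]
  · intro hx
    exact ⟨_, hx, by change h * (h⁻¹ * x * h) * h⁻¹ = x; group⟩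

lemma conj_blockDiag_apply (p : borelSubgroup F n) (i j : Idx n) :
    ((blockDiag n b m)⁻¹ * p * blockDiag n b m).1.val i j =
      (if (pos i : ℕ) < m then (b : F)⁻¹ else 1) * p.1.val i j *
        (if (pos j : ℕ) < m then (b : F) else 1) := by
  change ((diagG F n _)⁻¹ * p.1 * diagG F n _).val i j = _
  rw [← map_inv, Units.val_mul, Units.val_mul, diagG_val, diagG_val, Matrix.mul_diagonal,
    Matrix.diagonal_mul]
  congr 2
  · rw [Pi.inv_apply]
    split_ifs <;> simp
  · split_ifs <;> simp

lemma mem_borelCong_iff {p : borelSubgroup F n} {γ : ValueGroupWithZero F} (hγ : γ < 1) :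
    p ∈ borelCong n γ ↔ MatLE γ (p.1.val - 1) := by
  constructor
  · exact fun h => h.2
  · intro h
    obtain ⟨g, hg, hgp⟩ := exists_cong_of_sub_one hγ h
    obtain rfl : g = p.1 := Units.ext hgp
    exact hg

include hb in
-- Undoing the conjugation divides the corner entries by b and leaves the other entries of p alone.
-- Membership therefore asks for one more power of b in the corner, which is the vanishing of
-- `cornerHom`.
lemma mem_map_conj_blockDiag_iff (p : borelSubgroup F n) :
    p ∈ (borelCong n (valuation F (b : F))).map (MulAut.conj (blockDiag n b m)).toMonoidHom ↔
      ∃ h : p ∈ borelCong n (valuation F (b : F)), cornerHom m hb ⟨p, h⟩ = 1 := by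
  have hv := val_uniformizer_lt_one hb
  have key : ∀ i j, ((blockDiag n b m)⁻¹ * p * blockDiag n b m).1.val i j - (1 : Matrix _ _ F) i j =
      if (pos i : ℕ) < m ∧ m ≤ (pos j : ℕ) then p.1.val i j * (b : F)⁻¹ else
        p.1.val i j - (1 : Matrix _ _ F) i j := by
    intro i j
    rw [conj_blockDiag_apply]
    by_cases hi : (pos i : ℕ) < m <;> by_cases hj : (pos j : ℕ) < m
    · rw [if_pos hi, if_pos hj, if_neg (by omega)]
      field_simp
    · have hne : i ≠ j := by rintro rfl; omega
      rw [if_pos hi, if_neg hj, if_pos (by omega), Matrix.one_apply_ne hne]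
      ring
    · have h0 : p.1.val i j = 0 := p.2 (Fin.lt_def.2 (by omega))
      rw [if_neg hi, if_pos hj, if_neg (by omega), h0]
      ring
    · rw [if_neg hi, if_neg hj, if_neg (by omega)]
      ring
  rw [mem_map_conj_iff, mem_borelCong_iff hv]
  constructor
  · intro h
    have hp : p ∈ borelCong n (valuation F (b : F)) := by
      refine (mem_borelCong_iff hv).2 fun i j => ?_
      have h1 := h i j
      rw [Matrix.sub_apply, key] at h1
      split_ifs at h1 with hc
      · have hne : i ≠ j := by rintro rfl; omega
        rw [Matrix.sub_apply, Matrix.one_apply_ne hne, sub_zero]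
        have h2 : p.1.val i j = p.1.val i j * (b : F)⁻¹ * b := by
          rw [mul_assoc, inv_mul_cancel₀ b.ne_zero, mul_one]
        rw [h2, map_mul]
        exact mul_le_of_le_one_left' (h1.trans hv.le)
      · exact h1
    refine ⟨hp, congrArg Multiplicative.ofAdd (funext fun x => residue_eq_zero_iff_val.2 ?_)⟩
    have h1 := h x.1 x.2
    rw [Matrix.sub_apply, key, if_pos ⟨x.1.2, x.2.2⟩] at h1
    exact h1.trans_lt hv
  · rintro ⟨hp, h⟩ i j
    rw [Matrix.sub_apply, key]
    split_ifs with hc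
    · have h1 := congrFun (congrArg Multiplicative.toAdd h) (⟨i, hc.1⟩, ⟨j, hc.2⟩)
      exact val_le_of_lt_one hb (residue_eq_zero_iff_val.1 h1)
    · exact hp.2 i j

instance : SecondCountableTopology (borelSubgroup F n) :=
  Topology.IsInducing.subtypeVal.secondCountableTopology

include hb in
-- The conjugated congruence subgroup is the kernel of the surjection `cornerHom`, so its index is q
-- to the number of corner entries.
lemma modularCharacter_blockDiag (hm : m ≤ n + n) :
    modularCharacter (blockDiag n b m) * (resCard F : NNReal) ^ (m * (n + n - m)) = 1 := by
  let E := borelCong (F := F) n (valuation F (b : F))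
  have hE : IsOpen (E : Set (borelSubgroup F n)) :=
    (isOpen_cong (by simp)).preimage continuous_subtype_val
  have hc : IsCompact (E : Set (borelSubgroup F n)) := by
    have h1 : IsCompact (cong n (valuation F (b : F)) : Set (G F n)) :=
      isCompact_maxCompact.of_isClosed_subset (Subgroup.isClosed_of_isOpen _ (isOpen_cong (by simp)))
        cong_le_maxCompact
    exact isClosed_borelSubgroup.isClosedEmbedding_subtypeVal.isCompact_preimage h1
  have hle : E.map (MulAut.conj (blockDiag n b m)).toMonoidHom ≤ E := fun p hp =>
    ((mem_map_conj_blockDiag_iff hb m p).1 hp).1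
  have hidx : (E.map (MulAut.conj (blockDiag n b m)).toMonoidHom).relIndex E =
      resCard F ^ (m * (n + n - m)) := by
    have h1 : (E.map (MulAut.conj (blockDiag n b m)).toMonoidHom).subgroupOf E =
        (cornerHom m hb).ker := by
      ext p
      rw [Subgroup.mem_subgroupOf, mem_map_conj_blockDiag_iff hb, MonoidHom.mem_ker]
      exact ⟨fun ⟨_, h⟩ => h, fun h => ⟨p.2, h⟩⟩
    rw [Subgroup.relIndex, h1, Subgroup.index_ker,
      MonoidHom.range_eq_top.2 (cornerHom_surjective hb m), Subgroup.card_top,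
      Nat.card_congr Multiplicative.toAdd, Nat.card_fun, card_corner hm, resCard]
  have h := modularCharacter_mul_relIndex hE hc hle (by
    rw [hidx]
    exact pow_ne_zero _ (by have := resCard_pos (F := F); exact_mod_cast this.ne'))
  rw [hidx] at h
  exact_mod_cast h

lemma isOpen_borel_inf_maxCompact :
    IsOpen ((maxCompact F n).subgroupOf (borelSubgroup F n) : Set (borelSubgroup F n)) :=
  isOpen_maxCompact.preimage continuous_subtype_val

lemma isCompact_borel_inf_maxCompact :
    IsCompact ((maxCompact F n).subgroupOf (borelSubgroup F n) : Set (borelSubgroup F n)) :=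
  isClosed_borelSubgroup.isClosedEmbedding_subtypeVal.isCompact_preimage isCompact_maxCompact

/-- The diagonal matrices, as a subgroup of the Borel subgroup. -/
def borelTorus (F : Type*) [Field F] (n : ℕ) : (Idx n → Fˣ) →* borelSubgroup F n :=
  (diagG F n).codRestrict _ diagG_mem_borelSubgroup

lemma blockDiag_succ (b : Fˣ) (i : Idx n) :
    blockDiag n b ((pos i : ℕ) + 1) = blockDiag n b (pos i) * borelTorus F n (Pi.mulSingle i b) := by
  refine Subtype.ext ?_
  change diagG F n _ = diagG F n _ * diagG F n _
  rw [← map_mul]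
  congr 1
  funext j
  rw [Pi.mul_apply, Pi.mulSingle_apply]
  by_cases h : j = i
  · subst h
    simp
  · have h1 : (pos j : ℕ) ≠ pos i := fun h' => h (pos_injective (Fin.ext h'))
    rw [if_neg h, mul_one]
    exact if_congr (by omega) rfl rfl

/-- The modular character of the Borel subgroup is `δ`. -/
theorem modularCharacter_borel (p : borelSubgroup F n) : (modularCharacter p : ℝ) = modulus p.1 := by
  obtain ⟨b, hb⟩ := exists_uniformizer F
  let Δ : borelSubgroup F n →* NNRealˣ := modularCharacter.toHomUnits
  have hK : ∀ k : borelSubgroup F n, k.1 ∈ maxCompact F n → Δ k = 1 := fun k hk =>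
    Units.ext (modularCharacter_eq_one_of_mem isOpen_borel_inf_maxCompact
      isCompact_borel_inf_maxCompact hk)
  let T : (Idx n → Fˣ) →* NNRealˣ := Δ.comp (borelTorus F n)
  have hT : ∀ a : Idx n → Fˣ, (∀ i, ord (a i : F) = 0) → T a = 1 := fun a ha =>
    hK _ (diagG_mem_maxCompact ha)
  have hq : (resCard F : ℝ) ≠ 0 := resCard_pos.ne'
  have hblock : ∀ m ≤ n + n, ((Δ (blockDiag n b m) : NNReal) : ℝ) =
      ((resCard F : ℝ) ^ (m * (n + n - m)))⁻¹ := fun m hm => by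
    have h := congrArg NNReal.toReal (modularCharacter_blockDiag hb m hm)
    push_cast at h
    exact eq_inv_of_mul_eq_one_left h
  -- Two consecutive block matrices differ by one diagonal entry, and the exponents m (2n - m) at m
  -- = i + 1 and m = i differ by 2n - 1 - 2i.
  have hsingle : ∀ i, ((T (Pi.mulSingle i b) : NNReal) : ℝ) =
      (resCard F : ℝ) ^ (-(2 * (n : ℤ) - 1 - 2 * ((pos i : ℕ) : ℤ))) := by
    intro i
    have h1 : ((Δ (blockDiag n b ((pos i : ℕ) + 1)) : NNReal) : ℝ) =
        (Δ (blockDiag n b (pos i)) : NNReal) * (T (Pi.mulSingle i b) : NNReal) := by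
      rw [blockDiag_succ, map_mul]
      rfl
    have hi := (pos i).2
    rw [hblock _ hi, hblock _ hi.le, eq_inv_mul_iff_mul_eq₀ (pow_ne_zero _ hq)] at h1
    rw [← h1, ← zpow_natCast, ← zpow_natCast, ← zpow_neg, ← zpow_add₀ hq]
    congr 1
    obtain ⟨d, hd⟩ := Nat.exists_eq_add_of_lt hi
    have h2 : n + n - (pos i : ℕ) = d + 1 := by omega
    have h3 : n + n - ((pos i : ℕ) + 1) = d := by omega
    have h4 : 2 * (n : ℤ) = (pos i : ℕ) + d + 1 := by exact_mod_cast (by omega)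
    rw [h2, h3, h4]
    push_cast
    ring
  obtain ⟨a, k, hkb, hk, heq⟩ := exists_conj_diagG p.2
  have h1 : Δ p = T (borelDiag p.2) := by
    have h2 : borelTorus F n a * p * (borelTorus F n a)⁻¹ =
        borelTorus F n (borelDiag p.2) * ⟨k, hkb⟩ := Subtype.ext heq
    have h3 := congrArg Δ h2
    rw [map_mul, map_mul, map_mul, map_inv, mul_comm (Δ (borelTorus F n a)), mul_inv_cancel_right,
      hK ⟨k, hkb⟩ hk, mul_one] at h3
    exact h3
  change ((Δ p : NNReal) : ℝ) = _
  rw [h1, torus_hom_apply T hT hb, modulus, Units.coe_prod, NNReal.coe_prod]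
  refine Finset.prod_congr rfl fun i _ => ?_
  rw [Units.val_zpow_eq_zpow_val, NNReal.coe_zpow, hsingle, absF, ← zpow_mul, ← zpow_mul]
  congr 1
  change -_ * ord (p.1.val i i) = _
  ring

end BorelModulus

/-! ### The open double coset and the kernel κ. -/

section OpenCell

variable {F : Type*} [Field F] [ValuativeRel F] [TopologicalSpace F]
  [IsNonarchimedeanLocalField F] {n : ℕ} {γ : ValueGroupWithZero F}

/-- The permutation of the matrix `ξ`. -/
def xiPerm (n : ℕ) : Equiv.Perm (Idx n) :=
  (Equiv.sumComm _ _).trans (Equiv.sumCongr (Equiv.refl _) Fin.revPerm)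

lemma xiPerm_symm_inl (a : Fin n) : (xiPerm n).symm (Sum.inl a) = Sum.inr a := rfl

lemma xiPerm_symm_inr (a : Fin n) : (xiPerm n).symm (Sum.inr a) = Sum.inl a.rev := rfl

lemma permG_xiPerm : permG F (xiPerm n) = xi F n := by
  refine Units.ext (Matrix.ext fun i j => ?_)
  rw [permG_apply]
  rcases i with i | i <;> rcases j with j | j <;>
    simp [xiPerm_symm_inl, xiPerm_symm_inr, xi, w0, Matrix.one_apply, eq_comm]

/-- The support is the union of the first i rows and of at most min(n, j) further ones. For ξ these
further rows are the last min(n, j), so the two sets are disjoint or fill everything. -/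
lemma card_rankSupport_le_xiPerm (w : Equiv.Perm (Idx n)) (i j : ℕ) :
    (rankSupport w i j).card ≤ (rankSupport (xiPerm n) i j).card := by
  classical
  let A : Finset (Idx n) := {c | (pos c : ℕ) < i}
  let S (w : Equiv.Perm (Idx n)) : Finset (Fin n) := {l | (pos (w (Sum.inr l)) : ℕ) < j}
  let B (w : Equiv.Perm (Idx n)) : Finset (Idx n) := (S w).image fun l => w (Sum.inl l)
  have hunion : ∀ w : Equiv.Perm (Idx n), rankSupport w i j = A ∪ B w := by
    intro w
    ext c
    obtain ⟨c, rfl⟩ := w.surjective c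
    rcases c with l | l <;> simp [rankSupport, A, B, S, partner_inl]
  have hB : ∀ w, (B w).card = (S w).card := fun w =>
    Finset.card_image_of_injective _ fun a b h => by simpa using w.injective h
  have hSx : (S (xiPerm n)).card = min n j := by
    rw [← Fin.card_filter_val_lt]
    rfl
  have hS : (S w).card ≤ min n j := by
    refine le_min ((Finset.card_le_univ _).trans_eq (Fintype.card_fin n)) ?_
    have h1 : ((S w).image fun l => pos (w (Sum.inr l))).card = (S w).card :=
      Finset.card_image_of_injective _ fun a b h => by simpa using w.injective (pos_injective h)
    rw [← h1]
    refine (Finset.card_le_card (t := Finset.univ.filter fun x : Fin (n + n) => (x : ℕ) < j) ?_).trans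
      ?_
    · intro x hx
      obtain ⟨l, hl, rfl⟩ := Finset.mem_image.1 hx
      simpa [S] using hl
    · rw [Fin.card_filter_val_lt]
      exact min_le_right _ _
  have hBx : ∀ c, c ∈ B (xiPerm n) ↔ n ≤ (pos c : ℕ) ∧ n + n ≤ (pos c : ℕ) + j := by
    intro c
    have hinl : ∀ l : Fin n, xiPerm n (Sum.inl l) = Sum.inr l.rev := fun _ => rfl
    have hinr : ∀ l : Fin n, xiPerm n (Sum.inr l) = Sum.inl l := fun _ => rfl
    simp only [B, S, Finset.mem_image, Finset.mem_filter_univ, hinl, hinr]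
    rcases c with c | c
    · simp [pos]
    · simp only [pos, finSumFinEquiv_apply_left, finSumFinEquiv_apply_right, Fin.val_castAdd,
        Fin.val_natAdd, Sum.inr.injEq]
      constructor
      · rintro ⟨l, hl, rfl⟩
        rw [Fin.val_rev]
        omega
      · rintro ⟨-, h⟩
        exact ⟨c.rev, by rw [Fin.val_rev]; omega, Fin.rev_rev c⟩
  rw [hunion, hunion]
  by_cases h : i + min n j ≤ n + n
  · have hdisj : Disjoint A (B (xiPerm n)) := by
      rw [Finset.disjoint_left]
      intro c hc hc'
      have h1 : (pos c : ℕ) < i := by simpa [A] using hc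
      have h2 := (hBx c).1 hc'
      rcases min_choice n j with h3 | h3 <;> omega
    rw [Finset.card_union_of_disjoint hdisj, hB, hSx]
    exact (Finset.card_union_le _ _).trans (Nat.add_le_add_left ((hB w).trans_le hS) _)
  · refine Finset.card_le_card fun c _ => ?_
    rw [Finset.mem_union, hBx]
    have hA : c ∈ A ↔ (pos c : ℕ) < i := by simp [A]
    rw [hA]
    have := (pos c).2
    have h1 := min_le_left n j
    have h2 := min_le_right n j
    omega

lemma rankSum_le_xi (g : G F n) : rankSum g ≤ rankSum (xi F n) := by
  obtain ⟨γ, -, hγ⟩ := exists_val_ne_zero_lt_one (F := F)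
  obtain ⟨p, hp, w, s, hs, rfl⟩ := exists_borel_mul_perm_mul_shalika g
  rw [rankSum_mul_shalika _ hs, rankSum_borel_mul hp, ← permG_xiPerm]
  refine Finset.sum_le_sum fun q _ => (finrank_rankSpace_permG_le w _ _).trans
    ((card_rankSupport_le_xiPerm w _ _).trans (card_rankSupport_le hγ _ ?_ _ _))
  rw [sub_self]
  intro i j
  simp

/-- The rank sum is maximal at ξ, so it is constant near ξ, and a neighbourhood of ξ lies in PξS. -/
lemma exists_of_xi_mul (hγ : γ < 1) {c : G F n} (hc : c ∈ cong n γ) :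
    ∃ p ∈ borelSubgroup F n, p ∈ maxCompact F n ∧ ∃ s ∈ shalika F n, s ∈ cong n γ ∧
      xi F n * c = p * xi F n * s := by
  have h1 : rankSum (1 * permG F (xiPerm n) * c) = rankSum (permG F (xiPerm n)) := by
    refine le_antisymm ?_ (rankSum_permG_le_of_mem hγ _ (one_mem _) hc)
    rw [permG_xiPerm]
    exact rankSum_le_xi _
  have h2 := exists_shalika_of_rankSum_eq hγ (one_mem _) hc h1
  simpa only [one_mul, permG_xiPerm] using h2

lemma chiDelta_inv_mul (χ : Idx n → ℂˣ) (p : G F n) :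
    chiDelta χ p * chiDelta χ⁻¹ p = modulus p := by
  have h1 : unramChar χ p * unramChar χ⁻¹ p = 1 := by
    rw [unramChar, unramChar, ← Finset.prod_mul_distrib]
    refine Finset.prod_eq_one fun i _ => ?_
    rw [Pi.inv_apply, Units.val_inv_eq_inv_val, inv_zpow,
      mul_inv_cancel₀ (zpow_ne_zero _ (χ i).ne_zero)]
  have h2 : ((Real.sqrt (modulus p) : ℝ) : ℂ) * (Real.sqrt (modulus p) : ℝ) = modulus p := by
    rw [← Complex.ofReal_mul, Real.mul_self_sqrt (modulus_pos p).le]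
  rw [chiDelta, chiDelta, mul_mul_mul_comm, h1, h2, one_mul]

lemma conj_xi_apply (s : G F n) (i j : Idx n) :
    (xi F n * s * (xi F n)⁻¹).val i j = s.val ((xiPerm n).symm i) ((xiPerm n).symm j) := by
  rw [← permG_xiPerm, Units.val_mul, Units.val_mul, conj_permG_apply]

/-- The diagonal of ξsξ⁻¹ is that of g followed by its reverse, while χ and δ have inverse
components at opposite places. As `chiDelta` reads only diagonal entries, ξsξ⁻¹ need not be upper
triangular. -/
lemma chiDelta_conj_xi (t : D n) {s : G F n} (hs : s ∈ shalika F n) :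
    chiDelta (chiOf t) (xi F n * s * (xi F n)⁻¹) = 1 := by
  obtain ⟨g, Y, rfl⟩ := exists_eq_shalikaElt hs
  set q := xi F n * shalikaElt g Y * (xi F n)⁻¹ with hq
  have h1 : ∀ a, q.val (Sum.inl a) (Sum.inl a) = g.val a a := fun a => by
    rw [hq, conj_xi_apply, shalikaElt_val, xiPerm_symm_inl]; rfl
  have h2 : ∀ a, q.val (Sum.inr a) (Sum.inr a) = g.val a.rev a.rev := fun a => by
    rw [hq, conj_xi_apply, shalikaElt_val, xiPerm_symm_inr]; rfl
  have h3 : modulus q = 1 := by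
    rw [modulus, Fintype.prod_sum_type, ← Equiv.prod_comp Fin.revPerm (fun a : Fin n =>
      absF (q.val (Sum.inr a) (Sum.inr a)) ^ _), ← Finset.prod_mul_distrib]
    refine Finset.prod_eq_one fun a _ => ?_
    rw [Fin.revPerm_apply, h1, h2, Fin.rev_rev, ← zpow_add₀ (absF_pos _).ne']
    have h4 : (2 * (n : ℤ) - 1 - 2 * ((pos (Sum.inl a : Idx n) : ℕ) : ℤ)) +
        (2 * (n : ℤ) - 1 - 2 * ((pos (Sum.inr a.rev : Idx n) : ℕ) : ℤ)) = 0 := by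
      simp only [pos, finSumFinEquiv_apply_left, finSumFinEquiv_apply_right, Fin.val_castAdd,
        Fin.val_natAdd, Fin.val_rev]
      omega
    rw [h4, zpow_zero]
  have h5 : unramChar (chiOf t) q = 1 := by
    rw [unramChar_chiOf]
    refine Finset.prod_eq_one fun a _ => ?_
    rw [charExponent, h1, h2, Fin.rev_rev, sub_self, zpow_zero]
  rw [chiDelta, h3, h5]
  simp

lemma chiDelta_inv_conj_xi (t : D n) {s : G F n} (hs : s ∈ shalika F n) :
    chiDelta (chiOf t)⁻¹ (xi F n * s * (xi F n)⁻¹) = 1 := by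
  have h1 := chiDelta_inv_mul (chiOf t) (xi F n * s * (xi F n)⁻¹)
  have h2 : modulus (xi F n * s * (xi F n)⁻¹) = 1 := by
    have h3 := chiDelta_conj_xi 1 hs
    have h4 : unramChar (chiOf (1 : D n)) (xi F n * s * (xi F n)⁻¹) = 1 := by
      rw [unramChar_chiOf]
      simp
    rw [chiDelta, h4, one_mul] at h3
    exact Real.sqrt_eq_one.1 (by exact_mod_cast h3)
  rw [chiDelta_conj_xi t hs, h2, one_mul] at h1
  exact_mod_cast h1

/-- Conjugation by ξ moves the upper right block of s below the diagonal, so that block is 0 if the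
conjugate is upper triangular. -/
lemma shalikaChar_conj_xi (ψ : AddChar F Circle) {s : G F n}
    (hp : xi F n * s * (xi F n)⁻¹ ∈ borelSubgroup F n) : shalikaChar ψ s = 1 := by
  have h : s.val.toBlocks₁₂ = 0 := by
    ext a b
    have h1 : (xi F n * s * (xi F n)⁻¹).val (Sum.inr a.rev) (Sum.inl b) = 0 := by
      refine hp (Fin.lt_def.2 ?_)
      simp only [pos, finSumFinEquiv_apply_left, finSumFinEquiv_apply_right, Fin.val_castAdd,
        Fin.val_natAdd]
      omega
    rw [conj_xi_apply, xiPerm_symm_inr, xiPerm_symm_inl, Fin.rev_rev] at h1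
    exact h1
  rw [shalikaChar, shalikaTrace, h]
  simp

/-- The open double coset `P ξ S`. -/
def openCell (F : Type*) [Field F] (n : ℕ) : Set (G F n) :=
  {g | ∃ p ∈ borelSubgroup F n, ∃ s ∈ shalika F n, g = p * xi F n * s}

variable (ψ : AddChar F Circle) (t : D n)

open Classical in
/-- The kernel of the Shalika functional: `κ (p ξ s) = χ⁻¹ δ^{1/2} (p) Ψ(s)⁻¹`, and `κ = 0` outside the
open double coset. -/
def kappa (g : G F n) : ℂ :=
  if h : ∃ x : G F n × G F n, x.1 ∈ borelSubgroup F n ∧ x.2 ∈ shalika F n ∧ g = x.1 * xi F n * x.2 then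
    chiDelta (chiOf t)⁻¹ h.choose.1 * (shalikaChar ψ h.choose.2)⁻¹ else 0

/-- Two decompositions p ξ s of one element differ by some s₀ ∈ S with ξs₀ξ⁻¹ ∈ P, where χ⁻¹δ^{1/2}
and Ψ are both trivial. -/
lemma kappa_eq {p s : G F n} (hp : p ∈ borelSubgroup F n) (hs : s ∈ shalika F n) :
    kappa ψ t (p * xi F n * s) = chiDelta (chiOf t)⁻¹ p * (shalikaChar ψ s)⁻¹ := by
  have h : ∃ x : G F n × G F n, x.1 ∈ borelSubgroup F n ∧ x.2 ∈ shalika F n ∧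
      p * xi F n * s = x.1 * xi F n * x.2 := ⟨(p, s), hp, hs, rfl⟩
  rw [kappa, dif_pos h]
  obtain ⟨h1, h2, h3⟩ := h.choose_spec
  set p' := h.choose.1
  set s' := h.choose.2
  have hs₀ := mul_mem h2 (inv_mem hs)
  have hq : xi F n * (s' * s⁻¹) * (xi F n)⁻¹ = p'⁻¹ * p := by
    have h4 : xi F n * s' = p'⁻¹ * (p * xi F n * s) := by rw [h3]; group
    rw [← mul_assoc, h4]
    group
  have hqb : xi F n * (s' * s⁻¹) * (xi F n)⁻¹ ∈ borelSubgroup F n := by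
    rw [hq]; exact mul_mem (inv_mem h1) hp
  have e1 := chiDelta_inv_conj_xi t hs₀
  have e2 := shalikaChar_conj_xi ψ hqb
  rw [hq] at e1
  have e3 := chiDelta_mul (chiOf t)⁻¹ h1 (mul_mem (inv_mem h1) hp)
  rw [e1, mul_one, mul_inv_cancel_left] at e3
  have e4 := shalikaChar_mul ψ hs₀ hs
  rw [e2, one_mul, inv_mul_cancel_right] at e4
  rw [e3, e4]

lemma kappa_eq_zero {g : G F n} (h : g ∉ openCell F n) : kappa ψ t g = 0 := by
  rw [kappa, dif_neg]
  rintro ⟨x, h1, h2, h3⟩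
  exact h ⟨x.1, h1, x.2, h2, h3⟩

lemma kappa_mul {p s : G F n} (hp : p ∈ borelSubgroup F n) (hs : s ∈ shalika F n) (g : G F n) :
    kappa ψ t (p * g * s) = chiDelta (chiOf t)⁻¹ p * kappa ψ t g * (shalikaChar ψ s)⁻¹ := by
  by_cases h : g ∈ openCell F n
  · obtain ⟨p', hp', s', hs', rfl⟩ := h
    have h1 : p * (p' * xi F n * s') * s = (p * p') * xi F n * (s' * s) := by group
    rw [h1, kappa_eq ψ t (mul_mem hp hp') (mul_mem hs' hs), kappa_eq ψ t hp' hs',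
      chiDelta_mul _ hp hp', shalikaChar_mul ψ hs' hs, mul_inv]
    ring
  · rw [kappa_eq_zero ψ t h, kappa_eq_zero, mul_zero, zero_mul]
    rintro ⟨p', hp', s', hs', heq⟩
    exact h ⟨p⁻¹ * p', mul_mem (inv_mem hp) hp', s' * s⁻¹, mul_mem hs' (inv_mem hs), by
      rw [show p⁻¹ * p' * xi F n * (s' * s⁻¹) = p⁻¹ * (p' * xi F n * s') * s⁻¹ by group, ← heq]
      group⟩

variable {ψ}

/-- The kernel is locally constant on the open double coset. -/
lemma exists_kappa_mul_eq (hψ : ConductorIsIntegers ψ) {g : G F n} (hg : g ∈ openCell F n) :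
    ∃ γ : ValueGroupWithZero F, γ ≠ 0 ∧ ∀ c ∈ cong n γ, g * c ∈ openCell F n ∧
      kappa ψ t (g * c) = kappa ψ t g := by
  obtain ⟨p, hp, s, hs, rfl⟩ := hg
  obtain ⟨γ₀, h0, h1⟩ := exists_val_ne_zero_lt_one (F := F)
  obtain ⟨γ, hγ, -, -, hconj⟩ := exists_conj_cong_le s h0
  refine ⟨γ, hγ, fun c hc => ?_⟩
  obtain ⟨p', hp', hpk', s', hs', hsγ', heq⟩ := exists_of_xi_mul h1 (hconj c hc)
  have h2 : p * xi F n * s * c = (p * p') * xi F n * (s' * s) := by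
    calc p * xi F n * s * c = p * (xi F n * (s * c * s⁻¹)) * s := by group
      _ = _ := by rw [heq]; group
  refine ⟨⟨_, mul_mem hp hp', _, mul_mem hs' hs, h2⟩, ?_⟩
  rw [h2, kappa_eq ψ t (mul_mem hp hp') (mul_mem hs' hs), kappa_eq ψ t hp hs, chiDelta_mul _ hp hp',
    chiDelta_eq_one _ hp' hpk', mul_one, shalikaChar_mul ψ hs' hs,
    shalikaChar_eq_one hψ hsγ'.1, one_mul]

lemma isOpen_openCell (hψ : ConductorIsIntegers ψ) : IsOpen (openCell F n) := by
  refine isOpen_iff_mem_nhds.2 fun g hg => ?_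
  obtain ⟨γ, hγ, h⟩ := exists_kappa_mul_eq (1 : D n) hψ hg
  refine Filter.mem_of_superset (((isOpen_cong hγ).preimage (continuous_const_mul g⁻¹)).mem_nhds
    (x := g) (by simp [one_mem])) fun x hx => ?_
  have := (h _ hx).1
  rwa [mul_inv_cancel_left] at this

lemma measurable_kappa [MeasurableSpace (G F n)] [BorelSpace (G F n)] (hψ : ConductorIsIntegers ψ) :
    Measurable (kappa (F := F) ψ t) := by
  classical
  have h : kappa (F := F) ψ t = (openCell F n).piecewise (kappa ψ t) fun _ => 0 := by
    funext g
    by_cases hg : g ∈ openCell F n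
    · rw [Set.piecewise_eq_of_mem _ _ _ hg]
    · rw [Set.piecewise_eq_of_notMem _ _ _ hg, kappa_eq_zero ψ t hg]
  rw [h]
  refine ContinuousOn.measurable_piecewise (fun g hg => ?_) continuousOn_const
    (isOpen_openCell hψ).measurableSet
  refine ContinuousAt.continuousWithinAt ?_
  obtain ⟨γ, hγ, h⟩ := exists_kappa_mul_eq t hψ hg
  refine (continuousAt_const (y := kappa ψ t g)).congr ?_
  refine Filter.mem_of_superset (((isOpen_cong hγ).preimage (continuous_const_mul g⁻¹)).mem_nhds
    (x := g) (by simp [one_mem])) fun x hx => ?_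
  have := (h _ hx).2
  rw [mul_inv_cancel_left] at this
  exact this.symm

/-- The absolute values of the Satake parameters at the points of the torus at which `χ⁻¹ δ^{1/2}` is
unitary. -/
def unitaryRadius (F : Type*) [Field F] [ValuativeRel F] [TopologicalSpace F]
    [IsNonarchimedeanLocalField F] {n : ℕ} (i : Fin n) : ℝ :=
  Real.sqrt (resCard F) ^ (-(2 * (n : ℤ) - 1 - 2 * (i : ℤ)))

variable {t}

lemma norm_chiOf (ht : ∀ i, ‖(t i : ℂ)‖ = unitaryRadius F i) (i : Idx n) :
    ‖(chiOf t i : ℂ)‖ = Real.sqrt (resCard F) ^ (-(2 * (n : ℤ) - 1 - 2 * ((pos i : ℕ) : ℤ))) := by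
  rcases i with i | i
  · exact ht i
  · change ‖(((t i.rev)⁻¹ : ℂˣ) : ℂ)‖ = _
    rw [Units.val_inv_eq_inv_val, norm_inv, ht, unitaryRadius, ← zpow_neg]
    congr 1
    simp only [pos, finSumFinEquiv_apply_right, Fin.val_natAdd, Fin.val_rev]
    omega

lemma norm_chiDelta_inv (ht : ∀ i, ‖(t i : ℂ)‖ = unitaryRadius F i) (p : G F n) :
    ‖chiDelta (chiOf t)⁻¹ p‖ = 1 := by
  have hq : 0 < Real.sqrt (resCard F) := Real.sqrt_pos.2 resCard_pos
  let e : Idx n → ℤ := fun i => 2 * (n : ℤ) - 1 - 2 * ((pos i : ℕ) : ℤ)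
  have hsq : ∀ m : ℤ, (Real.sqrt (resCard F) ^ m) ^ 2 = (resCard F : ℝ) ^ m := fun m => by
    rw [← zpow_natCast, ← zpow_mul, mul_comm, zpow_mul, zpow_natCast, Real.sq_sqrt resCard_pos.le]
  have h1 : modulus p = (∏ i, Real.sqrt (resCard F) ^ (-ord (p.val i i) * e i)) ^ 2 := by
    rw [modulus, ← Finset.prod_pow]
    refine Finset.prod_congr rfl fun i _ => ?_
    rw [absF, ← zpow_mul, hsq]
  have h2 : ‖unramChar (chiOf t)⁻¹ p‖ = ∏ i, Real.sqrt (resCard F) ^ (ord (p.val i i) * e i) := by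
    rw [unramChar, norm_prod]
    refine Finset.prod_congr rfl fun i _ => ?_
    rw [norm_zpow, Pi.inv_apply, Units.val_inv_eq_inv_val, norm_inv, norm_chiOf ht, ← zpow_neg,
      ← zpow_mul, neg_neg, mul_comm]
  rw [chiDelta, norm_mul, h2, Complex.norm_real, Real.norm_of_nonneg (Real.sqrt_nonneg _), h1,
    Real.sqrt_sq (Finset.prod_nonneg fun i _ => zpow_nonneg hq.le _), ← Finset.prod_mul_distrib]
  refine Finset.prod_eq_one fun i _ => ?_
  rw [← zpow_add₀ hq.ne', neg_mul, add_neg_cancel, zpow_zero]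

lemma norm_kappa_le (ht : ∀ i, ‖(t i : ℂ)‖ = unitaryRadius F i) (g : G F n) :
    ‖kappa ψ t g‖ ≤ 1 := by
  by_cases h : g ∈ openCell F n
  · obtain ⟨p, hp, s, hs, rfl⟩ := h
    rw [kappa_eq ψ t hp hs, norm_mul, norm_chiDelta_inv ht, norm_inv, norm_shalikaChar]
    norm_num
  · rw [kappa_eq_zero ψ t h, norm_zero]
    exact zero_le_one

end OpenCell

/-! ### Invariant integration over P\G. -/

section Integration

variable {F : Type*} [Field F] [ValuativeRel F] [TopologicalSpace F]
  [IsNonarchimedeanLocalField F] {n : ℕ}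

lemma modulus_mul {p p' : G F n} (hp : p ∈ borelSubgroup F n) (hp' : p' ∈ borelSubgroup F n) :
    modulus (p * p') = modulus p * modulus p' := by
  rw [modulus, modulus, modulus, ← Finset.prod_mul_distrib]
  refine Finset.prod_congr rfl fun i _ => ?_
  rw [borel_diag_mul hp hp', absF_mul (a := p.val i i) (b := p'.val i i) (borelDiag hp i).ne_zero
    (borelDiag hp' i).ne_zero, mul_zpow]

lemma modulus_eq_one_of_mem {p : G F n} (hp : p ∈ borelSubgroup F n) (hk : p ∈ maxCompact F n) :
    modulus p = 1 := by
  simp [modulus, absF, ord_eq_zero (valuation_diag_eq_one hp hk _)]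

/-- The right `K`-invariant extension of `δ` to `G`. -/
def modulusK (g : G F n) : ℝ := modulus (borelPart g)

lemma modulusK_mul {p k : G F n} (hp : p ∈ borelSubgroup F n) (hk : k ∈ maxCompact F n) :
    modulusK (p * k) = modulus p := by
  set q := borelPart (p * k) with hq
  have h1 : q⁻¹ * p = (compactPart (p * k) : G F n) * k⁻¹ := by
    have h2 := borelPart_mul_compactPart (p * k)
    rw [← hq] at h2
    rw [inv_mul_eq_iff_eq_mul, ← mul_assoc, h2, mul_inv_cancel_right]
  have h3 : q⁻¹ * p ∈ maxCompact F n := h1 ▸ mul_mem (compactPart (p * k)).2 (inv_mem hk)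
  have h4 := modulus_mul (borelPart_mem (p * k)) (mul_mem (inv_mem (borelPart_mem (p * k))) hp)
  rw [modulus_eq_one_of_mem (mul_mem (inv_mem (borelPart_mem (p * k))) hp) h3, mul_one,
    mul_inv_cancel_left] at h4
  exact h4.symm

lemma modulusK_borel_mul {p : G F n} (hp : p ∈ borelSubgroup F n) (g : G F n) :
    modulusK (p * g) = modulus p * modulusK g := by
  obtain ⟨q, hq, k, hk, rfl⟩ := exists_iwasawa g
  rw [← mul_assoc, modulusK_mul (mul_mem hp hq) hk, modulusK_mul hq hk, modulus_mul hp hq]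

lemma modulusK_pos (g : G F n) : 0 < modulusK g := modulus_pos _

lemma continuous_modulusK : Continuous (modulusK (F := F) (n := n)) := by
  obtain ⟨γ, h0, -⟩ := exists_val_ne_zero_lt_one (F := F)
  refine (isLocallyConstant_of_cong h0 fun g c hc => ?_).continuous
  obtain ⟨q, hq, k, hk, rfl⟩ := exists_iwasawa g
  rw [mul_assoc, modulusK_mul hq (mul_mem hk hc.1), modulusK_mul hq hk]

variable [MeasurableSpace (G F n)] [BorelSpace (G F n)]

instance : BorelSpace (borelSubgroup F n) := Subtype.borelSpace _

/-- For g = qk the set is a right translate of P ∩ K by q⁻¹, and right translation changes the left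
Haar measure by the modular character, which is δ. -/
lemma measure_borel_mul_mem (ν : Measure (borelSubgroup F n)) [ν.IsHaarMeasure] (g : G F n) :
    ν.real {p | p.1 * g ∈ maxCompact F n} =
      modulusK g * ν.real ((maxCompact F n).subgroupOf (borelSubgroup F n) : Set _) := by
  obtain ⟨q, hq, k, hk, rfl⟩ := exists_iwasawa g
  have h1 : {p : borelSubgroup F n | p.1 * (q * k) ∈ maxCompact F n} =
      (· * (⟨q, hq⟩ : borelSubgroup F n)) ⁻¹'
        ((maxCompact F n).subgroupOf (borelSubgroup F n) : Set _) := by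
    ext p
    rw [Set.mem_ofPred_eq, ← mul_assoc, Subgroup.mul_mem_cancel_right _ hk]
    rfl
  rw [h1, measureReal_def, measure_preimage_mul_right ν _ isOpen_borel_inf_maxCompact.measurableSet,
    ENNReal.toReal_mul, ENNReal.coe_toReal, modularCharacter_borel, modulusK_mul hq hk]
  rfl

lemma measure_borel_inv_mul_mem (ν : Measure (borelSubgroup F n)) [ν.IsHaarMeasure] (g : G F n) :
    ν.real {p | p.1⁻¹ * g ∈ maxCompact F n} =
      ν.real ((maxCompact F n).subgroupOf (borelSubgroup F n) : Set _) := by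
  obtain ⟨q, hq, k, hk, rfl⟩ := exists_iwasawa g
  have h1 : {p : borelSubgroup F n | p.1⁻¹ * (q * k) ∈ maxCompact F n} =
      ((⟨q, hq⟩⁻¹ : borelSubgroup F n) * ·) ⁻¹'
        ((maxCompact F n).subgroupOf (borelSubgroup F n) : Set _) := by
    ext p
    rw [Set.mem_ofPred_eq, ← mul_assoc, Subgroup.mul_mem_cancel_right _ hk, ← inv_mem_iff, mul_inv_rev,
      inv_inv]
    rfl
  rw [h1, measureReal_def, measure_preimage_mul]
  rfl

variable (μ : Measure (G F n)) [μ.IsHaarMeasure]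

instance : μ.IsMulRightInvariant := ⟨fun g => by
  rw [Measure.map_right_mul_eq_modularCharacterFun_smul μ g,
    show Measure.modularCharacterFun g = 1 from modularCharacter_G g, one_smul]⟩

/-- Functions that transform under the Borel subgroup by `δ` have the same integral over all the
translates `K s`. -/
theorem setIntegral_translate {f : G F n → ℂ} (hf : Measurable f) {M : ℝ}
    (hM : ∀ k ∈ maxCompact F n, ‖f k‖ ≤ M)
    (hp : ∀ p ∈ borelSubgroup F n, ∀ g, f (p * g) = modulus p * f g) (s : G F n) :
    ∫ x in {x | x * s⁻¹ ∈ maxCompact F n}, f x ∂μ = ∫ x in (maxCompact F n : Set (G F n)), f x ∂μ := by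
  let ν : Measure (borelSubgroup F n) := Measure.haar
  let P₀ : Set (borelSubgroup F n) := (maxCompact F n).subgroupOf (borelSubgroup F n)
  have hν0 : (ν.real P₀ : ℂ) ≠ 0 := by
    have h1 : 0 < ν P₀ := isOpen_borel_inf_maxCompact.measure_pos ν ⟨1, one_mem _⟩
    have h2 : ν P₀ < ⊤ := isCompact_borel_inf_maxCompact.measure_lt_top
    exact_mod_cast (ENNReal.toReal_pos h1.ne' h2.ne).ne'
  have hKo : IsOpen (maxCompact F n : Set (G F n)) := isOpen_maxCompact
  have hKs : IsOpen {x : G F n | x * s⁻¹ ∈ maxCompact F n} := hKo.preimage (continuous_mul_const _)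
  have hKsc : IsCompact {x : G F n | x * s⁻¹ ∈ maxCompact F n} := by
    have h1 := isCompact_maxCompact (F := F) (n := n).image (continuous_mul_const s)
    convert h1 using 1
    ext x
    constructor
    · intro hx
      exact ⟨_, hx, inv_mul_cancel_right _ _⟩
    · rintro ⟨k, hk, rfl⟩
      rw [Set.mem_ofPred_eq, mul_inv_cancel_right]
      exact hk
  -- Division by the extension of δ gives a left P-invariant function, bounded since G = PK.
  let f₀ : G F n → ℂ := fun g => f g * ((modulusK g)⁻¹ : ℝ)
  have hf₀ : Measurable f₀ :=
    hf.mul (Complex.measurable_ofReal.comp continuous_modulusK.measurable.inv)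
  have hf₀p : ∀ p ∈ borelSubgroup F n, ∀ g, f₀ (p * g) = f₀ g := by
    intro p hpb g
    have h1 : (modulus p : ℂ) ≠ 0 := by exact_mod_cast (modulus_pos p).ne'
    simp only [f₀]
    rw [hp p hpb, modulusK_borel_mul hpb, mul_inv]
    push_cast
    field_simp
  have hf₀K : ∀ k ∈ maxCompact F n, f₀ k = f k := by
    intro k hk
    have h1 := modulusK_mul (one_mem (borelSubgroup F n)) hk
    rw [one_mul, modulus_eq_one_of_mem (one_mem _) (one_mem _)] at h1
    simp [f₀, h1]
  have hf₀M : ∀ g, ‖f₀ g‖ ≤ M := by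
    intro g
    obtain ⟨p, hpb, k, hk, rfl⟩ := exists_iwasawa g
    rw [hf₀p p hpb, hf₀K k hk]
    exact hM k hk
  -- The integral of f₀ over each of these two sets is computed in both orders. Integrating over p
  -- first gives the integral of f over Ks or over K, times the measure of P ∩ K.
  let W₁ : Set (G F n × borelSubgroup F n) :=
    {x | x.1 * s⁻¹ ∈ maxCompact F n ∧ x.2.1 * x.1 ∈ maxCompact F n}
  let W₂ : Set (G F n × borelSubgroup F n) :=
    {x | x.1 ∈ maxCompact F n ∧ x.2.1⁻¹ * x.1 * s⁻¹ ∈ maxCompact F n}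
  have hW₁ : IsOpen W₁ := (hKo.preimage (f := fun x : G F n × borelSubgroup F n => x.1 * s⁻¹)
    (by fun_prop)).inter (hKo.preimage (f := fun x : G F n × borelSubgroup F n => x.2.1 * x.1)
    (by fun_prop))
  have hW₂ : IsOpen W₂ := (hKo.preimage (f := fun x : G F n × borelSubgroup F n => x.1)
    (by fun_prop)).inter (hKo.preimage (f := fun x : G F n × borelSubgroup F n => x.2.1⁻¹ * x.1 * s⁻¹)
    (by fun_prop))
  let Ω : Set (borelSubgroup F n) := Subtype.val ⁻¹'
    ((fun x : G F n × G F n => x.1 * s⁻¹ * x.2) '' ((maxCompact F n : Set _) ×ˢ (maxCompact F n : Set _)))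
  have hΩ : IsCompact Ω := by
    refine isClosed_borelSubgroup.isClosedEmbedding_subtypeVal.isCompact_preimage ?_
    exact (isCompact_maxCompact.prod isCompact_maxCompact).image (by fun_prop)
  have hfin₁ : (μ.prod ν) W₁ < ⊤ := by
    refine lt_of_le_of_lt (measure_mono (t := {x : G F n | x * s⁻¹ ∈ maxCompact F n} ×ˢ Ω) ?_)
      ((hKsc.prod hΩ).measure_lt_top)
    rintro ⟨g, p⟩ ⟨h1, h2⟩
    refine ⟨h1, ⟨(p.1 * g, (g * s⁻¹)⁻¹), ⟨h2, inv_mem h1⟩, ?_⟩⟩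
    change p.1 * g * s⁻¹ * (g * s⁻¹)⁻¹ = p.1
    group
  have hfin₂ : (μ.prod ν) W₂ < ⊤ := by
    refine lt_of_le_of_lt (measure_mono (t := (maxCompact F n : Set (G F n)) ×ˢ Ω) ?_)
      ((isCompact_maxCompact.prod hΩ).measure_lt_top)
    rintro ⟨g, p⟩ ⟨h1, h2⟩
    refine ⟨h1, ⟨(g, (p.1⁻¹ * g * s⁻¹)⁻¹), ⟨h1, inv_mem h2⟩, ?_⟩⟩
    change g * s⁻¹ * (p.1⁻¹ * g * s⁻¹)⁻¹ = p.1
    group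
  let Φ₁ : G F n → borelSubgroup F n → ℂ := fun g p => W₁.indicator (fun x => f₀ x.1) (g, p)
  let Φ₂ : G F n → borelSubgroup F n → ℂ := fun g p => W₂.indicator (fun x => f₀ x.1) (g, p)
  have hint₁ : Integrable (Function.uncurry Φ₁) (μ.prod ν) := by
    refine (integrable_indicator_iff hW₁.measurableSet).2 (Measure.integrableOn_of_bounded hfin₁.ne
      (hf₀.comp measurable_fst).aestronglyMeasurable (M := M) (Filter.Eventually.of_forall
        fun x => hf₀M x.1))
  have hint₂ : Integrable (Function.uncurry Φ₂) (μ.prod ν) := by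
    refine (integrable_indicator_iff hW₂.measurableSet).2 (Measure.integrableOn_of_bounded hfin₂.ne
      (hf₀.comp measurable_fst).aestronglyMeasurable (M := M) (Filter.Eventually.of_forall
        fun x => hf₀M x.1))
  have hin₁ : ∀ g, ∫ p, Φ₁ g p ∂ν =
      ({x : G F n | x * s⁻¹ ∈ maxCompact F n}.indicator f g) * (ν.real P₀ : ℂ) := by
    intro g
    by_cases hg : g * s⁻¹ ∈ maxCompact F n
    · have h1 : ∀ p, Φ₁ g p = {p : borelSubgroup F n | p.1 * g ∈ maxCompact F n}.indicator
          (fun _ => f₀ g) p := by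
        intro p
        exact Set.indicator_eq_indicator (and_iff_right hg) rfl
      have h2 : IsOpen {p : borelSubgroup F n | p.1 * g ∈ maxCompact F n} :=
        hKo.preimage (f := fun p : borelSubgroup F n => p.1 * g) (by fun_prop)
      simp only [h1]
      rw [integral_indicator_const _ h2.measurableSet, measure_borel_mul_mem,
        Set.indicator_of_mem (by exact hg), Complex.real_smul]
      have h3 : (modulusK g : ℂ) ≠ 0 := by exact_mod_cast (modulusK_pos g).ne'
      simp only [f₀, P₀]
      push_cast
      field_simp
    · have h1 : ∀ p, Φ₁ g p = 0 := fun p => Set.indicator_of_notMem (fun h => hg h.1) _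
      rw [Set.indicator_of_notMem (by exact hg)]
      simp [h1]
  have hin₂ : ∀ g, ∫ p, Φ₂ g p ∂ν =
      ((maxCompact F n : Set (G F n)).indicator f g) * (ν.real P₀ : ℂ) := by
    intro g
    by_cases hg : g ∈ maxCompact F n
    · have h1 : ∀ p, Φ₂ g p = {p : borelSubgroup F n | p.1⁻¹ * (g * s⁻¹) ∈ maxCompact F n}.indicator
          (fun _ => f₀ g) p := by
        intro p
        refine Set.indicator_eq_indicator (b := p) ?_ rfl
        change (g ∈ maxCompact F n ∧ p.1⁻¹ * g * s⁻¹ ∈ maxCompact F n) ↔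
          p.1⁻¹ * (g * s⁻¹) ∈ maxCompact F n
        rw [mul_assoc]
        exact and_iff_right hg
      have h2 : IsOpen {p : borelSubgroup F n | p.1⁻¹ * (g * s⁻¹) ∈ maxCompact F n} :=
        hKo.preimage (f := fun p : borelSubgroup F n => p.1⁻¹ * (g * s⁻¹)) (by fun_prop)
      simp only [h1]
      rw [integral_indicator_const _ h2.measurableSet, measure_borel_inv_mul_mem,
        Set.indicator_of_mem (by exact hg), Complex.real_smul, hf₀K g hg, mul_comm]
    · have h1 : ∀ p, Φ₂ g p = 0 := fun p => Set.indicator_of_notMem (fun h => hg h.1) _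
      rw [Set.indicator_of_notMem (by exact hg)]
      simp [h1]
  -- For fixed p, the substitution g ↦ p⁻¹g carries one set to the other, and f₀ is invariant under
  -- it.
  have hswap : ∀ p, ∫ g, Φ₁ g p ∂μ = ∫ g, Φ₂ g p ∂μ := by
    intro p
    rw [← integral_mul_left_eq_self (fun g => Φ₁ g p) p.1⁻¹]
    refine integral_congr_ae (Filter.Eventually.of_forall fun g => ?_)
    have h1 : (p.1⁻¹ * g, p) ∈ W₁ ↔ (g, p) ∈ W₂ := by
      change (_ ∧ p.1 * (p.1⁻¹ * g) ∈ _) ↔ _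
      rw [mul_inv_cancel_left]
      exact and_comm
    exact Set.indicator_eq_indicator h1 (hf₀p _ (inv_mem p.2) g)
  have h1 := integral_integral_swap hint₁
  have h2 := integral_integral_swap hint₂
  simp only [hswap] at h1
  rw [← h2] at h1
  simp only [hin₁, hin₂, integral_mul_const] at h1
  have h3 := mul_right_cancel₀ hν0 h1
  rwa [integral_indicator hKs.measurableSet, integral_indicator hKo.measurableSet] at h3

lemma setIntegral_maxCompact_mul_right {f : G F n → ℂ} (hf : Measurable f) {M : ℝ}
    (hM : ∀ k ∈ maxCompact F n, ‖f k‖ ≤ M)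
    (hp : ∀ p ∈ borelSubgroup F n, ∀ g, f (p * g) = modulus p * f g) (s : G F n) :
    ∫ x in (maxCompact F n : Set (G F n)), f (x * s) ∂μ =
      ∫ x in (maxCompact F n : Set (G F n)), f x ∂μ := by
  have hKs : IsOpen {x : G F n | x * s⁻¹ ∈ maxCompact F n} :=
    isOpen_maxCompact.preimage (continuous_mul_const _)
  rw [← setIntegral_translate μ hf hM hp s, ← integral_indicator hKs.measurableSet,
    ← integral_indicator isOpen_maxCompact.measurableSet,
    ← integral_mul_right_eq_self ({x : G F n | x * s⁻¹ ∈ maxCompact F n}.indicator f) s]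
  refine integral_congr_ae (Filter.Eventually.of_forall fun x => ?_)
  have h1 : x * s ∈ {x : G F n | x * s⁻¹ ∈ maxCompact F n} ↔ x ∈ (maxCompact F n : Set (G F n)) := by
    rw [Set.mem_ofPred_eq, mul_inv_cancel_right]
    rfl
  exact Set.indicator_eq_indicator h1.symm rfl

end Integration

/-! ### Non-zero functionals at the unitary points. -/

section Existence

variable {F : Type*} [Field F] [ValuativeRel F] [TopologicalSpace F]
  [IsNonarchimedeanLocalField F] {n : ℕ} {ψ : AddChar F Circle} {t : D n}

lemma exists_norm_le {χ : Idx n → ℂˣ} (v : I F χ) : ∃ M, ∀ k ∈ maxCompact F n, ‖v.1 k‖ ≤ M :=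
  isCompact_maxCompact.exists_bound_of_continuousOn v.2.1.continuous.continuousOn

/-- An element of B is an integral upper triangular matrix times a congruence element, and the
latter can be split across ξ. All the factors lie in K, where both characters are trivial. -/
lemma kappa_of_mem_iwahori (hψ : ConductorIsIntegers ψ) {c : G F n} (hc : c ∈ iwahori F n) :
    kappa ψ t (c * xi F n) = 1 := by
  obtain ⟨γ, hγ, p, hp, hk, c, hc', rfl⟩ := exists_of_mem_iwahori hc
  have h1 := conj_mem_cong' (permG_mem_maxCompact (xiPerm n)) hc'
  rw [permG_xiPerm] at h1
  obtain ⟨p', hp', hpk', s, hs, hsγ, heq⟩ := exists_of_xi_mul hγ h1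
  have h2 : p * c * xi F n = p * p' * xi F n * s := by
    calc p * c * xi F n = p * (xi F n * ((xi F n)⁻¹ * c * xi F n)) := by group
      _ = _ := by rw [heq]; group
  rw [h2, kappa_eq ψ t (mul_mem hp hp') hs, chiDelta_eq_one _ (mul_mem hp hp') (mul_mem hk hpk'),
    shalikaChar_eq_one hψ hsγ.1, inv_one, one_mul]

/-- Since P ∩ K ⊆ B, the set PB meets K in B only. -/
lemma testVec_of_mem_maxCompact {x : G F n} (hx : x ∈ maxCompact F n) :
    (x * (xi F n)⁻¹ ∈ iwahori F n → (testVec F n t).1 x = 1) ∧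
    (x * (xi F n)⁻¹ ∉ iwahori F n → (testVec F n t).1 x = 0) := by
  constructor
  · intro h
    have h1 := phiBFun_eq (chiOf t) (one_mem (borelSubgroup F n)) (g := x * (xi F n)⁻¹)
      (by rwa [inv_one, one_mul])
    rw [chiDelta_one] at h1
    exact h1
  · intro h
    refine phiBFun_eq_zero _ ?_
    rintro ⟨p, hp, hb⟩
    have hxi : xi F n ∈ maxCompact F n := by
      rw [← permG_xiPerm]; exact permG_mem_maxCompact _
    have hpk : p ∈ maxCompact F n := by
      have h1 := mul_mem (mul_mem hx (inv_mem hxi)) (inv_mem (iwahori_le_maxCompact hb))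
      have h2 : x * (xi F n)⁻¹ * (p⁻¹ * (x * (xi F n)⁻¹))⁻¹ = p := by group
      rwa [h2] at h1
    have h1 := mul_mem (borel_inf_maxCompact_le_iwahori hp hpk) hb
    rw [mul_inv_cancel_left] at h1
    exact h h1

/-- At the points where `χ⁻¹ δ^{1/2}` is unitary, there is a Shalika functional that does not vanish
on `R_{ξ⁻¹} φ_B`. -/
theorem exists_shalikaFunctional (hψ : ConductorIsIntegers ψ)
    (ht : ∀ i, ‖(t i : ℂ)‖ = unitaryRadius F i) :
    ∃ Λ : I F (chiOf t) →ₗ[ℂ] ℂ, IsShalikaFunctional ψ Λ ∧ Λ (testVec F n t) ≠ 0 := by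
  borelize (G F n)
  let μ : Measure (G F n) := Measure.haar
  have hmeas : ∀ v : I F (chiOf t), Measurable fun x => v.1 x * kappa ψ t x := fun v =>
    v.2.1.continuous.measurable.mul (measurable_kappa t hψ)
  have hbound : ∀ v : I F (chiOf t), ∃ M, ∀ k ∈ maxCompact F n, ‖v.1 k * kappa ψ t k‖ ≤ M := by
    intro v
    obtain ⟨M, hM⟩ := exists_norm_le v
    refine ⟨M, fun k hk => ?_⟩
    rw [norm_mul]
    exact (mul_le_of_le_one_right (norm_nonneg _) (norm_kappa_le ht k)).trans (hM k hk)
  have hint : ∀ v : I F (chiOf t),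
      IntegrableOn (fun x => v.1 x * kappa ψ t x) (maxCompact F n : Set (G F n)) μ := by
    intro v
    obtain ⟨M, hM⟩ := hbound v
    exact Measure.integrableOn_of_bounded isCompact_maxCompact.measure_lt_top.ne
      (hmeas v).aestronglyMeasurable
      ((ae_restrict_iff' isOpen_maxCompact.measurableSet).2 (Filter.Eventually.of_forall hM))
  let Λ : I F (chiOf t) →ₗ[ℂ] ℂ :=
    { toFun := fun v => ∫ x in (maxCompact F n : Set (G F n)), v.1 x * kappa ψ t x ∂μ
      map_add' := fun v v' => by
        rw [← integral_add (hint v) (hint v')]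
        refine integral_congr_ae (Filter.Eventually.of_forall fun x => ?_)
        exact add_mul _ _ _
      map_smul' := fun c v => by
        rw [RingHom.id_apply, ← integral_smul]
        refine integral_congr_ae (Filter.Eventually.of_forall fun x => ?_)
        exact mul_assoc _ _ _ }
  refine ⟨Λ, (isShalikaFunctional_iff ψ).2 fun s hs v => ?_, ?_⟩
  · obtain ⟨M, hM⟩ := hbound v
    -- The product vκ transforms under P by χδ^{1/2} · χ⁻¹δ^{1/2} = δ, as the invariance of the
    -- integral requires.
    have h1 := setIntegral_maxCompact_mul_right μ (hmeas v) hM (fun p hp g => by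
      have h2 := kappa_mul ψ t hp (one_mem (shalika F n)) g
      rw [mul_one, shalikaChar_one, inv_one, mul_one] at h2
      rw [v.2.2 p hp, h2, ← chiDelta_inv_mul (chiOf t) p]
      ring) s
    change ∫ x in (maxCompact F n : Set (G F n)), v.1 (x * s) * kappa ψ t x ∂μ = _ *
      ∫ x in (maxCompact F n : Set (G F n)), v.1 x * kappa ψ t x ∂μ
    rw [← h1, ← integral_const_mul]
    refine integral_congr_ae (Filter.Eventually.of_forall fun x => ?_)
    have h2 := kappa_mul ψ t (one_mem (borelSubgroup F n)) hs x
    rw [one_mul, chiDelta_one, one_mul] at h2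
    change _ = shalikaChar ψ s * (v.1 (x * s) * kappa ψ t (x * s))
    rw [h2]
    field_simp [shalikaChar_ne_zero ψ s]
  -- On K the test vector is the indicator function of Bξ, and κ = 1 there, so the value is the
  -- volume of Bξ.
  · let U : Set (G F n) := {x | x * (xi F n)⁻¹ ∈ iwahori F n}
    have hxi : xi F n ∈ maxCompact F n := by
      rw [← permG_xiPerm]; exact permG_mem_maxCompact _
    have hU : IsOpen U := isOpen_iwahori.preimage (continuous_mul_const _)
    have hUK : U ⊆ maxCompact F n := fun x hx => by
      have h1 := mul_mem (iwahori_le_maxCompact hx) hxi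
      rwa [inv_mul_cancel_right] at h1
    have h1 : Λ (testVec F n t) = ∫ x in (maxCompact F n : Set (G F n)), U.indicator (fun _ => (1 : ℂ)) x ∂μ := by
      refine setIntegral_congr_fun isOpen_maxCompact.measurableSet fun x hx => ?_
      by_cases hxU : x ∈ U
      · have h2 := (testVec_of_mem_maxCompact (t := t) hx).1 hxU
        have h3 := kappa_of_mem_iwahori (t := t) hψ hxU
        rw [inv_mul_cancel_right] at h3
        change (testVec F n t).1 x * kappa ψ t x = _
        rw [h2, h3, Set.indicator_of_mem hxU, one_mul]
      · have h2 := (testVec_of_mem_maxCompact (t := t) hx).2 hxU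
        change (testVec F n t).1 x * kappa ψ t x = _
        rw [h2, Set.indicator_of_notMem hxU, zero_mul]
    rw [h1, setIntegral_indicator hU.measurableSet, Set.inter_eq_self_of_subset_right hUK,
      setIntegral_const, Complex.real_smul, mul_one]
    have h2 : 0 < μ U := hU.measure_pos μ ⟨xi F n, by
      change xi F n * (xi F n)⁻¹ ∈ iwahori F n
      rw [mul_inv_cancel]; exact one_mem _⟩
    have h3 : μ U < ⊤ := (measure_mono hUK).trans_lt isCompact_maxCompact.measure_lt_top
    exact_mod_cast (ENNReal.toReal_pos h2.ne' h3.ne).ne'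

end Existence

/-! ### Uniqueness of coefficients by Zariski density. -/

section Coefficients

variable {F : Type*} [Field F] [ValuativeRel F] [TopologicalSpace F]
  [IsNonarchimedeanLocalField F] {n : ℕ} {ψ : AddChar F Circle} {Q : Poly n} {v v' : Fam F n}
  {h h' : D n → ℂ} {t : D n}

lemma infinite_norm_eq {r : ℝ} (hr : 0 < r) : {z : ℂˣ | ‖(z : ℂ)‖ = r}.Infinite := by
  have h1 : Function.Injective fun c : Circle =>
      Units.mk0 ((r : ℂ) * c) (mul_ne_zero (by exact_mod_cast hr.ne') c.coe_ne_zero) := by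
    intro c c' h
    have h2 := congrArg Units.val h
    exact Circle.ext (mul_left_cancel₀ (by exact_mod_cast hr.ne') h2)
  have : Infinite Circle := by
    have h2 : Infinite (Set.Ioc (-Real.pi) Real.pi) :=
      (Set.Ioc_infinite (by linarith [Real.pi_pos])).to_subtype
    exact Circle.argEquiv.infinite_iff.2 h2
  refine (Set.infinite_range_of_injective h1).mono ?_
  rintro _ ⟨c, rfl⟩
  simp [abs_of_pos hr, Circle.norm_coe]

lemma unitaryRadius_pos (i : Fin n) : 0 < unitaryRadius F i := by
  have h1 : 0 < resCard F := Nat.card_pos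
  exact zpow_pos (Real.sqrt_pos.2 (by exact_mod_cast h1)) _

/-- The coefficient of a family is determined, since there are non-zero Shalika functionals on a
dense subset of the torus. -/
lemma IsCoef.eq (hψ : ConductorIsIntegers ψ) (hQ : Q ≠ 0) (hv : IsCoef ψ Q v h)
    (hv' : IsCoef ψ Q v h') (ht : evalAt t Q ≠ 0) : h t = h' t := by
  refine sub_eq_zero.1 ((hv.1.sub hv'.1).eq_zero hQ
    (fun i => {z : ℂˣ | ‖(z : ℂ)‖ = unitaryRadius F i})
    (fun i => infinite_norm_eq (unitaryRadius_pos i)) (fun t ht hq => ?_) ht)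
  obtain ⟨Λ, hΛ, hne⟩ := exists_shalikaFunctional hψ ht
  rw [sub_eq_zero]
  exact mul_right_cancel₀ hne ((hv.2 t hq Λ hΛ).symm.trans (hv'.2 t hq Λ hΛ))

end Coefficients

/-! ### Regular families as combinations of constant ones. -/

section Decomposition

universe u

variable {F : Type u} [Field F] [ValuativeRel F] [TopologicalSpace F]
  [IsNonarchimedeanLocalField F] {n : ℕ} {γ : ValueGroupWithZero F} {Q : Poly n} {v : Fam F n}

/-- The family of extensions of an element of `X`. -/
def constFam (x : X F n) : Fam F n := fun t => ext (chiOf t) x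

lemma isRegFam_constFam (hQ : ∀ i, MvPolynomial.X i ∣ Q) (x : X F n) : IsRegFam Q (constFam x) :=
  isRegFam_ext hQ x

/-- The equivalence relation on `K` whose classes are the double cosets of `P ∩ K` and a congruence
subgroup. -/
def classSetoid (F : Type*) [Field F] [ValuativeRel F] [TopologicalSpace F]
    [IsNonarchimedeanLocalField F] (n : ℕ) (γ : ValueGroupWithZero F) : Setoid (maxCompact F n) :=
  DoubleCoset.setoid ((borelSubgroup F n).subgroupOf (maxCompact F n))
    ((cong n γ).subgroupOf (maxCompact F n))

lemma classSetoid_rel {k k' : maxCompact F n} : classSetoid F n γ k k' ↔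
    ∃ p : maxCompact F n, (p : G F n) ∈ borelSubgroup F n ∧
      ∃ c : maxCompact F n, (c : G F n) ∈ cong n γ ∧ k' = p * k * c :=
  DoubleCoset.rel_iff

/-- K modulo an open subgroup is already finite, since K is compact. -/
lemma finite_classes (hγ : γ ≠ 0) : Finite (Quotient (classSetoid F n γ)) := by
  have h1 : IsOpen ((cong n γ).subgroupOf (maxCompact F n) : Set (maxCompact F n)) :=
    (isOpen_cong hγ).preimage continuous_subtype_val
  have : CompactSpace (maxCompact F n) := isCompact_iff_compactSpace.1 isCompact_maxCompact
  have h2 : Finite (maxCompact F n ⧸ (cong n γ).subgroupOf (maxCompact F n)) :=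
    Subgroup.quotient_finite_of_isOpen _ h1
  refine Finite.of_surjective
    (fun q : maxCompact F n ⧸ (cong n γ).subgroupOf (maxCompact F n) =>
      (Quotient.mk (classSetoid F n γ) q.out)) fun q => ?_
  induction q using Quotient.inductionOn with
  | _ k =>
    refine ⟨(k : maxCompact F n ⧸ (cong n γ).subgroupOf (maxCompact F n)), Quotient.sound ?_⟩
    obtain ⟨c, hc⟩ := QuotientGroup.mk_out_eq_mul ((cong n γ).subgroupOf (maxCompact F n)) k
    rw [hc]
    exact (classSetoid F n γ).symm (classSetoid_rel.2 ⟨1, one_mem _, c, c.2, by rw [one_mul]⟩)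

open Classical in
/-- The indicator function of a class. -/
def classInd (hγ : γ ≠ 0) (q : Quotient (classSetoid F n γ)) : X F n :=
  ⟨fun k => if Quotient.mk _ k = q then 1 else 0, by
    refine ⟨(IsLocallyConstant.iff_exists_open _).2 fun k =>
      ⟨(fun x => k⁻¹ * x) ⁻¹' ((cong n γ).subgroupOf (maxCompact F n) : Set (maxCompact F n)),
        ((isOpen_cong hγ).preimage continuous_subtype_val).preimage (continuous_const_mul _),
        by simp [one_mem], fun x hx => ?_⟩, fun p hp k => ?_⟩
    · have h1 : Quotient.mk (classSetoid F n γ) k = Quotient.mk _ x :=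
        Quotient.sound (classSetoid_rel.2 ⟨1, one_mem _, k⁻¹ * x, hx, by group⟩)
      simp only [h1]
    · have h1 : Quotient.mk (classSetoid F n γ) k = Quotient.mk _ (p * k) :=
        Quotient.sound (classSetoid_rel.2 ⟨p, hp, 1, one_mem _, by group⟩)
      simp only [h1]⟩

/-- Regular families are combinations of constant families in `X`. -/
lemma IsRegFam.exists_eq_sum (hv : IsRegFam Q v) : ∃ (ι : Type u) (_ : Fintype ι) (a : ι → G F n)
    (x : ι → X F n), v = ∑ i, Shalika.scale (fun t => (v t).1 (a i)) (constFam (x i)) := by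
  classical
  obtain ⟨γ, hγ, hc⟩ := hv.exists_cong
  have := finite_classes (F := F) (n := n) hγ
  refine ⟨Quotient (classSetoid F n γ), Fintype.ofFinite _, fun q => q.out, classInd hγ,
    funext fun t => I_ext fun k hk => ?_⟩
  have h1 : ∀ q : Quotient (classSetoid F n γ), (ext (chiOf t) (classInd hγ q)).1 k =
      if Quotient.mk _ ⟨k, hk⟩ = q then 1 else 0 := fun q =>
    congrFun (congrArg Subtype.val (resK_ext (chiOf t) (classInd hγ q))) ⟨k, hk⟩
  rw [Finset.sum_apply]
  simp only [Shalika.scale, constFam, AddSubmonoidClass.coe_finsetSum, Finset.sum_apply, SetLike.val_smul,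
    Pi.smul_apply, smul_eq_mul, h1, mul_ite, mul_one, mul_zero, Finset.sum_ite_eq,
    Finset.mem_univ, if_true]
  obtain ⟨p, hp, c, hcm, heq⟩ := classSetoid_rel.1
    (Quotient.mk_out (s := classSetoid F n γ) ⟨k, hk⟩)
  have h2 : k = p * (Quotient.out (Quotient.mk (classSetoid F n γ) ⟨k, hk⟩)).1 * c :=
    congrArg Subtype.val heq
  conv_lhs => rw [h2]
  rw [hc t _ _ hcm, (v t).2.2 _ hp, chiDelta_eq_one _ hp p.2, one_mul]

end Decomposition

/-! ### Rational functions and their values. -/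

section RationalValues

variable {n : ℕ} {Q : Poly n} {h h' : D n → ℂ} {r r' : L n}

/-- The values of the function `h` at the points where `Q ≠ 0` are those of the rational function
`r`, which has no poles there. -/
def HasValues (Q : Poly n) (r : L n) (h : D n → ℂ) : Prop :=
  ∃ (k : ℕ) (N : Poly n), algebraMap (Poly n) (L n) Q ^ k * r = algebraMap (Poly n) (L n) N ∧
    ∀ t, evalAt t Q ≠ 0 → evalAt t Q ^ k * h t = evalAt t N

lemma algebraMap_ne_zero (hQ : Q ≠ 0) : algebraMap (Poly n) (L n) Q ≠ 0 :=
  (map_ne_zero_iff _ (IsFractionRing.injective (Poly n) (L n))).2 hQ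

lemma IsReg.exists_hasValues (hQ : Q ≠ 0) (hh : IsReg Q h) : ∃ r, HasValues Q r h := by
  obtain ⟨k, N, hN⟩ := hh
  refine ⟨algebraMap (Poly n) (L n) N / algebraMap (Poly n) (L n) Q ^ k, k, N, ?_, hN⟩
  rw [mul_div_cancel₀ _ (pow_ne_zero _ (algebraMap_ne_zero hQ))]

/-- After clearing powers of Q, equality of values is equality of polynomials at all points of the
torus with Q ≠ 0, hence an identity. -/
lemma HasValues.eq (hQ : Q ≠ 0) (hr : HasValues Q r h) (hr' : HasValues Q r' h')
    (H : ∀ t, evalAt t Q ≠ 0 → h t = h' t) : r = r' := by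
  obtain ⟨k, N, h1, h2⟩ := hr
  obtain ⟨k', N', h1', h2'⟩ := hr'
  have h3 : N * Q ^ k' - N' * Q ^ k = 0 := by
    have : Infinite ℂˣ := Set.infinite_univ_iff.1
      ((infinite_norm_eq one_pos).mono (Set.subset_univ _))
    refine eq_zero_of_evalAt hQ (fun _ => Set.univ) (fun _ => Set.infinite_univ) fun t _ ht => ?_
    rw [map_sub, map_mul, map_mul, ← h2 t ht, ← h2' t ht, H t ht, map_pow, map_pow]
    ring
  have h4 : algebraMap (Poly n) (L n) N * algebraMap (Poly n) (L n) Q ^ k' =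
      algebraMap (Poly n) (L n) N' * algebraMap (Poly n) (L n) Q ^ k := by
    rw [← map_pow, ← map_pow, ← map_mul, ← map_mul, sub_eq_zero.1 h3]
  rw [← h1, ← h1'] at h4
  refine mul_left_cancel₀ (pow_ne_zero (k + k') (algebraMap_ne_zero hQ)) ?_
  linear_combination h4

lemma HasValues.add (hr : HasValues Q r h) (hr' : HasValues Q r' h') :
    HasValues Q (r + r') fun t => h t + h' t := by
  obtain ⟨k, N, h1, h2⟩ := hr
  obtain ⟨k', N', h1', h2'⟩ := hr'
  refine ⟨k + k', Q ^ k' * N + Q ^ k * N', ?_, fun t ht => ?_⟩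
  · rw [map_add, map_mul, map_mul, ← h1, ← h1', map_pow, map_pow]
    ring
  · rw [map_add, map_mul, map_mul, ← h2 t ht, ← h2' t ht, map_pow, map_pow]
    ring

lemma HasValues.mul (p : Poly n) (hr : HasValues Q r h) :
    HasValues Q (algebraMap (Poly n) (L n) p * r) fun t => evalAt t p * h t := by
  obtain ⟨k, N, h1, h2⟩ := hr
  refine ⟨k, p * N, ?_, fun t ht => ?_⟩
  · rw [map_mul, ← h1]
    ring
  · rw [map_mul, ← h2 t ht]
    ring

lemma HasValues.smul (c : ℂ) (hr : HasValues Q r h) :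
    HasValues Q (c • r) fun t => c * h t := by
  have h1 := hr.mul (MvPolynomial.C c)
  have h2 : algebraMap (Poly n) (L n) (MvPolynomial.C c) * r = c • r := by
    rw [← MvPolynomial.algebraMap_eq, ← IsScalarTower.algebraMap_apply, Algebra.smul_def]
  rw [h2] at h1
  simpa [evalAt] using h1

lemma hasValues_zero : HasValues Q 0 fun _ => 0 := ⟨0, 0, by simp, by simp⟩

end RationalValues

/-! ### The normalized functional and its rationality. -/

section Normalized

variable {F : Type*} [Field F] [ValuativeRel F] [TopologicalSpace F]
  [IsNonarchimedeanLocalField F] {n : ℕ} {ψ : AddChar F Circle} {Q : Poly n} {t : D n}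

lemma constFam_add (x y : X F n) : constFam (x + y) = constFam x + constFam y :=
  funext fun t => map_add (ext (chiOf t)) x y

lemma constFam_smul (c : ℂ) (x : X F n) :
    constFam (c • x) = scale (fun _ => c) (constFam x) :=
  funext fun t => map_smul (ext (chiOf t)) c x

lemma constFam_sum {ι : Type*} (s : Finset ι) (c : ι → ℂ) (x : ι → X F n) :
    constFam (∑ i ∈ s, c i • x i) = ∑ i ∈ s, scale (fun _ => c i) (constFam (x i)) :=
  funext fun t => by
    rw [Finset.sum_apply]
    exact (map_sum (ext (chiOf t)) _ _).trans
      (Finset.sum_congr rfl fun i _ => map_smul (ext (chiOf t)) (c i) (x i))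

variable {c : X F n → D n → ℂ}

/-- The coefficient of a regular family at a point depends only on its value at this point. -/
lemma IsCoef.eq_resK (hψ : ConductorIsIntegers ψ) (hQ : Q ≠ 0)
    (hc : ∀ x, IsCoef ψ Q (constFam x) (c x)) {v : Fam F n} (hreg : IsRegFam Q v) {h : D n → ℂ}
    (hv : IsCoef ψ Q v h) (ht : evalAt t Q ≠ 0) : h t = c (resK (chiOf t) (v t)) t := by
  obtain ⟨ι, _, a, x, hsum⟩ := hreg.exists_eq_sum
  have h1 : IsCoef ψ Q v fun s => ∑ i, (v s).1 (a i) * c (x i) s := by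
    have h2 := IsCoef.sum Finset.univ fun i _ => (hc (x i)).scale (hreg.isReg (a i))
    rwa [← hsum] at h2
  rw [hv.eq hψ hQ h1 ht]
  have h3 : resK (chiOf t) (v t) = ∑ i, (v t).1 (a i) • x i := by
    refine ext_injective (chiOf t) ?_
    rw [ext_resK, map_sum]
    have h4 := congrFun hsum t
    rw [Finset.sum_apply] at h4
    refine h4.trans (Finset.sum_congr rfl fun i _ => ?_)
    rw [map_smul]
    rfl
  -- The constant family through v t is the same combination with weights frozen at t. Its
  -- coefficient agrees at t with that of v.
  have h5 : IsCoef ψ Q (constFam (∑ i, (v t).1 (a i) • x i))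
      fun s => ∑ i, (v t).1 (a i) * c (x i) s := by
    rw [constFam_sum]
    exact IsCoef.sum Finset.univ fun i _ => (hc (x i)).scale (isReg_const _)
  rw [h3]
  exact h5.eq hψ hQ (hc _) ht

/-- The normalized Shalika functional given by the coefficients of constant families. -/
lemma exists_isNormalizedShalikaFunctional (hψ : ConductorIsIntegers ψ) (hQ : Q ≠ 0)
    (hQX : ∀ i, MvPolynomial.X i ∣ Q) (hc : ∀ x, IsCoef ψ Q (constFam x) (c x))
    (ht : evalAt t Q ≠ 0) :
    ∃ Λ : I F (chiOf t) →ₗ[ℂ] ℂ, IsNormalizedShalikaFunctional ψ Λ := by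
  let Λ : I F (chiOf t) →ₗ[ℂ] ℂ :=
    { toFun := fun v => c (resK (chiOf t) v) t
      map_add' := fun v v' => by
        rw [map_add]
        refine (hc _).eq hψ hQ ?_ ht (h' := fun s => c (resK (chiOf t) v) s + c (resK (chiOf t) v') s)
        rw [constFam_add]
        exact (hc _).add (hc _)
      map_smul' := fun a v => by
        rw [map_smul]
        refine (hc _).eq hψ hQ ?_ ht (h' := fun s => a * c (resK (chiOf t) v) s)
        rw [constFam_smul]
        exact (hc _).scale (isReg_const a) }
  refine ⟨Λ, (isShalikaFunctional_iff ψ).2 fun s hs v => ?_, ?_⟩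
  -- A translate of a constant family is in general no longer constant, so its coefficient is
  -- compared at the single point t by `IsCoef.eq_resK`.
  · have h1 := ((hc (resK (chiOf t) v)).translate hs).eq_resK hψ hQ hc
      ((isRegFam_constFam hQX (resK (chiOf t) v)).translate s) ht
    have h2 : translate s (constFam (resK (chiOf t) v)) t = principalSeries (chiOf t) s v := by
      rw [translate, constFam, ext_resK]
    rw [h2] at h1
    exact h1.symm
  · exact (isCoef_testVec.eq_resK hψ hQ hc ((isRegFam_phiB hQX).translate (xi F n)⁻¹) ht).symm

lemma IsNormalizedShalikaFunctional.apply_testVec {Λ : I F (chiOf t) →ₗ[ℂ] ℂ}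
    (hΛ : IsNormalizedShalikaFunctional ψ Λ) : Λ (testVec F n t) = 1 := hΛ.2

lemma IsNormalizedShalikaFunctional.apply_eq (hc : ∀ x, IsCoef ψ Q (constFam x) (c x))
    (ht : evalAt t Q ≠ 0) {Λ : I F (chiOf t) →ₗ[ℂ] ℂ} (hΛ : IsNormalizedShalikaFunctional ψ Λ)
    (v : I F (chiOf t)) : Λ v = c (resK (chiOf t) v) t := by
  have h1 := (hc (resK (chiOf t) v)).2 t ht Λ hΛ.1
  rw [hΛ.apply_testVec, mul_one, constFam, ext_resK] at h1
  exact h1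

lemma IsNormalizedShalikaFunctional.toH_ext {b : X F n → D n → ℂ}
    (hb : ∀ x, IsCoef ψ Q (translate (xi F n)⁻¹ (constFam x)) (b x))
    (ht : evalAt t Q ≠ 0) {Λ : I F (chiOf t) →ₗ[ℂ] ℂ} (hΛ : IsNormalizedShalikaFunctional ψ Λ)
    (x : X F n) : toH Λ (ext (chiOf t) x) = b x t := by
  have h1 := (hb x).2 t ht Λ hΛ.1
  rw [hΛ.apply_testVec, mul_one] at h1
  exact h1

lemma translate_add (g : G F n) (v v' : Fam F n) :
    translate g (v + v') = translate g v + translate g v' :=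
  funext fun t => map_add (principalSeries (chiOf t) g) (v t) (v' t)

lemma translate_scale (g : G F n) (a : D n → ℂ) (v : Fam F n) :
    translate g (scale a v) = scale a (translate g v) :=
  funext fun t => map_smul (principalSeries (chiOf t) g) (a t) (v t)

/-- The values of the normalized Shalika functionals on constant families are rational functions
that depend linearly on the family. -/
lemma exists_linearMap_hasValues (hψ : ConductorIsIntegers ψ) (hQ : Q ≠ 0) {b : X F n → D n → ℂ}
    (hb : ∀ x, IsCoef ψ Q (translate (xi F n)⁻¹ (constFam x)) (b x)) :
    ∃ a : X F n →ₗ[ℂ] L n, ∀ x, HasValues Q (a x) (b x) := by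
  choose a ha using fun x => (hb x).1.exists_hasValues hQ
  refine ⟨{ toFun := a, map_add' := fun x y => ?_, map_smul' := fun c x => ?_ }, ha⟩
  · refine (ha _).eq hQ ((ha x).add (ha y)) fun t ht => (hb _).eq hψ hQ (h' := fun s => b x s + b y s) ?_ ht
    rw [constFam_add, translate_add]
    exact (hb x).add (hb y)
  · refine (ha _).eq hQ ((ha x).smul c) fun t ht => (hb _).eq hψ hQ (h' := fun s => c * b x s) ?_ ht
    rw [constFam_smul, translate_scale]
    exact (hb x).scale (isReg_const c)

/-- The case of polynomial families: evaluation commutes with the linear extension of a, as one sees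
on pure tensors. -/
lemma exists_hasValues_liftBaseChange {b : X F n → D n → ℂ}
    (hb : ∀ x, IsCoef ψ Q (translate (xi F n)⁻¹ (constFam x)) (b x)) {a : X F n →ₗ[ℂ] L n}
    (ha : ∀ x, HasValues Q (a x) (b x)) (y : Poly n ⊗[ℂ] X F n) :
    ∃ h, HasValues Q (a.liftBaseChange (L n)
        ((IsScalarTower.toAlgHom ℂ (Poly n) (L n)).toLinearMap.rTensor (X F n) y)) h ∧
      ∀ t, evalAt t Q ≠ 0 → ∀ Λ : I F (chiOf t) →ₗ[ℂ] ℂ, IsNormalizedShalikaFunctional ψ Λ →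
        toH Λ (ext (chiOf t) (TensorProduct.lid ℂ (X F n)
          ((evalAt t).toLinearMap.rTensor (X F n) y))) = h t := by
  induction y using TensorProduct.induction_on with
  | zero => exact ⟨fun _ => 0, by simpa using hasValues_zero, fun t ht Λ hΛ => by simp⟩
  | tmul p x =>
    refine ⟨_, (ha x).mul p, fun t ht Λ hΛ => ?_⟩
    rw [LinearMap.rTensor_tmul, TensorProduct.lid_tmul, map_smul, map_smul, hΛ.toH_ext hb ht]
    rfl
  | add y y' ih ih' =>
    obtain ⟨h, h1, h2⟩ := ih
    obtain ⟨h', h1', h2'⟩ := ih'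
    refine ⟨fun t => h t + h' t, ?_, fun t ht Λ hΛ => ?_⟩
    · rw [map_add, map_add]
      exact h1.add h1'
    · rw [map_add, map_add, map_add, map_add, h2 t ht Λ hΛ, h2' t ht Λ hΛ]

/-- Besides the power of Q from the coefficients, the only denominator is d, the one that witnesses
regularity of the family at t. So the value is regular wherever the family is. -/
lemma hasValueAt_toH {b : X F n → D n → ℂ}
    (hb : ∀ x, IsCoef ψ Q (translate (xi F n)⁻¹ (constFam x)) (b x)) {a : X F n →ₗ[ℂ] L n}
    (ha : ∀ x, HasValues Q (a x) (b x)) (φ : L n ⊗[ℂ] X F n) (ht : evalAt t Q ≠ 0)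
    {Λ : I F (chiOf t) →ₗ[ℂ] ℂ} (hΛ : IsNormalizedShalikaFunctional ψ Λ) {v : I F (chiOf t)}
    (hv : HasVectorValueAt φ t (resK (chiOf t) v)) :
    HasValueAt (a.liftBaseChange (L n) φ) t (toH Λ v) := by
  obtain ⟨y, d, hd, h1, h2⟩ := hv
  obtain ⟨h, ⟨k, N, hN, hN'⟩, hh⟩ := exists_hasValues_liftBaseChange hb ha y
  have h3 := hh t ht Λ hΛ
  rw [← h2, map_smul, map_smul, ext_resK, smul_eq_mul] at h3
  rw [← h1, map_smul, smul_eq_mul] at hN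
  refine ⟨N, Q ^ k * d, ?_, ?_, ?_⟩
  · rw [map_mul, map_pow]
    exact mul_ne_zero (pow_ne_zero _ ht) hd
  · rw [map_mul, map_pow, mul_assoc, hN]
  · rw [map_mul, map_pow, mul_assoc, h3, hN' t ht]

end Normalized

end Shalika

end

theorem mainTheorem5 {F : Type*} [Field F] [ValuativeRel F] [TopologicalSpace F]
    [IsNonarchimedeanLocalField F] (n : ℕ) (ψ : AddChar F Circle)
    (hψ : Shalika.ConductorIsIntegers ψ) :
    ∃ Q : Shalika.Poly n, Q ≠ 0 ∧
      (∀ t : Shalika.D n, Shalika.evalAt t Q ≠ 0 →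
        (∃ Λ : Shalika.I F (Shalika.chiOf t) →ₗ[ℂ] ℂ,
          Shalika.IsShalikaFunctional ψ Λ ∧ Λ ≠ 0) ∧
        (∃! Λ : Shalika.I F (Shalika.chiOf t) →ₗ[ℂ] ℂ,
          Shalika.IsNormalizedShalikaFunctional ψ Λ)) ∧
      ∀ φ : TensorProduct ℂ (Shalika.L n) (Shalika.X F n), ∃ r : Shalika.L n,
        ∀ t : Shalika.D n, Shalika.evalAt t Q ≠ 0 →
          ∀ Λ : Shalika.I F (Shalika.chiOf t) →ₗ[ℂ] ℂ,
            Shalika.IsNormalizedShalikaFunctional ψ Λ →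
            ∀ v : Shalika.I F (Shalika.chiOf t),
              Shalika.HasVectorValueAt φ t (Shalika.resK (Shalika.chiOf t) v) →
              Shalika.HasValueAt r t (Shalika.toH Λ v) := by
  obtain ⟨Q, hQ, hQX, hdet⟩ := Shalika.exists_isDetermined (n := n) hψ
  -- The coefficients c define the functional Λ. The coefficients b, of the families translated by
  -- ξ⁻¹, give the values of Λ_H.
  choose c hc using fun x : Shalika.X F n =>
    hdet (Shalika.constFam x) (Shalika.isRegFam_constFam hQX x)
  choose b hb using fun x : Shalika.X F n =>
    hdet (Shalika.translate (Shalika.xi F n)⁻¹ (Shalika.constFam x))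
      ((Shalika.isRegFam_constFam hQX x).translate _)
  refine ⟨Q, hQ, fun t ht => ?_, fun φ => ?_⟩
  · obtain ⟨Λ, hΛ⟩ := Shalika.exists_isNormalizedShalikaFunctional hψ hQ hQX hc ht
    refine ⟨⟨Λ, hΛ.1, ?_⟩, Λ, hΛ, fun Λ' hΛ' => LinearMap.ext fun v => ?_⟩
    · rintro rfl
      exact zero_ne_one hΛ.apply_testVec
    · rw [hΛ.apply_eq hc ht, hΛ'.apply_eq hc ht]
  · obtain ⟨a, ha⟩ := Shalika.exists_linearMap_hasValues hψ hQ hb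
    exact ⟨a.liftBaseChange _ φ, fun t ht Λ hΛ v hv => Shalika.hasValueAt_toH hb ha φ ht hΛ hv⟩
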